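/- Let $X\subset\mathbb R^d$ be a compact connected set, $\Psi_1,\dots,\Psi_N$ strictly contractive similitudes of $\mathbb R^d$ with distinct fixed points such that $X=\bigcup_i\Psi_i(X)$, and $F$ a subset of the set of these fixed points with $\Psi_i(X)\cap\Psi_j(X)=\Psi_i(F)\cap\Psi_j(F)$ for $i\neq j$. Let $\alpha_i,\beta_i\in(0,1)$ with $\sum_i\beta_i=1$ and $\alpha_i\beta_i$ independent of $i$. Let $A f(x)=-\sum_{y\in F,\,y\ne x}a_{x,y}(f(y)-f(x))$ on $F$, with $a_{x,y}=a_{y,x}\ge 0$ and the graph $\{a_{x,y}>0\}$ on $F$ connected, and let $b$ be a strictly positive measure on $F$. Let $\omega\in\Omega=\{1,\dots,N\}^{\mathbb N}$, with the product of the uniform measures. For a word $j=(j_1,\dots,j_n)$ put $c_{j}=\Psi_{\omega_1}^{-1}\circ\cdots\circ\Psi_{\omega_n}^{-1}\circ\Psi_{j_1}\circ\cdots\circ\Psi_{j_n}$. Set $F_{<n>}=\bigcup_j c_j(F)$, $F_{<\infty>}=\bigcup_n F_{<n>}$, $\partial F_{<n>}=\Psi_{\omega_1}^{-1}\circ\cdots\circ\Psi_{\omega_n}^{-1}(F)$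 and $\partial F_{<\infty>}=\bigcap_n\bigcup_{m\ge n}\partial F_{<m>}$. On $F_{<n>}$ let $$A_{<n>}=\sum_{j}\alpha_{\omega_1}\cdots\alpha_{\omega_n}\alpha_{j_1}^{-1}\cdots\alpha_{j_n}^{-1}A_{<n>,j},\qquad b_{<n>}=\sum_{j}\beta_{\omega_1}^{-1}\cdots\beta_{\omega_n}^{-1}\beta_{j_1}\cdots\beta_{j_n}\,b_{<n>,j},$$ where $A_{<n>,j}$, $b_{<n>,j}$ are the copies of $A$, $b$ on the cell $c_j(F)$. Let $b_{<\infty>}$ and $A_{<\infty>}$ be the limits of $b_{<n>}$ and $A_{<n>}$ as $n\to\infty$; let $\mathcal D^+=L^2(F_{<\infty>},b_{<\infty>})$ and $\mathcal D^-=\{f\in\mathcal D^+: f=0\text{ on }\partial F_{<\infty>}\}$; and let $H^\pm(\omega)$ be the bounded self-adjoint operator on $\mathcal D^\pm$ with $\langle A_{<\infty>}f,g\rangle=-\int (H^\pm f)\,\bar g\,db_{<\infty>}$ for $f,g\in\mathcal D^\pm$. Almost surely $\partial F_{<\infty>}=\emptyset$, and then $H^+=H^-$. Let $\sigma(f)$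 be the spectral measure of $f$ for $H^\pm$, with absolutely continuous, singular continuous and pure point parts $\sigma_{ac}(f)$, $\sigma_{sc}(f)$, $\sigma_{pp}(f)$. Let $\mathcal H_{ac}$, $\mathcal H_{sc}$, $\mathcal H_{pp}$ be the subspaces of the $f$ whose spectral measure is of the corresponding type. Let $\mathcal H_{ND}$ be the closed span of the Neumann-Dirichlet eigenfunctions, that is, of the functions $f$ vanishing outside $F_{<n>}\setminus\partial F_{<n>}$ for some $n$ and satisfying, for some $\lambda\in\mathbb R$, $\langle A_{<n>}f,g\rangle=-\lambda\int f\bar g\,db_{<n>}$ for all $g$ on $F_{<n>}$. Let $\tilde{\mathcal H}_{pp}$ be the orthogonal complement of $\mathcal H_{ND}$ in $\mathcal H_{pp}$, and let $\tilde\sigma_{pp}(f)$ be the pure point part of the spectral measure of the projection of $f$ on $\mathcal H_{ND}^\perp$. Let $\Sigma^\pm_{ac}(\omega)$, $\Sigma^\pm_{sc}(\omega)$, $\Sigma^\pm_{pp}(\omega)$, $\tilde\Sigma^\pm_{pp}(\omega)$ be the spectra of the restrictions of $H^\pm(\omega)$ to $\mathcal H_{ac}$, $\mathcal H_{sc}$,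 $\mathcal H_{pp}$, $\tilde{\mathcal H}_{pp}$. For $\cdot\in\{ac,sc,pp\}$ define $$\mu^{\cdot}(d\lambda)=\mathbb E\Big(\sum_{x\in F}\frac{b(x)}{b_{<\infty>}(x)^2}\,\sigma_{\cdot}(\delta_x)(d\lambda,\omega)\Big),$$ and define $\tilde\mu^{pp}$ in the same way with $\tilde\sigma_{pp}$; the random measures under the expectation are measurable in $\omega$, up to a null set. Then these measures determine the almost sure components of the spectrum: for almost every $\omega$ and for both boundary conditions, $$\Sigma^\pm_{ac}(\omega)=\operatorname{supp}\mu^{ac},\quad \Sigma^\pm_{sc}(\omega)=\operatorname{supp}\mu^{sc},\quad \Sigma^\pm_{pp}(\omega)=\operatorname{supp}\mu^{pp},\quad \tilde\Sigma^\pm_{pp}(\omega)=\operatorname{supp}\tilde\mu^{pp}.$$ -/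

import Mathlib

open MeasureTheory Filter Topology
open scoped ENNReal

/- So that `inner ℂ` always means the inner product of the inner product space. -/
attribute [-instance] WithCStarModule.instCStarModuleComplex

noncomputable section

/-- The data of the discrete model: a finitely ramified self-similar set `X` in `ℝ^d` with boundary
`F`, the scaling weights `α`, `β`, and the initial discrete operator and measure on `F`. -/
structure SelfSimilarLattice (d N : ℕ) where
  /-- the self-similar set -/
  X : Set (EuclideanSpace ℝ (Fin d))
  /-- the contractive similitudes (a similitude of `ℝ^d` is bijective) -/
  Ψ : Fin N → (EuclideanSpace ℝ (Fin d) ≃ᵈ EuclideanSpace ℝ (Fin d))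
  /-- the boundary set -/
  F : Finset (EuclideanSpace ℝ (Fin d))
  isCompact_X : IsCompact X
  isConnected_X : IsConnected X
  ratio_lt_one : ∀ i, Dilation.ratio (Ψ i) < 1
  fixed_distinct : ∀ i j p, Ψ i p = p → Ψ j p = p → i = j
  self_similar : X = ⋃ i, Ψ i '' X
  F_fixed : ∀ p ∈ F, ∃ i, Ψ i p = p
  ramified : ∀ i j, i ≠ j →
    Ψ i '' X ∩ Ψ j '' X = (Ψ i '' (F : Set (EuclideanSpace ℝ (Fin d)))) ∩
      (Ψ j '' (F : Set (EuclideanSpace ℝ (Fin d))))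
  /-- energy weights -/
  α : Fin N → ℝ
  /-- measure weights -/
  β : Fin N → ℝ
  α_mem : ∀ i, α i ∈ Set.Ioo (0 : ℝ) 1
  β_mem : ∀ i, β i ∈ Set.Ioo (0 : ℝ) 1
  β_sum : ∑ i, β i = 1
  /-- `(α i * β i)⁻¹` does not depend on `i` -/
  lattice_case : ∀ i j, (α i * β i)⁻¹ = (α j * β j)⁻¹
  /-- the conductances (only the values off the diagonal matter) -/
  a : F → F → ℝ
  a_nonneg : ∀ x y, x ≠ y → 0 ≤ a x y
  a_symm : ∀ x y, a x y = a y x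
  /-- irreducibility: the graph of the positive conductances is connected -/
  a_irred : (SimpleGraph.fromRel (fun x y : F => 0 < a x y)).Connected
  /-- the initial measure -/
  b : F → ℝ
  b_pos : ∀ x, 0 < b x

/-- Neumann (`+`) or Dirichlet (`-`) condition on the boundary of the infinite lattice. -/
inductive BoundaryCondition
  | neumann
  | dirichlet

/-! ### Spectral measures and spectral components of a bounded self-adjoint operator -/

section Spectral

variable {V : Type*} [NormedAddCommGroup V] [InnerProductSpace ℂ V] [CompleteSpace V]

/-- The positive functional `φ ↦ ⟪f, φ(T) f⟫` on `C_c(ℝ, ℝ)`, with `φ(T)` the functional calculus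
of the self-adjoint operator `T`. -/
def spectralFunctional (T : V →L[ℂ] V) (f : V) : CompactlySupportedContinuousMap ℝ ℝ →ₚ[ℝ] ℝ :=
  PositiveLinearMap.mk₀
    { toFun := fun φ => (inner ℂ f (cfc (φ : ℝ → ℝ) T f)).re
      map_add' := fun φ ψ => by
        have h := cfc_add (R := ℝ) T (φ : ℝ → ℝ) (ψ : ℝ → ℝ)
          φ.continuous.continuousOn ψ.continuous.continuousOn
        have e : ((φ + ψ : CompactlySupportedContinuousMap ℝ ℝ) : ℝ → ℝ) = fun x => φ x + ψ x :=
          rfl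
        rw [e, h, add_apply, inner_add_right, Complex.add_re]
      map_smul' := fun c φ => by
        have h := cfc_smul (R := ℝ) c (φ : ℝ → ℝ) T φ.continuous.continuousOn
        have e : ((c • φ : CompactlySupportedContinuousMap ℝ ℝ) : ℝ → ℝ) = fun x => c • φ x :=
          rfl
        rw [e, h, smul_apply, inner_smul_right_eq_smul, Complex.smul_re]
        rfl }
    (fun φ hφ => by
      have h : (0 : V →L[ℂ] V) ≤ cfc (φ : ℝ → ℝ) T := cfc_nonneg (fun x _ => hφ x)
      rw [ContinuousLinearMap.nonneg_iff_isPositive] at h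
      exact (Complex.le_def.1 (h.inner_nonneg_right f)).1)

/-- The spectral measure `σ(f)` of the vector `f` for the self-adjoint operator `T`: the Radon
measure on `ℝ` with `∫ φ dσ(f) = ⟪f, φ(T) f⟫`, that is `σ(f)(B) = ‖1_B(T) f‖²`. -/
def spectralMeasure (T : V →L[ℂ] V) (f : V) : Measure ℝ :=
  RealRMK.rieszMeasure (spectralFunctional T f)

/-- Absolutely continuous part of a measure on the line. -/
def acPart (σ : Measure ℝ) : Measure ℝ := volume.withDensity (σ.rnDeriv volume)

/-- Pure point part of a measure on the line. -/
def ppPart (σ : Measure ℝ) : Measure ℝ := σ.restrict {t | σ {t} ≠ 0}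

/-- Singular continuous part of a measure on the line. -/
def scPart (σ : Measure ℝ) : Measure ℝ := (σ.singularPart volume).restrict {t | σ {t} = 0}

/-- Vectors with absolutely continuous spectral measure. -/
def acSpace (T : V →L[ℂ] V) : Set V := {f | spectralMeasure T f ≪ volume}

/-- Vectors with singular continuous spectral measure. -/
def scSpace (T : V →L[ℂ] V) : Set V :=
  {f | spectralMeasure T f ⟂ₘ volume ∧ ∀ t, spectralMeasure T f {t} = 0}

/-- Vectors with purely atomic spectral measure. -/
def ppSpace (T : V →L[ℂ] V) : Set V :=
  {f | ∃ C : Set ℝ, C.Countable ∧ spectralMeasure T f Cᶜ = 0}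

/-- The spectrum of the restriction of the self-adjoint operator `T` to an invariant closed subspace
`K`: `t` is outside of it iff `T - t` is a bijection of `K` onto `K` with bounded inverse. -/
def restrictedSpectrum (T : V →L[ℂ] V) (K : Set V) : Set ℝ :=
  {t | ¬ (Set.BijOn (fun f => T f - (t : ℂ) • f) K K ∧
    ∃ C : ℝ, ∀ f ∈ K, ‖f‖ ≤ C * ‖T f - (t : ℂ) • f‖)}

end Spectral

namespace SelfSimilarLattice

variable {d N : ℕ} (S : SelfSimilarLattice d N)

/-! ### The blown-up lattices -/

/-- The product of the uniform measures on the blow-ups `ω`. -/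
def blowUpLaw (N : ℕ) : Measure (ℕ → Fin N) :=
  Measure.infinitePi (fun _ : ℕ => ProbabilityTheory.uniformOn (Set.univ : Set (Fin N)))

/-- `Ψ_{ω₁}⁻¹ ∘ ⋯ ∘ Ψ_{ωₙ}⁻¹` (the letters of `ω` are numbered from `0` here). -/
def blowUp (ω : ℕ → Fin N) (n : ℕ) : EuclideanSpace ℝ (Fin d) ≃ᵈ EuclideanSpace ℝ (Fin d) :=
  (List.ofFn fun k : Fin n => (S.Ψ (ω k))⁻¹).prod

/-- The map `Ψ_{ω₁}⁻¹ ∘ ⋯ ∘ Ψ_{ωₙ}⁻¹ ∘ Ψ_{j₁} ∘ ⋯ ∘ Ψ_{jₙ}`, carrying `F` to the `0`-cell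
`F_{<n>,j₁,…,jₙ}`. -/
def cell (ω : ℕ → Fin N) {n : ℕ} (j : Fin n → Fin N) :
    EuclideanSpace ℝ (Fin d) ≃ᵈ EuclideanSpace ℝ (Fin d) :=
  S.blowUp ω n * (List.ofFn fun k : Fin n => S.Ψ (j k)).prod

open Classical in
/-- The finite lattice `F_{<n>}`. -/
def pts (ω : ℕ → Fin N) (n : ℕ) : Finset (EuclideanSpace ℝ (Fin d)) :=
  Finset.univ.image (fun p : (Fin n → Fin N) × S.F => S.cell ω p.1 p.2)

/-- The infinite lattice `F_{<∞>}`. -/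
def ptsInf (ω : ℕ → Fin N) : Set (EuclideanSpace ℝ (Fin d)) :=
  ⋃ n, (S.pts ω n : Set (EuclideanSpace ℝ (Fin d)))

/-- The boundary `∂F_{<n>}`. -/
def bdry (ω : ℕ → Fin N) (n : ℕ) : Set (EuclideanSpace ℝ (Fin d)) :=
  S.blowUp ω n '' (S.F : Set (EuclideanSpace ℝ (Fin d)))

/-- The boundary `∂F_{<∞>} = ⋂ₙ ⋃_{m ≥ n} ∂F_{<m>}`. -/
def bdryInf (ω : ℕ → Fin N) : Set (EuclideanSpace ℝ (Fin d)) :=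
  ⋂ n, ⋃ m ≥ n, S.bdry ω m

/-! ### Operators and measures on the lattices -/

/-- The operator `A` on functions on `F` (the term `y = z` of the sum vanishes). -/
def opA (u : S.F → ℂ) (z : S.F) : ℂ := -∑ y : S.F, (S.a z y : ℂ) * (u y - u z)

/-- The factor `α_{ω₁}⋯α_{ωₙ} α_{j₁}⁻¹⋯α_{jₙ}⁻¹` of a cell. -/
def energyWeight (ω : ℕ → Fin N) {n : ℕ} (j : Fin n → Fin N) : ℝ :=
  (∏ k : Fin n, S.α (ω k)) * ∏ k : Fin n, (S.α (j k))⁻¹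

/-- The factor `β_{ω₁}⁻¹⋯β_{ωₙ}⁻¹ β_{j₁}⋯β_{jₙ}` of a cell. -/
def massWeight (ω : ℕ → Fin N) {n : ℕ} (j : Fin n → Fin N) : ℝ :=
  (∏ k : Fin n, (S.β (ω k))⁻¹) * ∏ k : Fin n, S.β (j k)

open Classical in
/-- The operator `A_{<n>}`: the weighted sum of the copies of `A` on the `0`-cells of `F_{<n>}`. -/
def opAStage (ω : ℕ → Fin N) (n : ℕ) (f : EuclideanSpace ℝ (Fin d) → ℂ)
    (x : EuclideanSpace ℝ (Fin d)) : ℂ :=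
  ∑ j : Fin n → Fin N, (S.energyWeight ω j : ℂ) *
    ∑ z : S.F, if S.cell ω j z = x then S.opA (fun y => f (S.cell ω j y)) z else 0

/-- The scalar product `<A_{<n>} f, g>` over `F_{<n>}`. -/
def pairing (ω : ℕ → Fin N) (n : ℕ) (f g : EuclideanSpace ℝ (Fin d) → ℂ) : ℂ :=
  ∑ x ∈ S.pts ω n, S.opAStage ω n f x * starRingEnd ℂ (g x)

/-- The measure `b_{<n>}`: the weighted sum of the copies of `b` on the `0`-cells of `F_{<n>}`. -/
def bStage (ω : ℕ → Fin N) (n : ℕ) : Measure (EuclideanSpace ℝ (Fin d)) :=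
  ∑ j : Fin n → Fin N, ∑ z : S.F,
    ENNReal.ofReal (S.massWeight ω j * S.b z) • Measure.dirac (S.cell ω j z)

/-- The measure `b_{<∞>}` on `F_{<∞>}`; the mass of a point is the limit of its (nondecreasing)
masses for the measures `b_{<n>}`. -/
def bInf (ω : ℕ → Fin N) : Measure (EuclideanSpace ℝ (Fin d)) :=
  Measure.sum fun x : S.ptsInf ω => (⨆ n, S.bStage ω n {x.1}) • Measure.dirac x.1

/-- The domains `D_{<∞>}^+ = L²(b_{<∞>})` and `D_{<∞>}^- = {f ∈ D_{<∞>}^+ | f = 0 on ∂F_{<∞>}}`. -/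
def domain (ω : ℕ → Fin N) : BoundaryCondition → Submodule ℂ (Lp ℂ 2 (S.bInf ω))
  | .neumann => ⊤
  | .dirichlet => LinearMap.ker
      (LpToLpRestrictCLM (EuclideanSpace ℝ (Fin d)) ℂ ℂ (S.bInf ω) 2 (S.bdryInf ω)).toLinearMap

instance (ω : ℕ → Fin N) (bc : BoundaryCondition) : CompleteSpace (S.domain ω bc) := by
  cases bc
  · exact (isClosed_univ (X := Lp ℂ 2 (S.bInf ω))).completeSpace_coe
  · exact (ContinuousLinearMap.isClosed_ker
      (LpToLpRestrictCLM (EuclideanSpace ℝ (Fin d)) ℂ ℂ (S.bInf ω) 2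
        (S.bdryInf ω))).completeSpace_coe

/-- `T` is the operator with `<A_{<∞>} f, g> = -∫ (T f) g̅ db_{<∞>}` on the domain, where
`<A_{<∞>} f, g>` is the limit of `<A_{<n>} f, g>`. -/
def IsLaplacian (ω : ℕ → Fin N) (bc : BoundaryCondition)
    (T : S.domain ω bc →L[ℂ] S.domain ω bc) : Prop :=
  ∀ f g : S.domain ω bc,
    Tendsto (fun n => S.pairing ω n (f : Lp ℂ 2 (S.bInf ω)) (g : Lp ℂ 2 (S.bInf ω))) atTop
      (𝓝 (-inner ℂ g (T f)))


/-! ### Existence and uniqueness of the operator on the infinite lattice -/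

theorem energyWeight_eq (ω : ℕ → Fin N) {n : ℕ} (j : Fin n → Fin N) :
    S.energyWeight ω j = S.massWeight ω j := by
  unfold energyWeight massWeight
  rw [← Finset.prod_mul_distrib, ← Finset.prod_mul_distrib]
  refine Finset.prod_congr rfl fun k _ => ?_
  have h := inv_injective (S.lattice_case (ω k) (j k))
  have h1 := (S.α_mem (j k)).1
  have h2 := (S.β_mem (ω k)).1
  field_simp
  linarith

theorem massWeight_pos (ω : ℕ → Fin N) {n : ℕ} (j : Fin n → Fin N) : 0 < S.massWeight ω j :=
  mul_pos (Finset.prod_pos fun _ _ => inv_pos.2 (S.β_mem _).1)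
    (Finset.prod_pos fun _ _ => (S.β_mem _).1)

theorem massWeight_cons (ω : ℕ → Fin N) {n : ℕ} (w : Fin n → Fin N) :
    S.massWeight ω (Fin.cons (ω n) w : Fin (n + 1) → Fin N) = S.massWeight ω w := by
  unfold massWeight
  rw [Fin.prod_univ_castSucc, Fin.prod_univ_succ]
  have h2 := (S.β_mem (ω n)).1
  simp only [Fin.val_castSucc, Fin.val_last, Fin.cons_zero, Fin.cons_succ]
  field_simp

theorem cell_cons (ω : ℕ → Fin N) {n : ℕ} (w : Fin n → Fin N) :
    S.cell ω (Fin.cons (ω n) w : Fin (n + 1) → Fin N) = S.cell ω w := by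
  unfold cell blowUp
  rw [List.ofFn_succ', List.ofFn_succ (n := n)]
  simp [List.concat_eq_append, mul_assoc]

/-- Weighted sum over the `0`-cells of `F_{<n>}`. -/
def cellSum {M : Type*} [AddCommMonoid M] [Module ℝ M] (ω : ℕ → Fin N) (n : ℕ)
    (G : (EuclideanSpace ℝ (Fin d) ≃ᵈ EuclideanSpace ℝ (Fin d)) → M) : M :=
  ∑ j : Fin n → Fin N, S.massWeight ω j • G (S.cell ω j)

theorem cellSum_succ {M : Type*} [AddCommMonoid M] [Module ℝ M] (ω : ℕ → Fin N) (n : ℕ)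
    (G : (EuclideanSpace ℝ (Fin d) ≃ᵈ EuclideanSpace ℝ (Fin d)) → M) :
    S.cellSum ω (n + 1) G = S.cellSum ω n G +
      ∑ i ∈ Finset.univ.erase (ω n), ∑ w : Fin n → Fin N,
        S.massWeight ω (Fin.cons i w : Fin (n + 1) → Fin N) •
          G (S.cell ω (Fin.cons i w : Fin (n + 1) → Fin N)) := by
  have h1 : S.cellSum ω (n + 1) G = ∑ i : Fin N, ∑ w : Fin n → Fin N,
        S.massWeight ω (Fin.cons i w : Fin (n + 1) → Fin N) •
          G (S.cell ω (Fin.cons i w : Fin (n + 1) → Fin N)) := by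
    unfold cellSum
    rw [← Fintype.sum_prod_type']
    exact (Fintype.sum_equiv (Fin.consEquiv fun _ : Fin (n + 1) => Fin N) _ _
      (fun p => rfl)).symm
  rw [h1, ← Finset.add_sum_erase _ _ (Finset.mem_univ (ω n))]
  congr 1
  unfold cellSum
  simp only [massWeight_cons, cell_cons]

/-- The form of `A` evaluated on the cell which is the image of `F` under `c`. -/
def cellForm (f g : EuclideanSpace ℝ (Fin d) → ℂ)
    (c : EuclideanSpace ℝ (Fin d) ≃ᵈ EuclideanSpace ℝ (Fin d)) : ℂ :=
  ∑ z : S.F, S.opA (fun y => f (c y)) z * starRingEnd ℂ (g (c z))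

/-- The squared norms of `f` and `g` on the cell which is the image of `F` under `c`. -/
def cellMass (f g : EuclideanSpace ℝ (Fin d) → ℂ)
    (c : EuclideanSpace ℝ (Fin d) ≃ᵈ EuclideanSpace ℝ (Fin d)) : ℝ :=
  ∑ z : S.F, S.b z * (‖f (c z)‖ ^ 2 + ‖g (c z)‖ ^ 2)

theorem cell_mem_pts (ω : ℕ → Fin N) {n : ℕ} (j : Fin n → Fin N) (z : S.F) :
    S.cell ω j z ∈ S.pts ω n := by
  classical
  unfold pts
  exact Finset.mem_image.2 ⟨(j, z), Finset.mem_univ _, rfl⟩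

theorem pairing_eq (ω : ℕ → Fin N) (n : ℕ) (f g : EuclideanSpace ℝ (Fin d) → ℂ) :
    S.pairing ω n f g = S.cellSum ω n (S.cellForm f g) := by
  classical
  unfold pairing opAStage cellSum cellForm
  simp only [Finset.sum_mul, energyWeight_eq, Finset.smul_sum, Finset.mul_sum]
  rw [Finset.sum_comm]
  refine Finset.sum_congr rfl fun j _ => ?_
  rw [Finset.sum_comm]
  refine Finset.sum_congr rfl fun z _ => ?_
  rw [Finset.sum_eq_single (S.cell ω j z)]
  · simp [mul_assoc]
  · intro x _ hx
    simp [hx.symm]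
  · intro h
    exact absurd (S.cell_mem_pts ω j z) h

/-- A constant bounding the form of `A` by the measure `b`. -/
def formBound : ℝ := ∑ z : S.F, ∑ y : S.F, |S.a z y| * (2 * ∑ x : S.F, (S.b x)⁻¹)

theorem norm_cellForm_le (f g : EuclideanSpace ℝ (Fin d) → ℂ)
    (c : EuclideanSpace ℝ (Fin d) ≃ᵈ EuclideanSpace ℝ (Fin d)) :
    ‖S.cellForm f g c‖ ≤ S.formBound * S.cellMass f g c := by
  have hpt : ∀ z : S.F, ‖f (c z)‖ ^ 2 + ‖g (c z)‖ ^ 2 ≤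
      (∑ x : S.F, (S.b x)⁻¹) * S.cellMass f g c := by
    intro z
    have h1 : S.b z * (‖f (c z)‖ ^ 2 + ‖g (c z)‖ ^ 2) ≤ S.cellMass f g c :=
      Finset.single_le_sum (f := fun z : S.F => S.b z * (‖f (c z)‖ ^ 2 + ‖g (c z)‖ ^ 2))
        (fun z _ => mul_nonneg (S.b_pos z).le (by positivity)) (Finset.mem_univ z)
    have h2 : (S.b z)⁻¹ ≤ ∑ x : S.F, (S.b x)⁻¹ :=
      Finset.single_le_sum (f := fun z : S.F => (S.b z)⁻¹)
        (fun z _ => (inv_pos.2 (S.b_pos z)).le) (Finset.mem_univ z)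
    have hb := S.b_pos z
    calc ‖f (c z)‖ ^ 2 + ‖g (c z)‖ ^ 2
        = (S.b z)⁻¹ * (S.b z * (‖f (c z)‖ ^ 2 + ‖g (c z)‖ ^ 2)) := by field_simp
      _ ≤ _ := by
        refine mul_le_mul h2 h1 (mul_nonneg hb.le (by positivity)) ?_
        exact (inv_pos.2 hb).le.trans h2
  unfold cellForm formBound
  rw [Finset.sum_mul]
  refine (norm_sum_le _ _).trans (Finset.sum_le_sum fun z _ => ?_)
  unfold opA
  rw [norm_mul, norm_neg, RCLike.norm_conj, Finset.sum_mul]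
  refine (mul_le_mul_of_nonneg_right (norm_sum_le _ _) (norm_nonneg _)).trans ?_
  rw [Finset.sum_mul]
  refine Finset.sum_le_sum fun y _ => ?_
  rw [norm_mul, Complex.norm_real, Real.norm_eq_abs, mul_assoc, mul_assoc]
  refine mul_le_mul_of_nonneg_left ?_ (abs_nonneg _)
  have h3 : ‖f (c y) - f (c z)‖ ≤ ‖f (c y)‖ + ‖f (c z)‖ := norm_sub_le _ _
  have h4 := mul_le_mul_of_nonneg_right h3 (norm_nonneg (g (c z)))
  have hy := hpt y
  have hz := hpt z
  nlinarith [sq_nonneg (‖f (c y)‖ - ‖g (c z)‖), sq_nonneg (‖f (c z)‖ - ‖g (c z)‖),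
    sq_nonneg (‖g (c y)‖), sq_nonneg (‖f (c z)‖), sq_nonneg (‖f (c y)‖)]

theorem bStage_le_bInf (ω : ℕ → Fin N) (n : ℕ) : S.bStage ω n ≤ S.bInf ω := by
  refine Measure.le_iff.2 fun s hs => ?_
  have hnull : S.bStage ω n (S.pts ω n : Set (EuclideanSpace ℝ (Fin d)))ᶜ = 0 := by
    unfold bStage
    simp only [Measure.coe_finsetSum, Finset.sum_apply, Measure.smul_apply]
    refine Finset.sum_eq_zero fun j _ => Finset.sum_eq_zero fun z _ => ?_
    rw [Measure.dirac_apply' _ (Finset.measurableSet _).compl]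
    simp [cell_mem_pts]
  have h1 : S.bStage ω n s =
      S.bStage ω n (s ∩ (S.pts ω n : Set (EuclideanSpace ℝ (Fin d)))) :=
    (measure_inter_conull hnull).symm
  have hfin : (s ∩ (S.pts ω n : Set (EuclideanSpace ℝ (Fin d)))).Finite :=
    (Finset.finite_toSet _).subset Set.inter_subset_right
  have hsub : s ∩ (S.pts ω n : Set (EuclideanSpace ℝ (Fin d))) ⊆ S.ptsInf ω :=
    Set.inter_subset_right.trans (Set.subset_iUnion_of_subset n subset_rfl)
  rw [h1]
  refine le_trans ?_ (measure_mono (μ := S.bInf ω) Set.inter_subset_left :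
    S.bInf ω (s ∩ (S.pts ω n : Set (EuclideanSpace ℝ (Fin d)))) ≤ _)
  generalize s ∩ (S.pts ω n : Set (EuclideanSpace ℝ (Fin d))) = t at hfin hsub
  have hpt : ∀ x ∈ S.ptsInf ω, S.bStage ω n {x} ≤ S.bInf ω {x} := by
    intro x hx
    unfold bInf
    rw [Measure.sum_apply _ (measurableSet_singleton x)]
    refine le_trans ?_ (ENNReal.le_tsum ⟨x, hx⟩)
    simp only [Measure.smul_apply, Measure.dirac_apply' _ (measurableSet_singleton x),
      Set.indicator_of_mem (Set.mem_singleton x), Pi.one_apply, smul_eq_mul, mul_one]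
    exact le_iSup (fun n => S.bStage ω n {x}) n
  induction t, hfin using Set.Finite.induction_on with
  | empty => simp
  | @insert x t hx ht ih =>
    have hd : Disjoint {x} t := Set.disjoint_singleton_left.2 hx
    rw [Set.insert_eq, measure_union hd ht.measurableSet, measure_union hd ht.measurableSet]
    exact add_le_add (hpt x (hsub (Set.mem_insert _ _)))
      (ih ((Set.subset_insert _ _).trans hsub))

theorem ae_bInf (ω : ℕ → Fin N) {p : EuclideanSpace ℝ (Fin d) → Prop}
    (hp : ∀ᵐ x ∂S.bInf ω, p x) {n : ℕ} (j : Fin n → Fin N) (z : S.F) : p (S.cell ω j z) := by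
  have h := ae_mono (S.bStage_le_bInf ω n) hp
  have hle : ENNReal.ofReal (S.massWeight ω j * S.b z) • Measure.dirac (S.cell ω j z)
      ≤ S.bStage ω n := by
    unfold bStage
    refine le_trans ?_ (Finset.single_le_sum (fun j _ => Measure.zero_le _) (Finset.mem_univ j))
    exact Finset.single_le_sum
      (f := fun z : S.F => ENNReal.ofReal (S.massWeight ω j * S.b z) •
        Measure.dirac (S.cell ω j z : EuclideanSpace ℝ (Fin d)))
      (fun z _ => Measure.zero_le _) (Finset.mem_univ z)
  have h2 := ae_mono hle h
  have hne : ENNReal.ofReal (S.massWeight ω j * S.b z) ≠ 0 := by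
    simpa using mul_pos (S.massWeight_pos ω j) (S.b_pos z)
  have h3 : ∀ᵐ x ∂(Measure.dirac (S.cell ω j z : EuclideanSpace ℝ (Fin d))), p x :=
    (Measure.ae_ennreal_smul_measure_iff hne).1 h2
  rwa [ae_dirac_eq] at h3

theorem cellSum_normSq_le (ω : ℕ → Fin N) (n : ℕ) (f : Lp ℂ 2 (S.bInf ω)) :
    S.cellSum ω n (fun c => ∑ z : S.F, S.b z * ‖f (c z)‖ ^ 2) ≤ ‖f‖ ^ 2 := by
  have h1 : ∫⁻ x, ‖f x‖ₑ ^ 2 ∂S.bStage ω n ≤ ∫⁻ x, ‖f x‖ₑ ^ 2 ∂S.bInf ω :=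
    lintegral_mono' (S.bStage_le_bInf ω n) le_rfl
  have h2 : ∫⁻ x, ‖f x‖ₑ ^ 2 ∂S.bInf ω = ENNReal.ofReal (‖f‖ ^ 2) := by
    have h := Lp.enorm_def f
    rw [eLpNorm_eq_lintegral_rpow_enorm_toReal (by norm_num) (by norm_num)] at h
    have h' : ‖f‖ₑ ^ 2 = ∫⁻ x, ‖f x‖ₑ ^ 2 ∂S.bInf ω := by
      rw [h, ← ENNReal.rpow_natCast, ← ENNReal.rpow_mul]
      simp
    rw [← h', ENNReal.ofReal_pow (norm_nonneg _), ofReal_norm]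
  have h3 : ∫⁻ x, ‖f x‖ₑ ^ 2 ∂S.bStage ω n =
      ENNReal.ofReal (S.cellSum ω n (fun c => ∑ z : S.F, S.b z * ‖f (c z)‖ ^ 2)) := by
    unfold bStage cellSum
    rw [lintegral_finsetSum_measure, ENNReal.ofReal_sum_of_nonneg]
    · refine Finset.sum_congr rfl fun j _ => ?_
      rw [lintegral_finsetSum_measure, smul_eq_mul, Finset.mul_sum,
        ENNReal.ofReal_sum_of_nonneg]
      · refine Finset.sum_congr rfl fun z _ => ?_
        rw [lintegral_smul_measure, lintegral_dirac, ← mul_assoc, ENNReal.ofReal_mul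
          (mul_pos (S.massWeight_pos ω j) (S.b_pos z)).le, ENNReal.ofReal_pow (norm_nonneg _),
          ofReal_norm, smul_eq_mul]
      · intro z _
        exact mul_nonneg (S.massWeight_pos ω j).le (mul_nonneg (S.b_pos z).le (by positivity))
    · intro j _
      exact smul_nonneg (S.massWeight_pos ω j).le
        (Finset.sum_nonneg fun z _ => mul_nonneg (S.b_pos z).le (by positivity))
  rw [h2, h3] at h1
  exact (ENNReal.ofReal_le_ofReal_iff (by positivity)).1 h1

theorem cellSum_mass_le (ω : ℕ → Fin N) (n : ℕ) (f g : Lp ℂ 2 (S.bInf ω)) :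
    S.cellSum ω n (S.cellMass f g) ≤ ‖f‖ ^ 2 + ‖g‖ ^ 2 := by
  have h : S.cellSum ω n (S.cellMass f g) =
      S.cellSum ω n (fun c => ∑ z : S.F, S.b z * ‖f (c z)‖ ^ 2) +
      S.cellSum ω n (fun c => ∑ z : S.F, S.b z * ‖g (c z)‖ ^ 2) := by
    unfold cellSum
    rw [← Finset.sum_add_distrib]
    refine Finset.sum_congr rfl fun j _ => ?_
    rw [← smul_add, ← Finset.sum_add_distrib]
    simp only [cellMass, mul_add]
  rw [h]
  exact add_le_add (S.cellSum_normSq_le ω n f) (S.cellSum_normSq_le ω n g)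

theorem norm_pairing_le (ω : ℕ → Fin N) (n : ℕ) (f g : Lp ℂ 2 (S.bInf ω)) :
    ‖S.pairing ω n f g‖ ≤ S.formBound * (‖f‖ ^ 2 + ‖g‖ ^ 2) := by
  have hK : 0 ≤ S.formBound := Finset.sum_nonneg fun z _ => Finset.sum_nonneg fun y _ =>
    mul_nonneg (abs_nonneg _) (mul_nonneg (by norm_num)
      (Finset.sum_nonneg fun x _ => (inv_pos.2 (S.b_pos x)).le))
  refine le_trans ?_ (mul_le_mul_of_nonneg_left (S.cellSum_mass_le ω n f g) hK)
  rw [pairing_eq]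
  unfold cellSum
  rw [Finset.mul_sum]
  refine (norm_sum_le _ _).trans (Finset.sum_le_sum fun j _ => ?_)
  rw [norm_smul, Real.norm_of_nonneg (S.massWeight_pos ω j).le, smul_eq_mul, mul_left_comm]
  exact mul_le_mul_of_nonneg_left (S.norm_cellForm_le f g _) (S.massWeight_pos ω j).le

theorem exists_tendsto_pairing (ω : ℕ → Fin N) (f g : Lp ℂ 2 (S.bInf ω)) :
    ∃ l, Tendsto (fun n => S.pairing ω n f g) atTop (𝓝 l) := by
  have hK : 0 ≤ S.formBound := Finset.sum_nonneg fun z _ => Finset.sum_nonneg fun y _ =>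
    mul_nonneg (abs_nonneg _) (mul_nonneg (by norm_num)
      (Finset.sum_nonneg fun x _ => (inv_pos.2 (S.b_pos x)).le))
  have hstep : ∀ n, dist (S.pairing ω n f g) (S.pairing ω (n + 1) f g) ≤
      S.formBound * (S.cellSum ω (n + 1) (S.cellMass f g) - S.cellSum ω n (S.cellMass f g)) := by
    intro n
    rw [dist_comm, dist_eq_norm, pairing_eq, pairing_eq, cellSum_succ, cellSum_succ,
      add_sub_cancel_left, add_sub_cancel_left, Finset.mul_sum]
    refine (norm_sum_le _ _).trans (Finset.sum_le_sum fun i _ => ?_)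
    rw [Finset.mul_sum]
    refine (norm_sum_le _ _).trans (Finset.sum_le_sum fun w _ => ?_)
    rw [norm_smul, Real.norm_of_nonneg (S.massWeight_pos ω _).le, smul_eq_mul, mul_left_comm]
    exact mul_le_mul_of_nonneg_left (S.norm_cellForm_le f g _) (S.massWeight_pos ω _).le
  have hnn : ∀ n, 0 ≤ S.formBound *
      (S.cellSum ω (n + 1) (S.cellMass f g) - S.cellSum ω n (S.cellMass f g)) :=
    fun n => dist_nonneg.trans (hstep n)
  have hsum : Summable fun n => S.formBound *
      (S.cellSum ω (n + 1) (S.cellMass f g) - S.cellSum ω n (S.cellMass f g)) := by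
    refine summable_of_sum_range_le (c := S.formBound * (‖f‖ ^ 2 + ‖g‖ ^ 2)) hnn fun n => ?_
    rw [← Finset.mul_sum, Finset.sum_range_sub (fun n => S.cellSum ω n (S.cellMass f g))]
    refine mul_le_mul_of_nonneg_left ?_ hK
    have h0 : 0 ≤ S.cellSum ω 0 (S.cellMass f g) :=
      Finset.sum_nonneg fun j _ => smul_nonneg (S.massWeight_pos ω j).le
        (Finset.sum_nonneg fun z _ => mul_nonneg (S.b_pos z).le (by positivity))
    linarith [S.cellSum_mass_le ω n f g]
  exact cauchySeq_tendsto_of_complete (cauchySeq_of_dist_le_of_summable _ hstep hsum)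

theorem pairing_congr (ω : ℕ → Fin N) (n : ℕ) {f f' g g' : EuclideanSpace ℝ (Fin d) → ℂ}
    (hf : f =ᵐ[S.bInf ω] f') (hg : g =ᵐ[S.bInf ω] g') :
    S.pairing ω n f g = S.pairing ω n f' g' := by
  rw [pairing_eq, pairing_eq]
  unfold cellSum cellForm
  refine Finset.sum_congr rfl fun j _ => ?_
  congr 1
  refine Finset.sum_congr rfl fun z _ => ?_
  have h1 : (fun y : S.F => f (S.cell ω j y)) = fun y : S.F => f' (S.cell ω j y) :=
    funext fun y => S.ae_bInf ω hf j y
  have h2 : g (S.cell ω j z) = g' (S.cell ω j z) := S.ae_bInf ω hg j z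
  rw [h1, h2]

theorem pairing_add_left (ω : ℕ → Fin N) (n : ℕ) (f f' g : EuclideanSpace ℝ (Fin d) → ℂ) :
    S.pairing ω n (f + f') g = S.pairing ω n f g + S.pairing ω n f' g := by
  simp only [pairing_eq, cellSum, cellForm, opA, Pi.add_apply]
  rw [← Finset.sum_add_distrib]
  refine Finset.sum_congr rfl fun j _ => ?_
  rw [← smul_add, ← Finset.sum_add_distrib]
  congr 1
  refine Finset.sum_congr rfl fun z _ => ?_
  rw [← add_mul, ← neg_add, ← Finset.sum_add_distrib]
  congr 2
  refine Finset.sum_congr rfl fun y _ => ?_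
  ring

theorem pairing_smul_left (ω : ℕ → Fin N) (n : ℕ) (k : ℂ)
    (f g : EuclideanSpace ℝ (Fin d) → ℂ) :
    S.pairing ω n (k • f) g = k * S.pairing ω n f g := by
  simp only [pairing_eq, cellSum, cellForm, opA, Pi.smul_apply, smul_eq_mul]
  rw [Finset.mul_sum]
  refine Finset.sum_congr rfl fun j _ => ?_
  rw [mul_smul_comm, Finset.mul_sum]
  congr 1
  refine Finset.sum_congr rfl fun z _ => ?_
  rw [← mul_assoc, mul_neg, Finset.mul_sum]
  congr 2
  refine Finset.sum_congr rfl fun y _ => ?_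
  ring

theorem pairing_add_right (ω : ℕ → Fin N) (n : ℕ) (f g g' : EuclideanSpace ℝ (Fin d) → ℂ) :
    S.pairing ω n f (g + g') = S.pairing ω n f g + S.pairing ω n f g' := by
  simp only [pairing, Pi.add_apply, map_add, mul_add, Finset.sum_add_distrib]

theorem pairing_smul_right (ω : ℕ → Fin N) (n : ℕ) (k : ℂ)
    (f g : EuclideanSpace ℝ (Fin d) → ℂ) :
    S.pairing ω n f (k • g) = starRingEnd ℂ k * S.pairing ω n f g := by
  simp only [pairing, Pi.smul_apply, smul_eq_mul, map_mul, Finset.mul_sum]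
  exact Finset.sum_congr rfl fun x _ => by ring

/-- There is exactly one operator associated with the forms `<A_{<n>} f, g>`. -/
theorem existsUnique_isLaplacian (ω : ℕ → Fin N) (bc : BoundaryCondition) :
    ∃! T : S.domain ω bc →L[ℂ] S.domain ω bc, S.IsLaplacian ω bc T := by
  choose L hL using S.exists_tendsto_pairing ω
  have hadd₁ : ∀ f f' g, L (f + f') g = L f g + L f' g := fun f f' g =>
    tendsto_nhds_unique (hL _ _) (((hL f g).add (hL f' g)).congr fun n => by
      rw [S.pairing_congr ω n (Lp.coeFn_add f f') (ae_eq_refl _), pairing_add_left])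
  have hsmul₁ : ∀ (k : ℂ) f g, L (k • f) g = k * L f g := fun k f g =>
    tendsto_nhds_unique (hL _ _) (((hL f g).const_mul k).congr fun n => by
      rw [S.pairing_congr ω n (Lp.coeFn_smul k f) (ae_eq_refl _), pairing_smul_left])
  have hadd₂ : ∀ f g g', L f (g + g') = L f g + L f g' := fun f g g' =>
    tendsto_nhds_unique (hL _ _) (((hL f g).add (hL f g')).congr fun n => by
      rw [S.pairing_congr ω n (ae_eq_refl _) (Lp.coeFn_add g g'), pairing_add_right])
  have hsmul₂ : ∀ (k : ℂ) f g, L f (k • g) = starRingEnd ℂ k * L f g := fun k f g =>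
    tendsto_nhds_unique (hL _ _) (((hL f g).const_mul _).congr fun n => by
      rw [S.pairing_congr ω n (ae_eq_refl _) (Lp.coeFn_smul k g), pairing_smul_right])
  have hb : ∀ f g, ‖L f g‖ ≤ S.formBound * (‖f‖ ^ 2 + ‖g‖ ^ 2) := fun f g =>
    le_of_tendsto (hL f g).norm (Eventually.of_forall fun n => S.norm_pairing_le ω n f g)
  have hb' : ∀ f g, ‖L f g‖ ≤ (2 * S.formBound) * ‖g‖ * ‖f‖ := by
    intro f g
    rcases eq_or_ne f 0 with rfl | hf
    · have := hsmul₁ 0 0 g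
      simp only [smul_zero, zero_mul] at this
      simp [this]
    rcases eq_or_ne g 0 with rfl | hg
    · have := hsmul₂ 0 f 0
      simp only [smul_zero, map_zero, zero_mul] at this
      simp [this]
    have hf' := norm_pos_iff.2 hf
    have hg' := norm_pos_iff.2 hg
    have h := hb ((‖f‖⁻¹ : ℂ) • f) ((‖g‖⁻¹ : ℂ) • g)
    rw [hsmul₁, hsmul₂, norm_smul, norm_smul] at h
    simp only [norm_mul, norm_inv, Complex.norm_real, norm_norm, map_inv₀, Complex.conj_ofReal]
      at h
    rw [inv_mul_cancel₀ hf'.ne', inv_mul_cancel₀ hg'.ne'] at h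
    field_simp at h
    linarith
  let B : S.domain ω bc →L⋆[ℂ] S.domain ω bc →L[ℂ] ℂ :=
    LinearMap.mkContinuous₂
      (LinearMap.mk₂'ₛₗ (starRingEnd ℂ) (RingHom.id ℂ)
        (fun g f : S.domain ω bc => -L (f : Lp ℂ 2 (S.bInf ω)) (g : Lp ℂ 2 (S.bInf ω)))
        (fun g g' f => by simp only [Submodule.coe_add, hadd₂]; ring)
        (fun k g f => by simp only [Submodule.coe_smul, hsmul₂, smul_eq_mul]; ring)
        (fun g f f' => by simp only [Submodule.coe_add, hadd₁]; ring)
        (fun k g f => by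
          simp only [Submodule.coe_smul, hsmul₁, smul_eq_mul, RingHom.id_apply]; ring))
      (2 * S.formBound)
      (fun g f => by
        simp only [LinearMap.mk₂'ₛₗ_apply, norm_neg]
        exact hb' _ _)
  refine ⟨ContinuousLinearMap.adjoint (InnerProductSpace.continuousLinearMapOfBilin B), ?_, ?_⟩
  · intro f g
    rw [ContinuousLinearMap.adjoint_inner_right,
      InnerProductSpace.continuousLinearMapOfBilin_apply]
    have : -B g f = L (f : Lp ℂ 2 (S.bInf ω)) (g : Lp ℂ 2 (S.bInf ω)) := neg_neg _
    rw [this]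
    exact hL _ _
  · intro T hT
    refine ContinuousLinearMap.ext fun f => ext_inner_left ℂ fun g => ?_
    rw [ContinuousLinearMap.adjoint_inner_right,
      InnerProductSpace.continuousLinearMapOfBilin_apply]
    have h1 := tendsto_nhds_unique (hT f g) (hL _ _)
    have : B g f = -L (f : Lp ℂ 2 (S.bInf ω)) (g : Lp ℂ 2 (S.bInf ω)) := rfl
    rw [this, ← h1, neg_neg]

/-- The bounded self-adjoint operator `H_{<∞>}^±` on `D_{<∞>}^±`. -/
def laplacian (ω : ℕ → Fin N) (bc : BoundaryCondition) :
    S.domain ω bc →L[ℂ] S.domain ω bc :=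
  (S.existsUnique_isLaplacian ω bc).choose

theorem cellForm_conj_symm (f g : EuclideanSpace ℝ (Fin d) → ℂ)
    (c : EuclideanSpace ℝ (Fin d) ≃ᵈ EuclideanSpace ℝ (Fin d)) :
    starRingEnd ℂ (S.cellForm f g c) = S.cellForm g f c := by
  have key : ∀ u v : S.F → ℂ, ∑ z : S.F, S.opA u z * starRingEnd ℂ (v z) =
      (∑ z : S.F, ∑ y : S.F, (S.a z y : ℂ) * (u z * starRingEnd ℂ (v z))) -
        ∑ z : S.F, ∑ y : S.F, (S.a z y : ℂ) * (u y * starRingEnd ℂ (v z)) := by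
    intro u v
    rw [← Finset.sum_sub_distrib]
    refine Finset.sum_congr rfl fun z _ => ?_
    rw [← Finset.sum_sub_distrib, opA, neg_mul, Finset.sum_mul, ← Finset.sum_neg_distrib]
    exact Finset.sum_congr rfl fun y _ => by ring
  unfold cellForm
  rw [key (fun y : S.F => f (c y)) (fun y : S.F => g (c y)),
    key (fun y : S.F => g (c y)) (fun y : S.F => f (c y))]
  simp only [map_sub, map_sum, map_mul, Complex.conj_ofReal, Complex.conj_conj]
  congr 1
  · exact Finset.sum_congr rfl fun z _ => Finset.sum_congr rfl fun y _ => by ring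
  · rw [Finset.sum_comm]
    exact Finset.sum_congr rfl fun z _ => Finset.sum_congr rfl fun y _ => by
      rw [S.a_symm y z]; ring

theorem laplacian_spec (ω : ℕ → Fin N) (bc : BoundaryCondition) :
    S.IsLaplacian ω bc (S.laplacian ω bc) :=
  (S.existsUnique_isLaplacian ω bc).choose_spec.1

theorem laplacian_isSelfAdjoint (ω : ℕ → Fin N) (bc : BoundaryCondition) :
    IsSelfAdjoint (S.laplacian ω bc) := by
  rw [ContinuousLinearMap.isSelfAdjoint_iff_isSymmetric]
  intro f g
  have h1 := S.laplacian_spec ω bc f g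
  have h2 := (Complex.continuous_conj.tendsto _).comp (S.laplacian_spec ω bc g f)
  have h3 := tendsto_nhds_unique h1 (h2.congr fun n => by
    simp only [Function.comp_apply, pairing_eq, cellSum, map_sum, Complex.real_smul, map_mul,
      Complex.conj_ofReal, cellForm_conj_symm])
  rw [map_neg] at h3
  have h4 : inner ℂ g (S.laplacian ω bc f) = inner ℂ (S.laplacian ω bc g) f :=
    (neg_injective h3).trans (inner_conj_symm (𝕜 := ℂ) _ _)
  calc inner ℂ (S.laplacian ω bc f) g = starRingEnd ℂ (inner ℂ g (S.laplacian ω bc f)) :=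
        (inner_conj_symm _ _).symm
    _ = inner ℂ f (S.laplacian ω bc g) := by
        rw [h4]; exact inner_conj_symm (𝕜 := ℂ) _ _

/-! ### Neumann-Dirichlet eigenfunctions and the parts of the spectrum -/

/-- `f` is the extension by `0` of a Neumann-Dirichlet eigenfunction of `H_{<n>}` (or `0`). -/
def IsNDEigenfunction (ω : ℕ → Fin N) (n : ℕ) (f : EuclideanSpace ℝ (Fin d) → ℂ) : Prop :=
  (∀ᵐ x ∂S.bInf ω, x ∉ (S.pts ω n : Set (EuclideanSpace ℝ (Fin d))) \ S.bdry ω n → f x = 0) ∧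
  ∃ t : ℝ, ∀ g : EuclideanSpace ℝ (Fin d) → ℂ,
    S.pairing ω n f g = -(t : ℂ) * ∫ x, f x * starRingEnd ℂ (g x) ∂S.bStage ω n

/-- The closed subspace `H_ND` generated by the Neumann-Dirichlet eigenfunctions of all levels. -/
def ndSpace (ω : ℕ → Fin N) (bc : BoundaryCondition) : Submodule ℂ (S.domain ω bc) :=
  (Submodule.span ℂ {f : S.domain ω bc |
    ∃ n, S.IsNDEigenfunction ω n (f : Lp ℂ 2 (S.bInf ω))}).topologicalClosure

instance (ω : ℕ → Fin N) (bc : BoundaryCondition) : CompleteSpace (S.ndSpace ω bc) :=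
  (Submodule.isClosed_topologicalClosure _).completeSpace_coe

/-- The parts of the spectrum: absolutely continuous, singular continuous, pure point, and the pure
point part orthogonal to the Neumann-Dirichlet eigenfunctions. -/
inductive Part
  | ac
  | sc
  | pp
  | ppTilde

/-- The subspaces `H_ac`, `H_sc`, `H_pp`, and the orthogonal complement of `H_ND` in `H_pp`. -/
def partSpace (ω : ℕ → Fin N) (bc : BoundaryCondition) : Part → Set (S.domain ω bc)
  | .ac => acSpace (S.laplacian ω bc)
  | .sc => scSpace (S.laplacian ω bc)
  | .pp => ppSpace (S.laplacian ω bc)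
  | .ppTilde => ppSpace (S.laplacian ω bc) ∩ (S.ndSpace ω bc)ᗮ

/-- The sets `Σ_ac^±(ω)`, `Σ_sc^±(ω)`, `Σ_pp^±(ω)`, `Σ̃_pp^±(ω)`. -/
def partSpectrum (ω : ℕ → Fin N) (bc : BoundaryCondition) (p : Part) : Set ℝ :=
  restrictedSpectrum (S.laplacian ω bc) (S.partSpace ω bc p)

/-- The measures `σ_ac(f)`, `σ_sc(f)`, `σ_pp(f)`, and the pure point part `σ̃_pp(f)` of the spectral
measure of the projection of `f` on the orthogonal complement of `H_ND`. -/
def partMeasure (ω : ℕ → Fin N) (bc : BoundaryCondition) (f : S.domain ω bc) : Part → Measure ℝ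
  | .ac => acPart (spectralMeasure (S.laplacian ω bc) f)
  | .sc => scPart (spectralMeasure (S.laplacian ω bc) f)
  | .pp => ppPart (spectralMeasure (S.laplacian ω bc) f)
  | .ppTilde => ppPart (spectralMeasure (S.laplacian ω bc) ((S.ndSpace ω bc)ᗮ.starProjection f))

open Classical in
/-- The Dirac function `δ_x`, in `L²(b_{<∞>})` (the mass of every point of `F_{<∞>}` is finite for
almost every blow-up). -/
def delta (ω : ℕ → Fin N) (x : EuclideanSpace ℝ (Fin d)) : S.domain ω .neumann :=
  ⟨if h : S.bInf ω {x} ≠ ⊤ then indicatorConstLp 2 (measurableSet_singleton x) h (1 : ℂ) else 0,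
    Submodule.mem_top⟩

/-- The random measure `∑_{x ∈ F} b_{<0>}(x) / b_{<∞>}(x)² • σ_·(δ_x)(dλ, ω)`. -/
def localMeasure (p : Part) (ω : ℕ → Fin N) : Measure ℝ :=
  ∑ x : S.F, (ENNReal.ofReal (S.b x) / S.bInf ω {x.1} ^ 2) •
    S.partMeasure ω .neumann (S.delta ω x) p

/-- The measures `μ^ac`, `μ^sc`, `μ^pp`, `μ̃^pp`: the expectation over `ω` of the random measure. -/
def partDensity (p : Part) : Measure ℝ := (blowUpLaw N).bind (S.localMeasure p)

end SelfSimilarLattice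

end

/-! Fix one of the four parts and let M be the space removed from the Hilbert space: the
Neumann-Dirichlet space for the last part, 0 for the others. The proof reduces each spectrum to a
countable family of spectral measures, and then shows that these charge a given interval either
almost surely or almost never, according to the mean measure.

Deterministic side. Almost surely the boundary of the infinite lattice is empty
(`ae_bdryInf_eq_empty`), so both domains are the whole L² space and the Dirac functions are total.
For a self-adjoint operator, a spectral type and an invariant M, a point t lies in the spectrum of
the restriction iff every interval around t is charged by the part of the spectral measure of the
projection on the orthogonal complement of M of some vector of a total family
(`mem_restrictedSpectrum_iff`). This holds because each type is determined by null sets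
(`DominationClosed`), so the vectors not charging an interval form a closed subspace, and because
restricting a spectral measure to a Borel set gives the spectral measure of another vector
(`exists_spectralMeasure_eq_restrict`).

Transport. If two sequences agree from some letter on, a similitude carries one lattice to the other
and multiplies all masses by a constant κ. Since the products of energy and mass weights do not
depend on the letter, energies are multiplied by the same κ; the operator is unchanged and spectral
measures of Dirac functions are multiplied by κ. No unitary map is built: the moments of these
measures are limits of quantities computed on the finite lattices (`tendsto_stageMoment`), and they
determine the measures because the norms of the operators are bounded uniformly. The same limits
give the independence of the boundary condition and the measurability in the sequence, as a level
`n` quantity depends on `n` letters only.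

Probability. Every point of the infinite lattice is moved into F by a change of finitely many
letters (`exists_prepend_blowUp_mem_F`). Such changes preserve null sets, and an event of positive
probability is reached from almost every sequence by such a change (zero-one law). Hence some point
of the lattice charges an interval almost surely iff the mean measure charges it (`ae_charges_iff`);
the weights in the mean are positive and do not matter. Intervals with rational endpoints give a
common exceptional set, and the theorem follows. -/

section Spectral

/-! ### Spectral measures of a bounded self-adjoint operator. -/

variable {V : Type*} [NormedAddCommGroup V] [InnerProductSpace ℂ V] [CompleteSpace V]

theorem integral_spectralMeasure_compactlySupported (T : V →L[ℂ] V) (f : V)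
    (φ : CompactlySupportedContinuousMap ℝ ℝ) :
    ∫ x, φ x ∂spectralMeasure T f = (inner ℂ f (cfc (φ : ℝ → ℝ) T f)).re :=
  RealRMK.integral_rieszMeasure _ φ

theorem exists_cutoff {K C : Set ℝ} (hK : IsCompact K) (hC : IsClosed C) (h : Disjoint K C) :
    ∃ χ : CompactlySupportedContinuousMap ℝ ℝ, (∀ x ∈ K, χ x = 1) ∧ (∀ x ∈ C, χ x = 0) ∧
      ∀ x, 0 ≤ χ x ∧ χ x ≤ 1 := by
  obtain ⟨χ, h1, h2, h3, h4⟩ := exists_continuous_one_zero_of_isCompact hK hC h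
  exact ⟨⟨χ, h3⟩, fun x hx => h1 hx, fun x hx => h2 hx, fun x => ⟨(h4 x).1, (h4 x).2⟩⟩

theorem spectrum_subset_closedBall (T : V →L[ℂ] V) :
    spectrum ℝ T ⊆ Metric.closedBall 0 ‖T‖ := by
  intro x hx
  have h := spectrum.subset_closedBall_norm_mul (𝕜 := ℝ) T hx
  rw [mem_closedBall_zero_iff] at h ⊢
  refine h.trans ?_
  have : ‖(1 : V →L[ℂ] V)‖ ≤ 1 := ContinuousLinearMap.norm_id_le
  exact mul_le_of_le_one_right (norm_nonneg _) this

/-- A cutoff χ equal to 1 on K with values in [0, 1] satisfies ‖χ(T)‖ ≤ 1. The bound does not depend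
on K, which makes the measure finite. -/
theorem spectralMeasure_isCompact_le (T : V →L[ℂ] V) (f : V) {K : Set ℝ} (hK : IsCompact K) :
    spectralMeasure T f K ≤ ENNReal.ofReal (‖f‖ ^ 2) := by
  obtain ⟨χ, h1, -, h3⟩ := exists_cutoff hK isClosed_empty (Set.disjoint_empty K)
  refine (RealRMK.rieszMeasure_le_of_eq_one _ (fun x => (h3 x).1) hK h1).trans ?_
  refine ENNReal.ofReal_le_ofReal ?_
  change (inner ℂ f (cfc (χ : ℝ → ℝ) T f)).re ≤ _
  have hn : ‖cfc (χ : ℝ → ℝ) T‖ ≤ 1 := norm_cfc_le zero_le_one fun x _ => by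
    rw [Real.norm_of_nonneg (h3 x).1]; exact (h3 x).2
  calc (inner ℂ f (cfc (χ : ℝ → ℝ) T f)).re ≤ ‖f‖ * ‖cfc (χ : ℝ → ℝ) T f‖ :=
        re_inner_le_norm (𝕜 := ℂ) _ _
    _ ≤ ‖f‖ * (1 * ‖f‖) := by
        gcongr
        exact (ContinuousLinearMap.le_opNorm _ _).trans (by gcongr)
    _ = ‖f‖ ^ 2 := by ring

instance (T : V →L[ℂ] V) (f : V) : IsFiniteMeasure (spectralMeasure T f) := by
  refine ⟨lt_of_le_of_lt ?_ (ENNReal.ofReal_lt_top (r := ‖f‖ ^ 2))⟩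
  have hu : (⋃ n : ℕ, Metric.closedBall (0 : ℝ) n) = Set.univ := by
    refine Set.eq_univ_of_forall fun x => ?_
    obtain ⟨n, hn⟩ := exists_nat_ge ‖x‖
    exact Set.mem_iUnion.2 ⟨n, by simpa using hn⟩
  rw [← hu, Monotone.measure_iUnion]
  · exact iSup_le fun n => spectralMeasure_isCompact_le T f (isCompact_closedBall _ _)
  · intro m n h
    exact Metric.closedBall_subset_closedBall (by exact_mod_cast h)

/-- A cutoff vanishing on the ball vanishes on the spectrum, so its functional calculus is 0; inner
regularity on the open complement does the rest. -/
theorem spectralMeasure_compl_closedBall (T : V →L[ℂ] V) (f : V) :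
    spectralMeasure T f (Metric.closedBall 0 ‖T‖)ᶜ = 0 := by
  have hreg : (spectralMeasure T f).Regular := by unfold spectralMeasure; infer_instance
  rw [(Metric.isClosed_closedBall (x := (0 : ℝ)) (ε := ‖T‖)).isOpen_compl.measure_eq_iSup_isCompact]
  simp only [ENNReal.iSup_eq_zero]
  intro K hK hKc
  obtain ⟨χ, h1, h2, h3⟩ := exists_cutoff hKc Metric.isClosed_closedBall
    (Set.disjoint_left.2 fun x hx hx' => hK hx hx')
  have h := RealRMK.rieszMeasure_le_of_eq_one (spectralFunctional T f) (fun x => (h3 x).1) hKc h1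
  have h0 : cfc (χ : ℝ → ℝ) T = 0 := by
    rw [cfc_congr (g := fun _ => 0) (fun x hx => h2 x (spectrum_subset_closedBall T hx))]
    exact cfc_const_zero ℝ T
  have h4 : spectralFunctional T f χ = 0 := by
    change (inner ℂ f (cfc (χ : ℝ → ℝ) T f)).re = 0
    rw [h0]; simp
  rw [h4, ENNReal.ofReal_zero] at h
  exact le_antisymm h zero_le

theorem ae_mem_closedBall_spectralMeasure (T : V →L[ℂ] V) (f : V) :
    ∀ᵐ x ∂spectralMeasure T f, x ∈ Metric.closedBall (0 : ℝ) ‖T‖ :=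
  spectralMeasure_compl_closedBall T f

/-- Both the measure and the spectrum live in a ball, so φ can be truncated to compact support
without changing either side. -/
theorem integral_spectralMeasure (T : V →L[ℂ] V) (f : V) {φ : ℝ → ℝ} (hφ : Continuous φ) :
    ∫ x, φ x ∂spectralMeasure T f = (inner ℂ f (cfc φ T f)).re := by
  obtain ⟨χ, h1, -, h3⟩ := exists_cutoff (isCompact_closedBall (0 : ℝ) ‖T‖) isClosed_empty
    (Set.disjoint_empty _)
  let ψ : CompactlySupportedContinuousMap ℝ ℝ :=
    ⟨⟨fun x => φ x * χ x, hφ.mul χ.continuous⟩, χ.hasCompactSupport.mul_left⟩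
  have hψ : ∀ x ∈ Metric.closedBall (0 : ℝ) ‖T‖, φ x = ψ x := fun x hx => by
    change φ x = φ x * χ x
    rw [h1 x hx, mul_one]
  rw [cfc_congr (g := ψ) (fun x hx => hψ x (spectrum_subset_closedBall T hx)),
    ← integral_spectralMeasure_compactlySupported]
  exact integral_congr_ae ((ae_mem_closedBall_spectralMeasure T f).mono hψ)

theorem Continuous.integrable_spectralMeasure {φ : ℝ → ℝ} (hφ : Continuous φ) (T : V →L[ℂ] V)
    (f : V) : Integrable φ (spectralMeasure T f) := by
  obtain ⟨C, hC⟩ := (isCompact_closedBall (0 : ℝ) ‖T‖).exists_bound_of_continuousOn hφ.continuousOn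
  exact Integrable.of_bound hφ.aestronglyMeasurable C
    ((ae_mem_closedBall_spectralMeasure T f).mono hC)

theorem Continuous.memLp_spectralMeasure {φ : ℝ → ℝ} (hφ : Continuous φ) (T : V →L[ℂ] V)
    (f : V) : MemLp φ 2 (spectralMeasure T f) := by
  rw [memLp_two_iff_integrable_sq hφ.aestronglyMeasurable]
  exact (hφ.pow 2).integrable_spectralMeasure T f

theorem inner_cfc_cfc (T : V →L[ℂ] V) (f : V) {φ ψ : ℝ → ℝ} (hφ : Continuous φ)
    (hψ : Continuous ψ) :
    inner ℂ (cfc φ T f) (cfc ψ T f) = inner ℂ f (cfc (fun x => φ x * ψ x) T f) := by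
  have hs : IsSelfAdjoint (cfc φ T) := cfc_predicate φ T
  rw [cfc_mul φ ψ T hφ.continuousOn hψ.continuousOn, mul_apply_eq_comp]
  nth_rewrite 1 [← hs.adjoint_eq]
  rw [ContinuousLinearMap.adjoint_inner_left]

theorem norm_cfc_apply_sq (T : V →L[ℂ] V) (f : V) {φ : ℝ → ℝ} (hφ : Continuous φ) :
    ‖cfc φ T f‖ ^ 2 = ∫ x, φ x ^ 2 ∂spectralMeasure T f := by
  rw [integral_spectralMeasure T f (φ := fun x => φ x ^ 2) (by fun_prop), ← inner_self_eq_norm_sq (𝕜 := ℂ)]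
  simp only [pow_two]
  rw [← inner_cfc_cfc T f hφ hφ]
  rfl

/-- Self-adjointness matters here: otherwise the functional calculus takes the default value 0, and
the measure vanishes. -/
theorem measureReal_spectralMeasure_univ {T : V →L[ℂ] V} (hT : IsSelfAdjoint T) (f : V) :
    (spectralMeasure T f).real Set.univ = ‖f‖ ^ 2 := by
  have h := norm_cfc_apply_sq T f (continuous_const (y := (1 : ℝ)))
  rw [cfc_const_one ℝ T] at h
  simpa using h.symm

theorem spectralMeasure_le {T : V →L[ℂ] V} (hT : IsSelfAdjoint T) (f : V) (B : Set ℝ) :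
    spectralMeasure T f B ≤ ENNReal.ofReal (‖f‖ ^ 2) := by
  rw [← measureReal_spectralMeasure_univ hT, Measure.real, ENNReal.ofReal_toReal (by simp)]
  exact measure_mono (Set.subset_univ B)

/-- Two finite measures carried by a bounded set and with the same moments are equal. -/
theorem Measure.ext_of_forall_moment_eq {μ ν : Measure ℝ} [IsFiniteMeasure μ] [IsFiniteMeasure ν]
    {R : ℝ} (hμ : ∀ᵐ x ∂μ, x ∈ Metric.closedBall (0 : ℝ) R)
    (hν : ∀ᵐ x ∂ν, x ∈ Metric.closedBall (0 : ℝ) R)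
    (h : ∀ k : ℕ, ∫ x, x ^ k ∂μ = ∫ x, x ^ k ∂ν) : μ = ν := by
  have hint : ∀ (ρ : Measure ℝ) [IsFiniteMeasure ρ],
      (∀ᵐ x ∂ρ, x ∈ Metric.closedBall (0 : ℝ) R) → ∀ {φ : ℝ → ℝ}, Continuous φ →
      Integrable φ ρ := by
    intro ρ _ hρ φ hφ
    obtain ⟨C, hC⟩ := (isCompact_closedBall (0 : ℝ) R).exists_bound_of_continuousOn hφ.continuousOn
    exact Integrable.of_bound hφ.aestronglyMeasurable C (hρ.mono hC)
  have hpoly : ∀ p : Polynomial ℝ, ∫ x, p.eval x ∂μ = ∫ x, p.eval x ∂ν := by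
    intro p
    simp only [Polynomial.eval_eq_sum_range]
    rw [integral_finsetSum _ fun i _ => (hint μ hμ (continuous_pow i)).const_mul _,
      integral_finsetSum _ fun i _ => (hint ν hν (continuous_pow i)).const_mul _]
    simp only [integral_const_mul, h]
  refine ext_of_forall_integral_eq_of_IsFiniteMeasure fun φ => ?_
  refine eq_of_forall_dist_le fun ε hε => ?_
  -- The summand 1 keeps M positive when both measures vanish.
  set M := μ.real Set.univ + ν.real Set.univ + 1 with hM
  have hMpos : 0 < M := by positivity
  obtain ⟨p, hp⟩ := exists_polynomial_near_of_continuousOn (-R) R φ φ.continuous.continuousOn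
    (ε / M) (by positivity)
  have hb : ∀ (ρ : Measure ℝ) [IsFiniteMeasure ρ],
      (∀ᵐ x ∂ρ, x ∈ Metric.closedBall (0 : ℝ) R) →
      ‖∫ x, φ x ∂ρ - ∫ x, p.eval x ∂ρ‖ ≤ ε / M * ρ.real Set.univ := by
    intro ρ _ hρ
    rw [← integral_sub (hint ρ hρ φ.continuous) (hint ρ hρ p.continuous)]
    refine norm_integral_le_of_norm_le_const (hρ.mono fun x hx => ?_)
    rw [Real.closedBall_eq_Icc, zero_sub, zero_add] at hx
    rw [Real.norm_eq_abs, abs_sub_comm]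
    exact (hp x hx).le
  have h1 := hb μ hμ
  have h2 := hb ν hν
  rw [hpoly p] at h1
  rw [dist_eq_norm]
  calc ‖∫ x, φ x ∂μ - ∫ x, φ x ∂ν‖
      ≤ ‖∫ x, φ x ∂μ - ∫ x, p.eval x ∂ν‖ + ‖∫ x, φ x ∂ν - ∫ x, p.eval x ∂ν‖ := by
        rw [norm_sub_rev (∫ x, φ x ∂ν)]
        exact norm_sub_le_norm_sub_add_norm_sub _ _ _
    _ ≤ ε / M * μ.real Set.univ + ε / M * ν.real Set.univ := add_le_add h1 h2
    _ = ε / M * (M - 1) := by rw [hM]; ring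
    _ ≤ ε / M * M := by gcongr; linarith
    _ = ε := by field_simp

theorem integral_pow_spectralMeasure {T : V →L[ℂ] V} (hT : IsSelfAdjoint T) (f : V) (k : ℕ) :
    ∫ x, x ^ k ∂spectralMeasure T f = (inner ℂ f ((T ^ k) f)).re := by
  rw [integral_spectralMeasure T f (continuous_pow k), cfc_pow_id T k hT]

/-- The form f ↦ ⟨f, φ(T) f⟩ is quadratic. Dropping one term bounds the measure of a sum by those of
the summands, so conditions on null sets pass to sums. -/
theorem spectralMeasure_parallelogram (T : V →L[ℂ] V) (f g : V) :
    spectralMeasure T (f + g) + spectralMeasure T (f - g) =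
      (2 : ℝ≥0∞) • (spectralMeasure T f + spectralMeasure T g) := by
  have : IsFiniteMeasure ((2 : ℝ≥0∞) • (spectralMeasure T f + spectralMeasure T g)) :=
    Measure.smul_finite _ (by simp)
  refine ext_of_forall_integral_eq_of_IsFiniteMeasure fun φ => ?_
  have hi := fun f : V => φ.continuous.integrable_spectralMeasure T f
  rw [integral_add_measure (hi _) (hi _), integral_smul_measure,
    integral_add_measure (hi _) (hi _)]
  simp only [integral_spectralMeasure T _ φ.continuous, map_add, map_sub, inner_add_left,
    inner_add_right, inner_sub_left, inner_sub_right, Complex.add_re, Complex.sub_re,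
    ENNReal.toReal_ofNat, smul_eq_mul]
  ring

theorem spectralMeasure_add_le (T : V →L[ℂ] V) (f g : V) :
    spectralMeasure T (f + g) ≤ (2 : ℝ≥0∞) • (spectralMeasure T f + spectralMeasure T g) := by
  rw [← spectralMeasure_parallelogram]
  exact Measure.le_add_right le_rfl

/-- Testing against ψ gives ⟨f, (φψφ)(T) f⟩, so applying φ(T) only inserts the density φ²; null sets
stay null. -/
theorem spectralMeasure_cfc (T : V →L[ℂ] V) (f : V) {φ : ℝ → ℝ} (hφ : Continuous φ) :
    spectralMeasure T (cfc φ T f) =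
      (spectralMeasure T f).withDensity (fun x => ENNReal.ofReal (φ x ^ 2)) := by
  have : IsFiniteMeasure ((spectralMeasure T f).withDensity fun x => ENNReal.ofReal (φ x ^ 2)) :=
    isFiniteMeasure_withDensity_ofReal
      ((hφ.pow 2).integrable_spectralMeasure T f).hasFiniteIntegral
  refine ext_of_forall_integral_eq_of_IsFiniteMeasure fun ψ => ?_
  rw [integral_spectralMeasure T _ ψ.continuous,
    integral_withDensity_eq_integral_toReal_smul (by fun_prop) (by simp)]
  have h1 : inner ℂ (cfc φ T f) (cfc ψ T (cfc φ T f)) =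
      inner ℂ f (cfc (fun x => φ x * (ψ x * φ x)) T f) := by
    rw [← inner_cfc_cfc T f hφ (ψ := fun x => ψ x * φ x) (by fun_prop),
      cfc_mul ψ φ T ψ.continuous.continuousOn hφ.continuousOn, mul_apply_eq_comp]
  rw [h1, ← integral_spectralMeasure T f (φ := fun x => φ x * (ψ x * φ x)) (by fun_prop)]
  refine integral_congr_ae (Eventually.of_forall fun x => ?_)
  simp only [ENNReal.toReal_ofReal (sq_nonneg (φ x)), smul_eq_mul]
  ring

theorem spectralMeasure_smul (T : V →L[ℂ] V) (c : ℂ) (f : V) :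
    spectralMeasure T (c • f) = ENNReal.ofReal (‖c‖ ^ 2) • spectralMeasure T f := by
  have : IsFiniteMeasure (ENNReal.ofReal (‖c‖ ^ 2) • spectralMeasure T f) :=
    Measure.smul_finite _ (by simp)
  refine ext_of_forall_integral_eq_of_IsFiniteMeasure fun φ => ?_
  rw [integral_smul_measure, integral_spectralMeasure T _ φ.continuous,
    integral_spectralMeasure T _ φ.continuous, map_smul, inner_smul_left, inner_smul_right,
    ← mul_assoc, mul_comm (starRingEnd ℂ c), Complex.mul_conj, Complex.normSq_eq_norm_sq,
    ENNReal.toReal_ofReal (sq_nonneg _), Complex.re_ofReal_mul]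
  rfl

/-- The measure `1_B σ(f)` is the spectral measure of a limit of vectors `φ(T) f`. -/
theorem exists_spectralMeasure_eq_restrict (T : V →L[ℂ] V) (f : V)
    {B : Set ℝ} (hB : MeasurableSet B) {K : Set V} (hK : IsClosed K)
    (hKf : ∀ φ : ℝ → ℝ, Continuous φ → cfc φ T f ∈ K) :
    ∃ u ∈ K, spectralMeasure T u = (spectralMeasure T f).restrict B := by
  set σ := spectralMeasure T f with hσ
  have hmem : MemLp (B.indicator fun _ => (1 : ℝ)) 2 σ := memLp_indicator_const 2 hB 1 (by simp)
  have happ : ∀ n : ℕ, ∃ φ : ℝ → ℝ, Continuous φ ∧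
      eLpNorm ((B.indicator fun _ => (1 : ℝ)) - φ) 2 σ ≤ ENNReal.ofReal (1 / (n + 1)) := by
    intro n
    obtain ⟨φ, -, h2, h3, -⟩ := hmem.exists_hasCompactSupport_eLpNorm_sub_le (by simp)
      (ε := ENNReal.ofReal (1 / (n + 1))) (by simpa using by positivity)
    exact ⟨φ, h3, h2⟩
  choose φ hφ hφB using happ
  let I : Lp ℝ 2 σ := hmem.toLp _
  let Φ : ℕ → Lp ℝ 2 σ := fun n => ((hφ n).memLp_spectralMeasure T f).toLp _
  have hΦ : Tendsto Φ atTop (𝓝 I) := by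
    rw [tendsto_iff_norm_sub_tendsto_zero]
    refine squeeze_zero (fun n => norm_nonneg _) (fun n => ?_)
      (tendsto_one_div_add_atTop_nhds_zero_nat (𝕜 := ℝ))
    rw [norm_sub_rev, ← MemLp.toLp_sub, Lp.norm_toLp]
    exact ENNReal.toReal_le_of_le_ofReal (by positivity) (hφB n)
  -- The map φ ↦ φ(T) f is isometric for the L²(σ) norm, so approximating the indicator of B in
  -- L²(σ) produces a Cauchy sequence of vectors.
  have hnorm : ∀ m n, ‖cfc (φ m) T f - cfc (φ n) T f‖ = ‖Φ m - Φ n‖ := by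
    intro m n
    have h1 : cfc (φ m) T f - cfc (φ n) T f = cfc (fun x => φ m x - φ n x) T f := by
      rw [cfc_sub (φ m) (φ n) T (hφ m).continuousOn (hφ n).continuousOn]
      rfl
    rw [h1, ← MemLp.toLp_sub, ← sq_eq_sq₀ (norm_nonneg _) (norm_nonneg _),
      norm_cfc_apply_sq T f (φ := fun x => φ m x - φ n x)
        (by have := hφ m; have := hφ n; fun_prop), ← real_inner_self_eq_norm_sq, L2.inner_def]
    refine integral_congr_ae ?_
    filter_upwards [MemLp.coeFn_toLp (((hφ m).memLp_spectralMeasure T f).sub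
      ((hφ n).memLp_spectralMeasure T f))] with x hx
    rw [hx]
    simp [pow_two]
  have hcauchy : CauchySeq fun n => cfc (φ n) T f := by
    have := hΦ.cauchySeq
    rw [Metric.cauchySeq_iff] at this ⊢
    intro ε hε
    obtain ⟨N, hN⟩ := this ε hε
    refine ⟨N, fun m hm n hn => ?_⟩
    have := hN m hm n hn
    rwa [dist_eq_norm, hnorm, ← dist_eq_norm]
  obtain ⟨u, hu⟩ := cauchySeq_tendsto_of_complete hcauchy
  refine ⟨u, hK.mem_of_tendsto hu (Eventually.of_forall fun n => hKf _ (hφ n)), ?_⟩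
  refine ext_of_forall_integral_eq_of_IsFiniteMeasure fun ψ => ?_
  rw [integral_spectralMeasure T _ ψ.continuous]
  have h1 : Tendsto (fun n => (inner ℂ (cfc (φ n) T f) (cfc ψ T (cfc (φ n) T f))).re) atTop
      (𝓝 (inner ℂ u (cfc ψ T u)).re) :=
    (Complex.continuous_re.tendsto _).comp
      (hu.inner (((cfc ψ T).continuous.tendsto u).comp hu))
  -- As the indicator of B equals its square, the error is the integral of ψ (φₙ - 1_B)(φₙ + 1_B),
  -- an inner product in L²(σ) to which Cauchy-Schwarz applies.
  have h2 : Tendsto (fun n => ∫ x, φ n x * (ψ x * φ n x) ∂σ) atTop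
      (𝓝 (∫ x, ψ x ∂σ.restrict B)) := by
    rw [tendsto_iff_norm_sub_tendsto_zero]
    have hlim : Tendsto (fun n => ‖Φ n - I‖ * (‖ψ‖ * ‖Φ n + I‖)) atTop (𝓝 0) := by
      have := (tendsto_iff_norm_sub_tendsto_zero.1 hΦ).mul
        ((hΦ.add_const I).norm.const_mul ‖ψ‖)
      simpa using this
    refine squeeze_zero (fun n => norm_nonneg _) (fun n => ?_) hlim
    have hφn := (hφ n).memLp_spectralMeasure T f
    have hX : MemLp (fun x => ψ x * (φ n x + B.indicator (fun _ => (1 : ℝ)) x)) 2 σ := by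
      refine (hφn.add hmem).of_le_mul (c := ‖ψ‖)
        (ψ.continuous.aestronglyMeasurable.mul (hφn.add hmem).1)
        (Eventually.of_forall fun x => ?_)
      rw [norm_mul]
      exact mul_le_mul_of_nonneg_right (ψ.norm_coe_le_norm x) (norm_nonneg _)
    have hXn : ‖hX.toLp‖ ≤ ‖ψ‖ * ‖Φ n + I‖ := by
      refine Lp.norm_le_mul_norm_of_ae_le_mul ?_
      filter_upwards [hX.coeFn_toLp, (hφn.add hmem).coeFn_toLp] with x h1 h2
      rw [h1, ← MemLp.toLp_add, h2, norm_mul]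
      exact mul_le_mul_of_nonneg_right (ψ.norm_coe_le_norm x) (norm_nonneg _)
    refine le_trans (le_of_eq ?_) ((norm_inner_le_norm (𝕜 := ℝ) (Φ n - I) hX.toLp).trans
      (mul_le_mul_of_nonneg_left hXn (norm_nonneg _)))
    congr 1
    rw [← integral_indicator hB, ← integral_sub, ← MemLp.toLp_sub, L2.inner_def]
    · refine integral_congr_ae ?_
      filter_upwards [hX.coeFn_toLp, (hφn.sub hmem).coeFn_toLp] with x h1 h2
      rw [h1, h2]
      by_cases hx : x ∈ B <;> simp [hx] <;> ring
    · exact Continuous.integrable_spectralMeasure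
        (by have := hφ n; fun_prop : Continuous fun x => φ n x * (ψ x * φ n x)) T f
    · exact (ψ.continuous.integrable_spectralMeasure T f).indicator hB
  refine tendsto_nhds_unique h1 (h2.congr fun n => ?_)
  have hc : Continuous fun x => ψ x * φ n x := by have := hφ n; fun_prop
  rw [hσ, integral_spectralMeasure T f (φ := fun x => φ n x * (ψ x * φ n x))
      (by have := hφ n; fun_prop), ← inner_cfc_cfc T f (hφ n) hc,
    cfc_mul ψ (φ n) T ψ.continuous.continuousOn (hφ n).continuousOn, mul_apply_eq_comp]

end Spectral

/-! ### Spectral types described by null sets. -/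

/-- A property of measures which passes from a countable family to every measure vanishing on the
common null sets of the family. -/
def DominationClosed (P : Measure ℝ → Prop) : Prop :=
  ∀ (ι : Type) [Countable ι] (σ : ι → Measure ℝ) (τ : Measure ℝ) [∀ i, IsFiniteMeasure (σ i)]
    [IsFiniteMeasure τ], (∀ i, P (σ i)) →
    (∀ B, MeasurableSet B → (∀ i, σ i B = 0) → τ B = 0) → P τ

theorem DominationClosed.and {P Q : Measure ℝ → Prop} (hP : DominationClosed P)
    (hQ : DominationClosed Q) : DominationClosed fun σ => P σ ∧ Q σ :=
  fun ι _ σ τ _ _ h hB => ⟨hP ι σ τ (fun i => (h i).1) hB, hQ ι σ τ (fun i => (h i).2) hB⟩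

/-- `part` extracts from a finite measure its component of the type described by `P`. -/
structure IsSpectralType (part : Measure ℝ → Measure ℝ) (P : Measure ℝ → Prop) : Prop where
  dominationClosed : DominationClosed P
  dominationClosed_null : ∀ U, MeasurableSet U → DominationClosed fun σ => part σ U = 0
  part_eq_self : ∀ (σ : Measure ℝ) [IsFiniteMeasure σ], P σ → part σ = σ
  exists_restrict : ∀ (σ : Measure ℝ) [IsFiniteMeasure σ],
    ∃ B, MeasurableSet B ∧ part σ = σ.restrict B ∧ P (part σ)

theorem countable_atoms (σ : Measure ℝ) [IsFiniteMeasure σ] : {t | σ {t} ≠ 0}.Countable := by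
  have h := Measure.countable_meas_level_set_pos (μ := σ) (measurable_id (α := ℝ))
  refine h.mono fun t ht => ?_
  simpa [pos_iff_ne_zero] using ht

theorem measurableSet_atoms (σ : Measure ℝ) [IsFiniteMeasure σ] :
    MeasurableSet {t | σ {t} ≠ 0} := (countable_atoms σ).measurableSet

/-- Mutual singularity supplies one set S that carries Lebesgue measure and is null for the singular
part; cutting σ along S separates its two Lebesgue parts. -/
theorem exists_restrict_eq_acPart (σ : Measure ℝ) [IsFiniteMeasure σ] :
    ∃ S, MeasurableSet S ∧ volume Sᶜ = 0 ∧ acPart σ = σ.restrict S ∧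
      σ.singularPart volume = σ.restrict Sᶜ := by
  obtain ⟨S, hS, h1, h2⟩ := Measure.mutuallySingular_singularPart σ volume
  have hd := Measure.haveLebesgueDecomposition_add σ volume
  have hac : acPart σ ≪ volume := withDensity_absolutelyContinuous _ _
  refine ⟨S, hS, h2, ?_, ?_⟩
  · conv_rhs => rw [hd]
    rw [Measure.restrict_add, Measure.restrict_eq_zero.2 h1, zero_add]
    exact (Measure.restrict_eq_self_of_ae_mem (hac h2)).symm
  · conv_rhs => rw [hd]
    have h3 : (volume.withDensity (σ.rnDeriv volume)).restrict Sᶜ = 0 :=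
      Measure.restrict_eq_zero.2 (hac h2)
    rw [Measure.restrict_add, h3, add_zero]
    exact (Measure.restrict_eq_self_of_ae_mem
      (by rw [ae_iff]; simpa using h1)).symm

/-- This form mentions only null sets of σ, up to a Lebesgue-null exception; such exceptions can be
united over a countable family, which is what closure under domination requires. -/
theorem acPart_apply_eq_zero_iff (σ : Measure ℝ) [IsFiniteMeasure σ] {U : Set ℝ}
    (hU : MeasurableSet U) :
    acPart σ U = 0 ↔ ∃ B, MeasurableSet B ∧ volume B = 0 ∧ σ (U \ B) = 0 := by
  obtain ⟨S, hS, h1, h2, -⟩ := exists_restrict_eq_acPart σ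
  constructor
  · intro h
    refine ⟨Sᶜ, hS.compl, h1, ?_⟩
    rw [h2, Measure.restrict_apply hU] at h
    rwa [Set.sdiff_compl]
  · rintro ⟨B, hB, hB0, h⟩
    have h3 : acPart σ B = 0 := withDensity_absolutelyContinuous _ _ hB0
    rw [← measure_sdiff_null h3, h2]
    exact le_antisymm ((Measure.restrict_apply_le _ _).trans h.le) zero_le

/-- Again a condition on null sets. The countable C discards the atoms, and testing on Lebesgue-null
B discards the absolutely continuous part; countable exceptions are stable under countable unions.
-/
theorem scPart_apply_eq_zero_iff (σ : Measure ℝ) [IsFiniteMeasure σ] {U : Set ℝ}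
    (hU : MeasurableSet U) :
    scPart σ U = 0 ↔ ∃ C : Set ℝ, C.Countable ∧
      ∀ B, MeasurableSet B → volume B = 0 → σ ((U ∩ B) \ C) = 0 := by
  obtain ⟨S, hS, h1, h2, h3⟩ := exists_restrict_eq_acPart σ
  have hA := measurableSet_atoms σ
  have hcompl : {t | σ {t} = 0} = {t | σ {t} ≠ 0}ᶜ := by ext; simp
  have hsc : scPart σ U = σ ((U ∩ Sᶜ) \ {t | σ {t} ≠ 0}) := by
    rw [scPart, h3, hcompl, Measure.restrict_restrict hA.compl, Measure.restrict_apply hU]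
    congr 1
    ext; simp; tauto
  constructor
  · intro h
    refine ⟨_, countable_atoms σ, fun B hB hB0 => ?_⟩
    have h4 : σ (B ∩ S) = 0 := by
      rw [← Measure.restrict_apply hB, ← h2]
      exact withDensity_absolutelyContinuous _ _ hB0
    refine measure_mono_null (t := (B ∩ S) ∪ ((U ∩ Sᶜ) \ {t | σ {t} ≠ 0})) ?_
      (measure_union_null h4 (hsc ▸ h))
    rintro x ⟨⟨hxU, hxB⟩, hxA⟩
    by_cases hx : x ∈ S
    · exact Or.inl ⟨hxB, hx⟩
    · exact Or.inr ⟨⟨hxU, hx⟩, hxA⟩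
  · rintro ⟨C, hC, h⟩
    rw [hsc]
    have h4 : σ (C \ {t | σ {t} ≠ 0}) = 0 := by
      refine (measure_null_iff_singleton (hC.mono Set.sdiff_subset)).2 fun x hx => ?_
      simpa using hx.2
    refine measure_mono_null (t := ((U ∩ Sᶜ) \ C) ∪ (C \ {t | σ {t} ≠ 0})) ?_
      (measure_union_null (h _ hS.compl h1) h4)
    rintro x ⟨hx, hxA⟩
    by_cases hxC : x ∈ C
    · exact Or.inr ⟨hxC, hxA⟩
    · exact Or.inl ⟨hx, hxC⟩

theorem ppPart_apply_eq_zero_iff (σ : Measure ℝ) [IsFiniteMeasure σ] {U : Set ℝ}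
    (hU : MeasurableSet U) : ppPart σ U = 0 ↔ ∀ t ∈ U, σ {t} = 0 := by
  rw [ppPart, Measure.restrict_apply hU]
  constructor
  · intro h t ht
    by_contra hne
    have hsub : {t} ⊆ U ∩ {t | σ {t} ≠ 0} := by
      rintro _ rfl
      exact ⟨ht, hne⟩
    exact hne (measure_mono_null hsub h)
  · intro h
    have : U ∩ {t | σ {t} ≠ 0} = ∅ := by
      ext t; simpa using h t
    rw [this, measure_empty]

theorem isSpectralType_ac : IsSpectralType acPart (fun σ => σ ≪ volume) where
  dominationClosed := fun ι _ σ τ _ _ h hB =>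
    Measure.AbsolutelyContinuous.mk fun B hBm hB0 => hB B hBm fun i => h i hB0
  dominationClosed_null := by
    intro U hU ι _ σ τ _ _ h hB
    simp only [acPart_apply_eq_zero_iff _ hU] at h ⊢
    choose B hBm hB0 hσ using h
    refine ⟨⋃ i, B i, MeasurableSet.iUnion hBm, measure_iUnion_null hB0, ?_⟩
    exact hB _ (hU.diff (MeasurableSet.iUnion hBm)) fun i =>
      measure_mono_null (Set.sdiff_subset_sdiff_right (Set.subset_iUnion B i)) (hσ i)
  part_eq_self := fun σ _ h => Measure.withDensity_rnDeriv_eq σ volume h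
  exists_restrict := fun σ _ => by
    obtain ⟨S, hS, -, h, -⟩ := exists_restrict_eq_acPart σ
    exact ⟨S, hS, h, withDensity_absolutelyContinuous _ _⟩

theorem isSpectralType_sc :
    IsSpectralType scPart (fun σ => σ ⟂ₘ volume ∧ ∀ t, σ {t} = 0) where
  dominationClosed := by
    refine DominationClosed.and ?_ ?_
    · intro ι _ σ τ _ _ h hB
      choose S hS h1 h2 using h
      refine ⟨⋂ i, S i, MeasurableSet.iInter hS, hB _ (MeasurableSet.iInter hS) fun i =>
        measure_mono_null (Set.iInter_subset S i) (h1 i), ?_⟩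
      rw [Set.compl_iInter]
      exact measure_iUnion_null h2
    · intro ι _ σ τ _ _ h hB t
      exact hB _ (measurableSet_singleton t) fun i => h i t
  dominationClosed_null := by
    intro U hU ι _ σ τ _ _ h hB
    simp only [scPart_apply_eq_zero_iff _ hU] at h ⊢
    choose C hC hσ using h
    refine ⟨⋃ i, C i, Set.countable_iUnion hC, fun B hBm hB0 => ?_⟩
    refine hB _ ((hU.inter hBm).diff (Set.countable_iUnion hC).measurableSet) fun i => ?_
    exact measure_mono_null (Set.sdiff_subset_sdiff_right (Set.subset_iUnion C i)) (hσ i B hBm hB0)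
  part_eq_self := by
    rintro σ _ ⟨h1, h2⟩
    have h3 : {t | σ {t} = 0} = Set.univ := Set.eq_univ_of_forall h2
    rw [scPart, Measure.singularPart_eq_self.2 h1, h3, Measure.restrict_univ]
  exists_restrict := by
    intro σ _
    obtain ⟨S, hS, h1, h2, h3⟩ := exists_restrict_eq_acPart σ
    have hA := measurableSet_atoms σ
    have hcompl : {t | σ {t} = 0} = {t | σ {t} ≠ 0}ᶜ := by ext; simp
    refine ⟨{t | σ {t} ≠ 0}ᶜ ∩ Sᶜ, hA.compl.inter hS.compl, ?_, ?_, fun t => ?_⟩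
    · rw [scPart, h3, hcompl, Measure.restrict_restrict hA.compl]
    · exact ((Measure.mutuallySingular_singularPart σ volume).restrict _)
    · rw [scPart, hcompl, Measure.restrict_apply (measurableSet_singleton t)]
      by_cases ht : σ {t} = 0
      · have := Measure.singularPart_le σ volume {t}
        rw [ht] at this
        exact measure_mono_null Set.inter_subset_left (le_antisymm this zero_le)
      · rw [Set.singleton_inter_eq_empty.2 (by simpa using ht), measure_empty]

theorem isSpectralType_pp :
    IsSpectralType ppPart (fun σ => ∃ C : Set ℝ, C.Countable ∧ σ Cᶜ = 0) where
  dominationClosed := by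
    intro ι _ σ τ _ _ h hB
    choose C hC h1 using h
    have hU := Set.countable_iUnion hC
    exact ⟨⋃ i, C i, hU, hB _ hU.measurableSet.compl fun i =>
      measure_mono_null (Set.compl_subset_compl.2 (Set.subset_iUnion C i)) (h1 i)⟩
  dominationClosed_null := by
    intro U hU ι _ σ τ _ _ h hB
    simp only [ppPart_apply_eq_zero_iff _ hU] at h ⊢
    exact fun t ht => hB _ (measurableSet_singleton t) fun i => h i t ht
  part_eq_self := by
    rintro σ _ ⟨C, hC, h⟩
    refine Measure.restrict_eq_self_of_ae_mem ?_
    have h4 : σ (C \ {t | σ {t} ≠ 0}) = 0 := by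
      refine (measure_null_iff_singleton (hC.mono Set.sdiff_subset)).2 fun x hx => ?_
      simpa using hx.2
    refine measure_mono_null (t := Cᶜ ∪ (C \ {t | σ {t} ≠ 0})) ?_ (measure_union_null h h4)
    intro x hx
    by_cases hxC : x ∈ C
    · exact Or.inr ⟨hxC, hx⟩
    · exact Or.inl hxC
  exists_restrict := fun σ _ => ⟨_, measurableSet_atoms σ, rfl, _, countable_atoms σ, by
    rw [ppPart, Measure.restrict_apply (measurableSet_atoms σ).compl, Set.compl_inter_self,
      measure_empty]⟩

/-! ### Spectrum of the restriction to the vectors of a given type. -/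

section Spectral

variable {V : Type*} [NormedAddCommGroup V] [InnerProductSpace ℂ V] [CompleteSpace V]

/-- The vectors whose spectral measure has a property closed under domination. -/
def spectralSubmodule {T : V →L[ℂ] V} (hT : IsSelfAdjoint T) {P : Measure ℝ → Prop}
    (hP : DominationClosed P) : Submodule ℂ V where
  carrier := {f | P (spectralMeasure T f)}
  zero_mem' := by
    -- The empty family dominates only the zero measure, and the measure of the vector 0 is zero.
    refine hP Empty (fun _ => 0) _ (fun e => e.elim) fun B _ _ => ?_
    have := spectralMeasure_le hT 0 B
    simpa using this
  add_mem' := by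
    intro f g hf hg
    refine hP Bool (fun i => spectralMeasure T (if i then f else g)) _ ?_ ?_
    · intro i; cases i <;> simpa
    · intro B _ h
      have h1 : spectralMeasure T f B = 0 := h true
      have h2 : spectralMeasure T g B = 0 := h false
      have := spectralMeasure_add_le T f g B
      simpa [h1, h2] using this
  smul_mem' := by
    intro c f hf
    refine hP Unit (fun _ => spectralMeasure T f) _ (fun _ => hf) fun B _ h => ?_
    rw [spectralMeasure_smul, Measure.smul_apply, h (), smul_zero]

variable {T : V →L[ℂ] V} {P : Measure ℝ → Prop}

/-- If all σ(uₙ) vanish on B, then σ(f)(B) ≤ 2 σ(f - uₙ)(B) ≤ 2‖f - uₙ‖², which tends to 0. So the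
sequence dominates its limit. -/
theorem isClosed_spectralSubmodule (hT : IsSelfAdjoint T) (hP : DominationClosed P) : IsClosed (spectralSubmodule hT hP : Set V) := by
  refine isClosed_of_closure_subset fun f hf => ?_
  obtain ⟨u, hu, hlim⟩ := mem_closure_iff_seq_limit.1 hf
  refine hP ℕ (fun n => spectralMeasure T (u n)) _ hu fun B _ h => ?_
  have hle : ∀ n, spectralMeasure T f B ≤ 2 * ENNReal.ofReal (‖f - u n‖ ^ 2) := by
    intro n
    have h1 := spectralMeasure_add_le T (f - u n) (u n) B
    simp only [sub_add_cancel, Measure.smul_apply, Measure.add_apply, smul_eq_mul] at h1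
    rw [h n, add_zero] at h1
    exact h1.trans (by gcongr; exact spectralMeasure_le hT _ _)
  have hl : Tendsto (fun n => 2 * ENNReal.ofReal (‖f - u n‖ ^ 2)) atTop (𝓝 (2 * 0)) := by
    refine ENNReal.Tendsto.const_mul ?_ (Or.inr (by simp))
    rw [← ENNReal.ofReal_zero]
    refine ENNReal.tendsto_ofReal ?_
    have : Tendsto (fun n => f - u n) atTop (𝓝 (f - f)) := tendsto_const_nhds.sub hlim
    simpa using this.norm.pow 2
  rw [mul_zero] at hl
  exact le_antisymm (ge_of_tendsto' hl hle) zero_le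

theorem cfc_mem_spectralSubmodule (hT : IsSelfAdjoint T) (hP : DominationClosed P)
    {f : V} (hf : f ∈ spectralSubmodule hT hP) {φ : ℝ → ℝ}
    (hφ : Continuous φ) : cfc φ T f ∈ spectralSubmodule hT hP := by
  refine hP Unit (fun _ => spectralMeasure T f) _ (fun _ => hf) fun B _ h => ?_
  rw [spectralMeasure_cfc T f hφ]
  exact withDensity_absolutelyContinuous _ _ (h ())

theorem sub_smul_eq_cfc (hT : IsSelfAdjoint T) (f : V) (t : ℝ) :
    T f - (t : ℂ) • f = cfc (fun x : ℝ => x - t) T f := by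
  rw [cfc_sub (fun x => x) (fun _ => t) T, cfc_id' ℝ T hT, cfc_const t T hT]
  simp [Algebra.algebraMap_eq_smul_one]

/-- The spectrum of the restriction to an invariant closed subspace, in terms of the spectral
measures of the vectors of the subspace. -/
theorem notMem_restrictedSpectrum_iff (hT : IsSelfAdjoint T) {K : Submodule ℂ V}
    (hK : ∀ f ∈ K, ∀ φ : ℝ → ℝ, Continuous φ → cfc φ T f ∈ K) (t : ℝ) :
    t ∉ restrictedSpectrum T (K : Set V) ↔
      ∃ ε > 0, ∀ f ∈ K, spectralMeasure T f (Set.Ioo (t - ε) (t + ε)) = 0 := by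
  have hc : Continuous fun x : ℝ => x - t := by fun_prop
  simp only [restrictedSpectrum, Set.mem_ofPred_eq, not_not, sub_smul_eq_cfc hT]
  constructor
  · rintro ⟨-, C, hC⟩
    -- Chosen so that |C| ε < 1, also when C is 0 or negative.
    set ε : ℝ := (|C| + 1)⁻¹ with hε
    have hεpos : 0 < ε := by positivity
    refine ⟨ε, hεpos, fun f hf => ?_⟩
    -- A tent supported by the interval: T - t contracts φ(T) f by the factor ε, which contradicts
    -- the lower bound unless φ(T) f = 0.
    set φ : ℝ → ℝ := fun x => max (ε - |x - t|) 0 with hφ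
    have hφc : Continuous φ := by fun_prop
    have hsupp : ∀ x, φ x ≠ 0 ↔ x ∈ Set.Ioo (t - ε) (t + ε) := by
      intro x
      rw [← Real.ball_eq_Ioo, Metric.mem_ball, Real.dist_eq, hφ]
      constructor
      · intro h
        by_contra hx
        exact h (max_eq_right (by linarith))
      · intro h
        exact (lt_max_of_lt_left (by linarith)).ne'
    have hu : cfc φ T f ∈ K := hK f hf φ hφc
    have h1 := hC _ hu
    have h2 : ‖cfc (fun x : ℝ => x - t) T (cfc φ T f)‖ ≤ ε * ‖cfc φ T f‖ := by
      have e : cfc (fun x : ℝ => x - t) T (cfc φ T f) = cfc (fun x => (x - t) * φ x) T f := by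
        rw [cfc_mul (fun x : ℝ => x - t) φ T hc.continuousOn hφc.continuousOn,
          mul_apply_eq_comp]
      rw [← sq_le_sq₀ (norm_nonneg _) (by positivity), mul_pow, e,
        norm_cfc_apply_sq T f (φ := fun x => (x - t) * φ x) (by fun_prop),
        norm_cfc_apply_sq T f hφc, ← integral_const_mul]
      refine integral_mono (Continuous.integrable_spectralMeasure (by fun_prop) T f)
        (Continuous.integrable_spectralMeasure (by fun_prop) T f) fun x => ?_
      by_cases hx : φ x = 0
      · simp [hx]
      · have := (hsupp x).1 hx
        rw [← Real.ball_eq_Ioo, Metric.mem_ball, Real.dist_eq] at this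
        change ((x - t) * φ x) ^ 2 ≤ ε ^ 2 * φ x ^ 2
        rw [mul_pow]
        gcongr ?_ * _
        exact sq_le_sq.2 (by rw [abs_of_pos hεpos]; exact this.le)
    have h3 : cfc φ T f = 0 := by
      by_contra hne
      have hpos := norm_pos_iff.2 hne
      have h4 : ‖cfc φ T f‖ ≤ |C| * (ε * ‖cfc φ T f‖) :=
        h1.trans ((mul_le_mul_of_nonneg_right (le_abs_self C) (norm_nonneg _)).trans
          (mul_le_mul_of_nonneg_left h2 (abs_nonneg _)))
      have h5 : |C| * ε < 1 := by
        rw [hε, ← div_eq_mul_inv, div_lt_one (by positivity)]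
        linarith
      nlinarith
    have h4 := norm_cfc_apply_sq T f hφc
    rw [h3, norm_zero, zero_pow two_ne_zero, eq_comm, integral_eq_zero_iff_of_nonneg
      (fun x => sq_nonneg _) ((hφc.pow 2).integrable_spectralMeasure T f)] at h4
    refine measure_mono_null (fun x hx => ?_) h4
    simpa using (hsupp x).2 hx
  · rintro ⟨ε, hε, h⟩
    -- A continuous function equal to 1/(x - t) off the interval; since the vectors of K do not
    -- charge the interval, g(T) inverts T - t on K.
    set g : ℝ → ℝ := fun x => (x - t) / max (ε ^ 2) ((x - t) ^ 2) with hg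
    have hden : ∀ x : ℝ, 0 < max (ε ^ 2) ((x - t) ^ 2) := fun x =>
      lt_max_of_lt_left (by positivity)
    have hgc : Continuous g := by
      have hd : Continuous fun x : ℝ => max (ε ^ 2) ((x - t) ^ 2) := by fun_prop
      exact hc.div hd fun x => (hden x).ne'
    have hout : ∀ f ∈ K, ∀ᵐ x ∂spectralMeasure T f, ε ^ 2 ≤ (x - t) ^ 2 := by
      intro f hf
      refine measure_mono_null (fun x hx => ?_) (h f hf)
      rw [← Real.ball_eq_Ioo, Metric.mem_ball, Real.dist_eq]
      by_contra hlt
      refine hx ?_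
      have := sq_le_sq' (by linarith) (not_lt.1 hlt)
      rwa [sq_abs] at this
    have hinv : ∀ f ∈ K, cfc (fun x : ℝ => (x - t) * g x) T f = f := by
      intro f hf
      have e : cfc (fun x : ℝ => (x - t) * g x) T f - f =
          cfc (fun x : ℝ => (x - t) * g x - 1) T f := by
        rw [cfc_sub (fun x : ℝ => (x - t) * g x) (fun _ => 1) T (by fun_prop) (by fun_prop),
          cfc_const_one ℝ T]
        rfl
      rw [← sub_eq_zero, e, ← norm_eq_zero, ← sq_eq_zero_iff,
        norm_cfc_apply_sq T f (φ := fun x => (x - t) * g x - 1) (by fun_prop)]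
      refine integral_eq_zero_of_ae ((hout f hf).mono fun x hx => ?_)
      have : (x - t) ^ 2 ≠ 0 := (lt_of_lt_of_le (by positivity) hx).ne'
      simp only [hg, max_eq_right hx, Pi.zero_apply]
      rw [mul_div_assoc', ← pow_two, div_self this, sub_self, zero_pow two_ne_zero]
    have h1 : ∀ f, cfc (fun x : ℝ => x - t) T (cfc g T f) =
        cfc (fun x : ℝ => (x - t) * g x) T f := by
      intro f
      rw [cfc_mul (fun x : ℝ => x - t) g T hc.continuousOn hgc.continuousOn,
        mul_apply_eq_comp]
    have hbound : ∀ f ∈ K, ‖f‖ ≤ ε⁻¹ * ‖cfc (fun x : ℝ => x - t) T f‖ := by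
      intro f hf
      rw [inv_mul_eq_div, le_div_iff₀' hε, ← sq_le_sq₀ (by positivity) (norm_nonneg _), mul_pow,
        norm_cfc_apply_sq T f hc, ← measureReal_spectralMeasure_univ hT f]
      have : ε ^ 2 * (spectralMeasure T f).real Set.univ =
          ∫ _, ε ^ 2 ∂spectralMeasure T f := by simp [mul_comm]
      rw [this]
      exact integral_mono_ae (integrable_const _)
        (Continuous.integrable_spectralMeasure (by fun_prop) T f) (hout f hf)
    refine ⟨⟨fun f hf => hK f hf _ hc, fun f hf f' hf' heq => ?_, fun f hf => ?_⟩, ε⁻¹, hbound⟩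
    · have h2 := hbound (f - f') (K.sub_mem hf hf')
      simp only at heq
      rw [map_sub, heq, sub_self, norm_zero, mul_zero] at h2
      exact sub_eq_zero.1 (norm_le_zero_iff.1 h2)
    · exact ⟨cfc g T f, hK f hf _ hgc, by simp only [h1]; exact hinv f hf⟩

/-- Invariance of M reads P T P = T P for its projection P. Taking adjoints gives P T P = P T, so T
commutes with P, and the functional calculus inherits this. -/
theorem cfc_starProjection (hT : IsSelfAdjoint T) {M : Submodule ℂ V} [M.HasOrthogonalProjection]
    (hM : ∀ f ∈ M, T f ∈ M) (φ : ℝ → ℝ) (f : V) :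
    cfc φ T (M.starProjection f) = M.starProjection (cfc φ T f) := by
  have hcomm : Commute T M.starProjection := by
    have h1 : M.starProjection * T * M.starProjection = T * M.starProjection := by
      ext x
      simp only [mul_apply_eq_comp]
      exact Submodule.starProjection_eq_self_iff.2 (hM _ (Submodule.starProjection_apply_mem _ _))
    have hs : star M.starProjection = M.starProjection := isSelfAdjoint_starProjection M
    have h2 := congrArg star h1
    simp only [star_mul, hs, hT.star_eq] at h2
    have : T * M.starProjection = M.starProjection * T := by
      rw [← h1, mul_assoc, h2]
    exact this
  have h := hcomm.cfc_real φ
  exact congrArg (fun S : V →L[ℂ] V => S f) h.eq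

/-- The spectrum of the part of type `P` of a self-adjoint operator in the orthogonal complement of
an invariant subspace, in terms of the spectral measures of a total family of vectors. -/
theorem mem_restrictedSpectrum_iff (hT : IsSelfAdjoint T) {part : Measure ℝ → Measure ℝ}
    (hpart : IsSpectralType part P)
    {M : Submodule ℂ V} [M.HasOrthogonalProjection] (hM : ∀ f ∈ M, T f ∈ M) {ι : Type*}
    (e : ι → V) (he : (Submodule.span ℂ (Set.range e)).topologicalClosure = ⊤) (t : ℝ) :
    t ∈ restrictedSpectrum T ({f | P (spectralMeasure T f)} ∩ Mᗮ) ↔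
      ∀ ε > 0, ∃ i, part (spectralMeasure T (Mᗮ.starProjection (e i)))
        (Set.Ioo (t - ε) (t + ε)) ≠ 0 := by
  have hM' : ∀ f ∈ Mᗮ, T f ∈ Mᗮ := by
    intro f hf
    rw [Submodule.mem_orthogonal] at hf ⊢
    intro u hu
    have := hf _ (hM u hu)
    rwa [← hT.adjoint_eq, ContinuousLinearMap.adjoint_inner_left] at this
  have hcfcM : ∀ f ∈ Mᗮ, ∀ φ : ℝ → ℝ, cfc φ T f ∈ Mᗮ := by
    intro f hf φ
    rw [← Submodule.starProjection_eq_self_iff.2 hf, cfc_starProjection hT hM']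
    exact Submodule.starProjection_apply_mem _ _
  set K : Submodule ℂ V := spectralSubmodule hT hpart.dominationClosed ⊓ Mᗮ with hKdef
  have hset : ({f | P (spectralMeasure T f)} ∩ Mᗮ : Set V) = K := rfl
  have hK : ∀ f ∈ K, ∀ φ : ℝ → ℝ, Continuous φ → cfc φ T f ∈ K := fun f hf φ hφ =>
    ⟨cfc_mem_spectralSubmodule hT _ hf.1 hφ, hcfcM f hf.2 φ⟩
  rw [hset, ← not_iff_not, notMem_restrictedSpectrum_iff hT hK]
  push Not
  refine exists_congr fun ε => and_congr_right fun hε => ?_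
  set U := Set.Ioo (t - ε) (t + ε)
  constructor
  · intro h i
    set f := Mᗮ.starProjection (e i)
    -- The part is a restriction of σ(f), hence the spectral measure of some u that stays in the
    -- orthogonal complement of M and has the right type; the hypothesis applies to u.
    obtain ⟨B, hB, h1, h2⟩ := hpart.exists_restrict (spectralMeasure T f)
    obtain ⟨u, hu, huB⟩ := exists_spectralMeasure_eq_restrict T f hB
      (Submodule.isClosed_orthogonal M)
      (fun φ _ => hcfcM f (Submodule.starProjection_apply_mem _ _) φ)
    rw [h1, ← huB]
    refine h u ⟨?_, hu⟩
    change P (spectralMeasure T u)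
    rwa [huB, ← h1]
  · intro h f hf
    -- The vectors whose projection has a part not charging U form a closed subspace. It contains
    -- the total family, hence everything; on K neither the projection nor the extraction of the
    -- part changes anything.
    set Q := spectralSubmodule hT (hpart.dominationClosed_null U measurableSet_Ioo) with hQdef
    have hQ : IsClosed ((Q.comap Mᗮ.starProjection.toLinearMap : Submodule ℂ V) : Set V) := by
      have hQ' : IsClosed (Q : Set V) := isClosed_spectralSubmodule hT _
      exact hQ'.preimage Mᗮ.starProjection.continuous
    have hle : (Submodule.span ℂ (Set.range e)).topologicalClosure ≤
        Q.comap Mᗮ.starProjection.toLinearMap := by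
      refine Submodule.topologicalClosure_minimal _ (Submodule.span_le.2 ?_) hQ
      rintro _ ⟨i, rfl⟩
      exact h i
    have hf' : part (spectralMeasure T (Mᗮ.starProjection f)) U = 0 :=
      (he ▸ hle) (Submodule.mem_top (x := f))
    rw [Submodule.starProjection_eq_self_iff.2 hf.2, hpart.part_eq_self _ hf.1] at hf'
    exact hf'

end Spectral

/-! ### Measurability of the parts of a random measure. -/

section MeasurableParts

variable {Ω : Type*} [MeasurableSpace Ω]

/-- A finite kernel needs a uniform bound on its masses; dividing by the total mass provides it, and
the scalar restores the original family. Where the mass is 0 the factor is ⊤ and the product is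
still 0. -/
theorem exists_finiteKernel_smul_eq {κ : Ω → Measure ℝ} (hκ : Measurable κ)
    [∀ ω, IsFiniteMeasure (κ ω)] :
    ∃ (c : Ω → NNReal) (K : ProbabilityTheory.Kernel Ω ℝ), Measurable c ∧
      ProbabilityTheory.IsFiniteKernel K ∧ ∀ ω, κ ω = c ω • K ω := by
  have hu : Measurable fun ω => κ ω Set.univ := (Measure.measurable_coe MeasurableSet.univ).comp hκ
  have hm : Measurable fun ω => (κ ω Set.univ)⁻¹ • κ ω := by
    refine Measure.measurable_of_measurable_coe _ fun s hs => ?_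
    simp only [Measure.smul_apply, smul_eq_mul]
    exact hu.inv.mul ((Measure.measurable_coe hs).comp hκ)
  refine ⟨fun ω => (κ ω Set.univ).toNNReal, ⟨_, hm⟩, hu.ennreal_toNNReal,
    ⟨1, ENNReal.one_lt_top, fun ω => ?_⟩, fun ω => ?_⟩
  · change (κ ω Set.univ)⁻¹ * κ ω Set.univ ≤ 1
    exact ENNReal.inv_mul_le_one _
  · change κ ω = (κ ω Set.univ).toNNReal • ((κ ω Set.univ)⁻¹ • κ ω)
    rw [ENNReal.smul_def, ENNReal.coe_toNNReal (measure_ne_top _ _), smul_smul]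
    by_cases h : κ ω Set.univ = 0
    · rw [Measure.measure_univ_eq_zero.1 h, smul_zero]
    · rw [ENNReal.mul_inv_cancel h (measure_ne_top _ _), one_smul]

/-- The kernel form of the Lebesgue decomposition is applied to finite kernels. An equivalent finite
measure has the same null sets as Lebesgue measure, hence gives the same singular part. -/
theorem singularPart_toFinite_volume (σ : Measure ℝ) [IsFiniteMeasure σ] :
    σ.singularPart (volume : Measure ℝ).toFinite = σ.singularPart volume := by
  set ν := (volume : Measure ℝ).toFinite
  have hν : volume.withDensity (ν.rnDeriv volume) = ν :=
    Measure.withDensity_rnDeriv_eq _ _ (toFinite_absolutelyContinuous _)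
  refine Measure.eq_singularPart (f := ν.rnDeriv volume * σ.rnDeriv ν)
    ((Measure.measurable_rnDeriv _ _).mul (Measure.measurable_rnDeriv _ _))
    ((Measure.mutuallySingular_singularPart σ ν).mono_ac Measure.AbsolutelyContinuous.rfl
      (absolutelyContinuous_toFinite _)) ?_
  rw [withDensity_mul _ (Measure.measurable_rnDeriv _ _) (Measure.measurable_rnDeriv _ _), hν]
  exact Measure.haveLebesgueDecomposition_add σ ν

theorem measurable_singularPart_volume {κ : Ω → Measure ℝ} (hκ : Measurable κ)
    [∀ ω, IsFiniteMeasure (κ ω)] : Measurable fun ω => (κ ω).singularPart volume := by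
  obtain ⟨c, K, hc, hK, h⟩ := exists_finiteKernel_smul_eq hκ
  have h1 : ∀ ω, (κ ω).singularPart volume = c ω •
      (K ω).singularPart (ProbabilityTheory.Kernel.const Ω (volume : Measure ℝ).toFinite ω) := by
    intro ω
    rw [h, Measure.singularPart_smul, ProbabilityTheory.Kernel.const_apply,
      singularPart_toFinite_volume]
  simp only [h1]
  have hm := ProbabilityTheory.Kernel.measurable_singularPart K
    (ProbabilityTheory.Kernel.const Ω (volume : Measure ℝ).toFinite)
  refine Measure.measurable_of_measurable_coe _ fun s hs => ?_
  simp only [Measure.smul_apply, ENNReal.smul_def, smul_eq_mul]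
  exact hc.coe_nnreal_ennreal.mul ((Measure.measurable_coe hs).comp hm)

theorem measurable_apply_prodMk_preimage {κ : Ω → Measure ℝ} (hκ : Measurable κ)
    [∀ ω, IsFiniteMeasure (κ ω)] {D : Set (Ω × ℝ)} (hD : MeasurableSet D) :
    Measurable fun ω => κ ω (Prod.mk ω ⁻¹' D) := by
  obtain ⟨c, K, hc, hK, h⟩ := exists_finiteKernel_smul_eq hκ
  simp only [h, Measure.smul_apply, ENNReal.smul_def, smul_eq_mul]
  exact hc.coe_nnreal_ennreal.mul (ProbabilityTheory.Kernel.measurable_kernel_prodMk_left hD)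

theorem measurable_restrict_prodMk_preimage {κ : Ω → Measure ℝ} (hκ : Measurable κ)
    [∀ ω, IsFiniteMeasure (κ ω)] {D : Set (Ω × ℝ)} (hD : MeasurableSet D) :
    Measurable fun ω => (κ ω).restrict (Prod.mk ω ⁻¹' D) := by
  refine Measure.measurable_of_measurable_coe _ fun s hs => ?_
  have h : ∀ ω, (κ ω).restrict (Prod.mk ω ⁻¹' D) s =
      κ ω (Prod.mk ω ⁻¹' ((Prod.snd ⁻¹' s) ∩ D)) := fun ω => by
    rw [Measure.restrict_apply hs]; rfl
  simp only [h]
  exact measurable_apply_prodMk_preimage hκ ((measurable_snd hs).inter hD)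

/-- The mass of {t} is that of a section of the diagonal, with (ω, t) as the parameter of the
family. Joint measurability allows the random set of atoms to be cut out. -/
theorem measurableSet_prod_atoms {κ : Ω → Measure ℝ} (hκ : Measurable κ)
    [∀ ω, IsFiniteMeasure (κ ω)] : MeasurableSet {p : Ω × ℝ | κ p.1 {p.2} = 0} := by
  have h := measurable_apply_prodMk_preimage (κ := fun p : Ω × ℝ => κ p.1)
    (hκ.comp measurable_fst) (D := {q : (Ω × ℝ) × ℝ | q.2 = q.1.2})
    (measurableSet_eq_fun measurable_snd measurable_fst.snd)
  exact h (measurableSet_singleton 0)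

theorem Measurable.acPart {κ : Ω → Measure ℝ} (hκ : Measurable κ)
    [∀ ω, IsFiniteMeasure (κ ω)] : Measurable fun ω => acPart (κ ω) := by
  refine Measure.measurable_of_measurable_coe _ fun s hs => ?_
  have h : ∀ ω, _root_.acPart (κ ω) s = κ ω s - (κ ω).singularPart volume s := by
    intro ω
    have h1 := congrArg (fun μ : Measure ℝ => μ s)
      (Measure.haveLebesgueDecomposition_add (κ ω) volume)
    simp only [Measure.add_apply] at h1
    rw [_root_.acPart]
    rw [h1]
    rw [ENNReal.add_sub_cancel_left (measure_ne_top _ _)]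
  simp only [h]
  exact ((Measure.measurable_coe hs).comp hκ).sub
    ((Measure.measurable_coe hs).comp (measurable_singularPart_volume hκ))

theorem Measurable.scPart {κ : Ω → Measure ℝ} (hκ : Measurable κ)
    [∀ ω, IsFiniteMeasure (κ ω)] : Measurable fun ω => scPart (κ ω) :=
  measurable_restrict_prodMk_preimage (measurable_singularPart_volume hκ)
    (measurableSet_prod_atoms hκ)

theorem Measurable.ppPart {κ : Ω → Measure ℝ} (hκ : Measurable κ)
    [∀ ω, IsFiniteMeasure (κ ω)] : Measurable fun ω => ppPart (κ ω) :=
  measurable_restrict_prodMk_preimage hκ (measurableSet_prod_atoms hκ).compl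

/-- A family of measures carried by a common bounded set is measurable as soon as its moments
are. -/
theorem measurable_of_measurable_moments {κ : Ω → Measure ℝ} [∀ ω, IsFiniteMeasure (κ ω)] {R : ℝ}
    (hR : ∀ ω, ∀ᵐ x ∂κ ω, x ∈ Metric.closedBall (0 : ℝ) R)
    (h : ∀ k : ℕ, Measurable fun ω => ∫ x, x ^ k ∂κ ω) : Measurable κ := by
  have hint : ∀ ω, ∀ {φ : ℝ → ℝ}, Continuous φ → Integrable φ (κ ω) := by
    intro ω φ hφ
    obtain ⟨C, hC⟩ := (isCompact_closedBall (0 : ℝ) R).exists_bound_of_continuousOn hφ.continuousOn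
    exact Integrable.of_bound hφ.aestronglyMeasurable C ((hR ω).mono hC)
  have hpoly : ∀ p : Polynomial ℝ, Measurable fun ω => ∫ x, p.eval x ∂κ ω := by
    intro p
    simp only [Polynomial.eval_eq_sum_range]
    have : ∀ ω, ∫ x, ∑ i ∈ Finset.range (p.natDegree + 1), p.coeff i * x ^ i ∂κ ω =
        ∑ i ∈ Finset.range (p.natDegree + 1), p.coeff i * ∫ x, x ^ i ∂κ ω := fun ω => by
      rw [integral_finsetSum _ fun i _ => (hint ω (continuous_pow i)).const_mul _]
      simp only [integral_const_mul]
    simp only [this]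
    exact Finset.measurable_sum _ fun i _ => (h i).const_mul _
  have hcont : ∀ φ : ℝ → ℝ, Continuous φ → Measurable fun ω => ∫ x, φ x ∂κ ω := by
    intro φ hφ
    have happ : ∀ n : ℕ, ∃ p : Polynomial ℝ, ∀ x ∈ Set.Icc (-R) R,
        |p.eval x - φ x| < 1 / ((n : ℝ) + 1) := fun n =>
      exists_polynomial_near_of_continuousOn (-R) R φ hφ.continuousOn _ (by positivity)
    choose p hp using happ
    refine measurable_of_tendsto_metrizable (fun n => hpoly (p n)) (tendsto_pi_nhds.2 fun ω => ?_)
    rw [tendsto_iff_norm_sub_tendsto_zero]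
    refine squeeze_zero (fun n => norm_nonneg _) (fun n => ?_)
      (g := fun n : ℕ => 1 / ((n : ℝ) + 1) * (κ ω).real Set.univ) ?_
    · rw [← integral_sub (hint ω (p n).continuous) (hint ω hφ)]
      refine norm_integral_le_of_norm_le_const ((hR ω).mono fun x hx => ?_)
      rw [Real.closedBall_eq_Icc, zero_sub, zero_add] at hx
      exact (hp n x hx).le
    · simpa using (tendsto_one_div_add_atTop_nhds_zero_nat (𝕜 := ℝ)).mul_const
        ((κ ω).real Set.univ)
  -- Closed sets form a generating π-system, and the mass of a closed set is a limit of integrals of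
  -- continuous functions.
  refine Measurable.measure_of_isPiSystem (S := {s | IsClosed s})
    (by rw [BorelSpace.measurable_eq (α := ℝ), borel_eq_generateFrom_isClosed])
    isPiSystem_isClosed (fun F hF => ?_) ?_
  · refine measurable_of_tendsto_metrizable
      (f := fun n ω => ∫⁻ x, hF.apprSeq n x ∂κ ω) (fun n => ?_)
      (tendsto_pi_nhds.2 fun ω => HasOuterApproxClosed.tendsto_lintegral_apprSeq hF (κ ω))
    have hc : Continuous fun x => (hF.apprSeq n x : ℝ) :=
      NNReal.continuous_coe.comp (hF.apprSeq n).continuous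
    have : ∀ ω, ∫⁻ x, hF.apprSeq n x ∂κ ω =
        ENNReal.ofReal (∫ x, (hF.apprSeq n x : ℝ) ∂κ ω) := by
      intro ω
      rw [ofReal_integral_eq_lintegral_ofReal (hint ω hc)
        (Eventually.of_forall fun x => NNReal.coe_nonneg _)]
      simp
    simp only [this]
    exact (hcont _ hc).ennreal_ofReal
  · have : ∀ ω, κ ω Set.univ = ENNReal.ofReal (∫ x, x ^ 0 ∂κ ω) := by
      intro ω
      simp [Measure.real]
    simp only [this]
    exact (h 0).ennreal_ofReal

end MeasurableParts

/-! ### Changing finitely many letters of a random sequence. -/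

section BlowUpLaw

open ProbabilityTheory

variable {N : ℕ}

/-- The sequence `ω` with its first letters replaced by those of the word `w`. -/
def prepend {n : ℕ} (w : Fin n → Fin N) (ω : ℕ → Fin N) : ℕ → Fin N :=
  fun k => if h : k < n then w ⟨k, h⟩ else ω k

theorem prepend_of_lt {n : ℕ} (w : Fin n → Fin N) (ω : ℕ → Fin N) {k : ℕ} (h : k < n) :
    prepend w ω k = w ⟨k, h⟩ := dif_pos h

theorem prepend_of_le {n : ℕ} (w : Fin n → Fin N) (ω : ℕ → Fin N) {k : ℕ} (h : n ≤ k) :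
    prepend w ω k = ω k := dif_neg (not_lt.2 h)

theorem prepend_eq_of_agree {n : ℕ} {ω ω' : ℕ → Fin N} (h : ∀ k, n ≤ k → ω k = ω' k) :
    prepend (fun k : Fin n => ω' k) ω = ω' := by
  funext k
  by_cases hk : k < n
  · rw [prepend_of_lt _ _ hk]
  · rw [prepend_of_le _ _ (not_lt.1 hk), h k (not_lt.1 hk)]

/-- The new sequence depends only on the letters from `n` on. This gives independence from the first
`n` letters, and the tail measurability of sets invariant under such changes. -/
theorem measurable_prepend_iSup {n : ℕ} (w : Fin n → Fin N) :
    Measurable[⨆ k ∈ {k : ℕ | n ≤ k}, MeasurableSpace.comap (fun ω : ℕ → Fin N => ω k) ⊤]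
      (prepend w) := by
  refine @measurable_pi_iff _ _ _ (_) _ _ |>.2 fun k => ?_
  by_cases hk : k < n
  · simp only [prepend_of_lt _ _ hk]
    exact @measurable_const _ _ _ (_) _
  · simp only [prepend_of_le _ _ (not_lt.1 hk)]
    refine Measurable.mono (comap_measurable (fun ω : ℕ → Fin N => ω k)) ?_ le_top
    exact le_iSup₂ (f := fun (k : ℕ) (_ : k ∈ {k : ℕ | n ≤ k}) =>
      MeasurableSpace.comap (fun ω : ℕ → Fin N => ω k) ⊤) k (not_lt.1 hk)

theorem comap_eval_le (k : ℕ) :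
    MeasurableSpace.comap (fun ω : ℕ → Fin N => ω k) ⊤ ≤ MeasurableSpace.pi :=
  (measurable_pi_apply k).comap_le

theorem measurable_prepend {n : ℕ} (w : Fin n → Fin N) : Measurable (prepend w) :=
  (measurable_prepend_iSup w).mono (iSup₂_le fun k _ => comap_eval_le k) le_rfl

variable [NeZero N]

instance : IsProbabilityMeasure (uniformOn (Set.univ : Set (Fin N))) :=
  isProbabilityMeasure_uniformOn Set.finite_univ Set.univ_nonempty

instance : IsProbabilityMeasure (SelfSimilarLattice.blowUpLaw N) := by
  unfold SelfSimilarLattice.blowUpLaw; infer_instance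

theorem iIndep_comap_eval :
    iIndep (fun k => MeasurableSpace.comap (fun ω : ℕ → Fin N => ω k) ⊤)
      (SelfSimilarLattice.blowUpLaw N) := by
  have h := iIndepFun_infinitePi (P := fun _ : ℕ => uniformOn (Set.univ : Set (Fin N)))
    (X := fun _ x => x) (fun _ => measurable_id)
  exact (iIndepFun_iff_iIndep _ _ _).1 h

theorem blowUpLaw_cylinder (s : Finset ℕ) (v : ℕ → Fin N) :
    SelfSimilarLattice.blowUpLaw N {ω | ∀ k ∈ s, ω k = v k} = ((N : ℝ≥0∞)⁻¹) ^ s.card := by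
  have h := Measure.infinitePi_pi (μ := fun _ : ℕ => uniformOn (Set.univ : Set (Fin N)))
    (s := s) (t := fun k => {v k}) (fun k _ => measurableSet_singleton _)
  have hset : {ω : ℕ → Fin N | ∀ k ∈ s, ω k = v k} = Set.pi s fun k => {v k} := by
    ext; simp [Set.mem_pi]
  rw [SelfSimilarLattice.blowUpLaw, hset, h]
  simp [uniformOn_univ, Finset.prod_const]

/-- The cylinder of w has positive probability and is independent of the preimage, while on the
cylinder the change of letters is the identity. So the product of the two probabilities is at most
that of A, which is 0. -/
theorem blowUpLaw_prepend_preimage_eq_zero {n : ℕ} (w : Fin n → Fin N) {A : Set (ℕ → Fin N)}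
    (hA : SelfSimilarLattice.blowUpLaw N A = 0) :
    SelfSimilarLattice.blowUpLaw N (prepend w ⁻¹' A) = 0 := by
  set P := SelfSimilarLattice.blowUpLaw N
  obtain ⟨A', hAA', hA'm, hA'⟩ := exists_measurable_superset_of_null hA
  refine measure_mono_null (Set.preimage_mono hAA') ?_
  -- The sequence v is mere filler beyond the letters of w, needed to write the cylinder with a full
  -- sequence.
  obtain ⟨v⟩ : Nonempty (ℕ → Fin N) := inferInstance
  set C : Set (ℕ → Fin N) := {ω | ∀ k ∈ Finset.range n, ω k = prepend w v k}
  have hC : MeasurableSet[⨆ k ∈ {k : ℕ | k < n},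
      MeasurableSpace.comap (fun ω : ℕ → Fin N => ω k) ⊤] C := by
    have : C = ⋂ k ∈ Finset.range n, (fun ω : ℕ → Fin N => ω k) ⁻¹' {prepend w v k} := by
      ext; simp [C]
    rw [this]
    refine Finset.measurableSet_biInter _ fun k hk => ?_
    exact (le_iSup₂ (f := fun (k : ℕ) (_ : k ∈ {k : ℕ | k < n}) =>
      MeasurableSpace.comap (fun ω : ℕ → Fin N => ω k) ⊤) k (Finset.mem_range.1 hk)) _
      ⟨_, MeasurableSpace.measurableSet_top, rfl⟩
  have hind := indep_iSup_of_disjoint (fun k => comap_eval_le k) (iIndep_comap_eval (N := N))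
    (S := {k : ℕ | k < n}) (T := {k : ℕ | n ≤ k})
    (Set.disjoint_left.2 fun k (h1 : k < n) (h2 : n ≤ k) => not_lt.2 h2 h1)
  have hmul := (Indep_iff _ _ _).1 hind C (prepend w ⁻¹' A') hC (measurable_prepend_iSup w hA'm)
  have hsub : C ∩ prepend w ⁻¹' A' ⊆ A' := by
    rintro ω ⟨h1, h2⟩
    have : prepend w ω = ω := by
      funext k
      by_cases hk : k < n
      · rw [h1 k (Finset.mem_range.2 hk), prepend_of_lt _ _ hk, prepend_of_lt _ _ hk]
      · rw [prepend_of_le _ _ (not_lt.1 hk)]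
    rwa [Set.mem_preimage, this] at h2
  rw [measure_mono_null hsub hA', blowUpLaw_cylinder] at hmul
  refine (mul_eq_zero.1 hmul.symm).resolve_left (pow_ne_zero _ ?_)
  exact ENNReal.inv_ne_zero.2 (ENNReal.natCast_ne_top N)

/-- Zero-one law for the events which do not depend on finitely many letters. -/
theorem blowUpLaw_eq_zero_or_one {E : Set (ℕ → Fin N)} (hE : MeasurableSet E)
    (h : ∀ (n : ℕ) (w : Fin n → Fin N) ω, prepend w ω ∈ E ↔ ω ∈ E) :
    SelfSimilarLattice.blowUpLaw N E = 0 ∨ SelfSimilarLattice.blowUpLaw N E = 1 := by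
  refine measure_zero_or_one_of_measurableSet_limsup_atTop (fun k => comap_eval_le k)
    (iIndep_comap_eval (N := N)) ?_
  rw [limsup_eq_iInf_iSup_of_nat]
  refine (MeasurableSpace.measurableSet_iInf).2 fun n => ?_
  obtain ⟨w⟩ : Nonempty (Fin n → Fin N) := inferInstance
  have : E = prepend w ⁻¹' E := by ext ω; exact (h n w ω).symm
  rw [this]
  exact measurable_prepend_iSup w hE

/-- The union over all words of the preimages of D is a tail event, and it contains D through the
empty word. Its probability is positive, hence 1. -/
theorem ae_exists_prepend_mem {D : Set (ℕ → Fin N)} (hD : MeasurableSet D)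
    (hpos : SelfSimilarLattice.blowUpLaw N D ≠ 0) :
    ∀ᵐ ω ∂SelfSimilarLattice.blowUpLaw N, ∃ (n : ℕ) (w : Fin n → Fin N), prepend w ω ∈ D := by
  set E : Set (ℕ → Fin N) := ⋃ n, ⋃ w : Fin n → Fin N, prepend w ⁻¹' D with hEdef
  have hmem : ∀ ω, ω ∈ E ↔ ∃ (n : ℕ) (w : Fin n → Fin N), prepend w ω ∈ D := by
    intro ω; simp [hEdef]
  have hE : MeasurableSet E := MeasurableSet.iUnion fun n => MeasurableSet.iUnion fun w =>
    measurable_prepend w hD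
  -- A change of the first `n` letters of ω that reaches D is reproduced from ω' by rewriting its
  -- first `max n m` letters.
  have key : ∀ ω ω' (m : ℕ), (∀ k, m ≤ k → ω k = ω' k) → ω ∈ E → ω' ∈ E := by
    intro ω ω' m hm h
    obtain ⟨n, w, hw⟩ := (hmem ω).1 h
    refine (hmem ω').2 ⟨max n m, fun k => prepend w ω k, ?_⟩
    rwa [prepend_eq_of_agree]
    intro k hk
    rw [prepend_of_le _ _ ((le_max_left _ _).trans hk), hm k ((le_max_right _ _).trans hk)]
  have h01 := blowUpLaw_eq_zero_or_one hE fun n w ω =>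
    ⟨key _ _ n fun k hk => prepend_of_le w ω hk, key _ _ n fun k hk => (prepend_of_le w ω hk).symm⟩
  have hDE : D ⊆ E := fun ω hω => (hmem ω).2 ⟨0, Fin.elim0, by
    have : prepend (Fin.elim0 : Fin 0 → Fin N) ω = ω := funext fun k => prepend_of_le _ _ zero_le
    rwa [this]⟩
  have h1 : SelfSimilarLattice.blowUpLaw N E = 1 := h01.resolve_left fun h0 =>
    hpos (measure_mono_null hDE h0)
  filter_upwards [(prob_compl_eq_zero_iff hE).2 h1 |> compl_mem_ae_iff.2] with ω hω
  rw [compl_compl] at hω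
  exact (hmem ω).1 hω

/-- Every word occurs infinitely often in almost every sequence. -/
theorem ae_word_occurs (ℓ : ℕ) (v : ℕ → Fin N) :
    ∀ᵐ ω ∂SelfSimilarLattice.blowUpLaw N, ∀ n, ∃ m ≥ n, ∀ k < ℓ, ω (m + k) = v k := by
  set P := SelfSimilarLattice.blowUpLaw N
  set B : ℕ → Set (ℕ → Fin N) := fun m => {ω | ∀ k < ℓ, ω (m + k) = v k} with hB
  have hBm : ∀ m, MeasurableSet (B m) := by
    intro m
    have : B m = ⋂ k ∈ Finset.range ℓ, (fun ω : ℕ → Fin N => ω (m + k)) ⁻¹' {v k} := by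
      ext; simp [B]
    rw [this]
    exact Finset.measurableSet_biInter _ fun k _ =>
      measurable_pi_apply (m + k) (measurableSet_singleton _)
  have hPB : ∀ m, P (B m) = ((N : ℝ≥0∞)⁻¹) ^ ℓ := by
    intro m
    have : B m = {ω | ∀ k ∈ (Finset.range ℓ).map (addLeftEmbedding m), ω k = v (k - m)} := by
      ext; simp [B]
    rw [this, blowUpLaw_cylinder]
    simp
  set E : Set (ℕ → Fin N) := ⋂ n, ⋃ m ≥ n, B m with hE
  have hU : ∀ n, MeasurableSet (⋃ m ≥ n, B m) := fun n =>
    MeasurableSet.iUnion fun m => MeasurableSet.iUnion fun _ => hBm m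
  have hEm : MeasurableSet E := MeasurableSet.iInter hU
  have hmem : ∀ ω, ω ∈ E ↔ ∀ n, ∃ m ≥ n, ∀ k < ℓ, ω (m + k) = v k := by
    intro ω; simp [hE, hB]
  have key : ∀ ω ω' (j : ℕ), (∀ k, j ≤ k → ω k = ω' k) → ω ∈ E → ω' ∈ E := by
    intro ω ω' j hj h
    rw [hmem] at h ⊢
    intro n
    obtain ⟨m, hm, hk⟩ := h (max n j)
    exact ⟨m, (le_max_left _ _).trans hm, fun k hkl => by
      rw [← hj _ (((le_max_right _ _).trans hm).trans (Nat.le_add_right _ _)), hk k hkl]⟩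
  have h01 := blowUpLaw_eq_zero_or_one hEm fun n w ω =>
    ⟨key _ _ n fun k hk => prepend_of_le w ω hk, key _ _ n fun k hk => (prepend_of_le w ω hk).symm⟩
  -- The occurrences at all positions m have the same probability, so their upper limit has at least
  -- this probability; no independence between positions is needed, as the zero-one law concludes.
  have hge : ((N : ℝ≥0∞)⁻¹) ^ ℓ ≤ P E := by
    have hanti : Antitone fun n => ⋃ m ≥ n, B m := fun n n' h =>
      Set.biUnion_mono (fun m (hm : n' ≤ m) => h.trans hm) fun _ _ => subset_rfl
    rw [hE, hanti.measure_iInter (fun n => (hU n).nullMeasurableSet) ⟨0, measure_ne_top _ _⟩]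
    refine le_iInf fun n => ?_
    rw [← hPB n]
    exact measure_mono (Set.subset_biUnion_of_mem (u := B) (le_refl n : n ≥ n))
  have h1 : P E = 1 := h01.resolve_left fun h0 => by
    rw [h0] at hge
    exact pow_ne_zero ℓ (ENNReal.inv_ne_zero.2 (ENNReal.natCast_ne_top N)) (le_antisymm hge zero_le)
  filter_upwards [(prob_compl_eq_zero_iff hEm).2 h1 |> compl_mem_ae_iff.2] with ω hω
  rw [compl_compl] at hω
  exact (hmem ω).1 hω

end BlowUpLaw

namespace SelfSimilarLattice

variable {d N : ℕ} (S : SelfSimilarLattice d N)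

/-! ### The letters and the boundary set -/

theorem exists_ne_letter {d N : ℕ} (S : SelfSimilarLattice d N) (i : Fin N) : ∃ j, j ≠ i := by
  by_contra! h
  have h1 := S.β_sum
  rw [Finset.sum_eq_single i (fun j _ hj => absurd (h j) hj) (by simp)] at h1
  exact (S.β_mem i).2.ne h1

theorem neZero {d N : ℕ} (S : SelfSimilarLattice d N) : NeZero N := by
  refine ⟨?_⟩
  rintro rfl
  simpa using S.β_sum

theorem dist_Ψ (i : Fin N) (x y : EuclideanSpace ℝ (Fin d)) :
    dist (S.Ψ i x) (S.Ψ i y) = Dilation.ratio (S.Ψ i) * dist x y :=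
  Dilation.dist_eq _ _ _

theorem dist_iterate_Ψ (i : Fin N) (n : ℕ) (x y : EuclideanSpace ℝ (Fin d)) :
    dist ((S.Ψ i)^[n] x) ((S.Ψ i)^[n] y) = (Dilation.ratio (S.Ψ i) : ℝ) ^ n * dist x y := by
  induction n with
  | zero => simp
  | succ n ih => rw [Function.iterate_succ_apply', Function.iterate_succ_apply', dist_Ψ, ih]; ring

theorem Ψ_mem_X {x : EuclideanSpace ℝ (Fin d)} (hx : x ∈ S.X) (i : Fin N) : S.Ψ i x ∈ S.X := by
  rw [S.self_similar]
  exact Set.mem_iUnion.2 ⟨i, x, hx, rfl⟩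

/-- A fixed point of a contraction is the limit of the iterates of any point; starting in X they
stay in X, which is closed. -/
theorem F_subset_X {p : EuclideanSpace ℝ (Fin d)} (hp : p ∈ S.F) : p ∈ S.X := by
  obtain ⟨i, hi⟩ := S.F_fixed p hp
  obtain ⟨x, hx⟩ := S.isConnected_X.nonempty
  have hmem : ∀ n, (S.Ψ i)^[n] x ∈ S.X := by
    intro n
    induction n with
    | zero => exact hx
    | succ n ih => rw [Function.iterate_succ_apply']; exact S.Ψ_mem_X ih i
  have hp' : ∀ n, (S.Ψ i)^[n] p = p := fun n => Function.iterate_fixed hi n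
  refine S.isCompact_X.isClosed.mem_of_tendsto (b := atTop) ?_ (Eventually.of_forall hmem)
  rw [tendsto_iff_dist_tendsto_zero]
  have h : ∀ n, dist ((S.Ψ i)^[n] x) p = (Dilation.ratio (S.Ψ i) : ℝ) ^ n * dist x p := by
    intro n
    conv_lhs => rw [← hp' n]
    exact S.dist_iterate_Ψ i n x p
  simp only [h]
  have hr : (Dilation.ratio (S.Ψ i) : ℝ) < 1 := by exact_mod_cast S.ratio_lt_one i
  simpa using (tendsto_pow_atTop_nhds_zero_of_lt_one (by positivity) hr).mul_const (dist x p)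

theorem mem_F_of_Ψ_mem {i j : Fin N} (hij : i ≠ j) {x y : EuclideanSpace ℝ (Fin d)}
    (hx : x ∈ S.X) (hy : y ∈ S.X) (h : S.Ψ i x = S.Ψ j y) : x ∈ S.F := by
  have h1 : S.Ψ i x ∈ S.Ψ i '' S.X ∩ S.Ψ j '' S.X := ⟨⟨x, hx, rfl⟩, ⟨y, hy, h.symm⟩⟩
  rw [S.ramified i j hij] at h1
  obtain ⟨z, hz, hzx⟩ := h1.1
  rwa [← (S.Ψ i).injective hzx]

/-- The point Ψᵢ x is fixed by some Ψₖ. If k = i, then x is that fixed point; otherwise Ψᵢ x also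
lies in the image of X under Ψₖ, and the ramification condition applies. -/
theorem mem_F_of_Ψ_mem_F {i : Fin N} {x : EuclideanSpace ℝ (Fin d)} (hx : x ∈ S.X)
    (h : S.Ψ i x ∈ S.F) : x ∈ S.F := by
  obtain ⟨k, hk⟩ := S.F_fixed _ h
  by_cases hki : i = k
  · subst hki
    rwa [← (S.Ψ i).injective hk]
  · exact S.mem_F_of_Ψ_mem hki hx (S.F_subset_X h) hk.symm

/-- One more iterate than F has points forces a repetition, so p is periodic by injectivity; a
strict contraction has no periodic points other than fixed ones. -/
theorem Ψ_eq_self_of_iterate_mem_F {i : Fin N} {p : EuclideanSpace ℝ (Fin d)}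
    (h : ∀ k ≤ S.F.card, (S.Ψ i)^[k] p ∈ S.F) : S.Ψ i p = p := by
  have hcard : S.F.card < (Finset.range (S.F.card + 1)).card := by simp
  obtain ⟨k, hk, l, hl, hne, heq⟩ := Finset.exists_ne_map_eq_of_card_lt_of_maps_to hcard
    (f := fun k => (S.Ψ i)^[k] p)
    (fun k hk => h k (Nat.lt_succ_iff.1 (Finset.mem_range.1 hk)))
  wlog hlt : k < l generalizing k l
  · exact this l hl k hk hne.symm heq.symm (lt_of_le_of_ne (not_lt.1 hlt) hne.symm)
  obtain ⟨r, rfl⟩ := Nat.exists_eq_add_of_lt hlt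
  have hp : p = (S.Ψ i)^[r + 1] p := by
    have h1 : (S.Ψ i)^[k] p = (S.Ψ i)^[k] ((S.Ψ i)^[r + 1] p) := by
      rw [← Function.iterate_add_apply]
      exact heq
    exact (S.Ψ i).injective.iterate k h1
  have hd : dist p (S.Ψ i p) = (Dilation.ratio (S.Ψ i) : ℝ) ^ (r + 1) * dist p (S.Ψ i p) := by
    rw [← S.dist_iterate_Ψ i (r + 1) p (S.Ψ i p), ← hp]
    congr 1
    conv_lhs => rw [hp]
    rw [← Function.iterate_succ_apply' (S.Ψ i), Function.iterate_succ_apply]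
  have hr : (Dilation.ratio (S.Ψ i) : ℝ) ^ (r + 1) < 1 := by
    have : (Dilation.ratio (S.Ψ i) : ℝ) < 1 := by exact_mod_cast S.ratio_lt_one i
    exact pow_lt_one₀ (by positivity) this (Nat.succ_ne_zero r)
  have h0 : dist p (S.Ψ i p) = 0 := by nlinarith [dist_nonneg (x := p) (y := S.Ψ i p)]
  exact (dist_eq_zero.1 h0).symm

/-! ### Cells -/

theorem blowUp_succ (ω : ℕ → Fin N) (n : ℕ) :
    S.blowUp ω (n + 1) = S.blowUp ω n * (S.Ψ (ω n))⁻¹ := by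
  unfold blowUp
  rw [List.ofFn_succ']
  simp [List.concat_eq_append]

theorem wordMap_mem_X {n : ℕ} (j : Fin n → Fin N) {x : EuclideanSpace ℝ (Fin d)} (hx : x ∈ S.X) :
    (List.ofFn fun k : Fin n => S.Ψ (j k)).prod x ∈ S.X := by
  induction n with
  | zero => simpa
  | succ n ih =>
    rw [List.ofFn_succ, List.prod_cons]
    exact S.Ψ_mem_X (ih fun k => j k.succ) (j 0)

theorem exists_X_of_mem_pts {ω : ℕ → Fin N} {n : ℕ} {x : EuclideanSpace ℝ (Fin d)}
    (hx : x ∈ S.pts ω n) : ∃ y ∈ S.X, S.blowUp ω n y = x := by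
  classical
  unfold pts at hx
  obtain ⟨⟨j, z⟩, -, rfl⟩ := Finset.mem_image.1 hx
  exact ⟨_, S.wordMap_mem_X j (S.F_subset_X z.2), rfl⟩

theorem mem_pts_iff {ω : ℕ → Fin N} {n : ℕ} {x : EuclideanSpace ℝ (Fin d)} :
    x ∈ S.pts ω n ↔ ∃ (j : Fin n → Fin N) (z : S.F), S.cell ω j z = x := by
  classical
  unfold pts
  simp

theorem pts_mono (ω : ℕ → Fin N) : Monotone (S.pts ω) := by
  refine monotone_nat_of_le_succ fun n x hx => ?_
  obtain ⟨j, z, rfl⟩ := S.mem_pts_iff.1 hx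
  rw [← cell_cons]
  exact S.cell_mem_pts ω _ z

theorem bdry_subset_pts (ω : ℕ → Fin N) (n : ℕ) : S.bdry ω n ⊆ S.pts ω n := by
  rintro _ ⟨p, hp, rfl⟩
  obtain ⟨k, hk⟩ := S.F_fixed p hp
  refine S.mem_pts_iff.2 ⟨fun _ => k, ⟨p, hp⟩, ?_⟩
  have : ∀ m, (List.ofFn fun _ : Fin m => S.Ψ k).prod p = p := by
    intro m
    induction m with
    | zero => simp
    | succ m ih =>
      rw [List.ofFn_succ, List.prod_cons]
      change S.Ψ k ((List.ofFn fun _ : Fin m => S.Ψ k).prod p) = p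
      rw [ih, hk]
  exact congrArg (S.blowUp ω n) (this n)

/-- A point of `F_{<n>}` in a `0`-cell of `F_{<n+1>}` outside of `F_{<n>}` is a boundary point. -/
theorem mem_bdry_of_cell_cons {ω : ℕ → Fin N} {n : ℕ} {i : Fin N} (hi : i ≠ ω n)
    (w : Fin n → Fin N) (z : S.F)
    (hx : S.cell ω (Fin.cons i w : Fin (n + 1) → Fin N) z ∈ S.pts ω n) :
    S.cell ω (Fin.cons i w : Fin (n + 1) → Fin N) z ∈ S.bdry ω n := by
  obtain ⟨y, hy, h⟩ := S.exists_X_of_mem_pts hx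
  rw [← h]
  refine ⟨y, ?_, rfl⟩
  unfold cell at h
  rw [blowUp_succ, List.ofFn_succ, List.prod_cons] at h
  simp only [Fin.cons_zero, Fin.cons_succ] at h
  have h1 : y = (S.Ψ (ω n)).symm (S.Ψ i ((List.ofFn fun k : Fin n => S.Ψ (w k)).prod z)) :=
    (S.blowUp ω n).injective h
  have h2 := congrArg (S.Ψ (ω n)) h1
  rw [DilationEquiv.apply_symm_apply] at h2
  exact S.mem_F_of_Ψ_mem hi.symm hy (S.wordMap_mem_X w (S.F_subset_X z.2)) h2

/-- In the coordinates of level `n` the point is some y in X whose image under the letter lies in F,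
hence y is in F. Consequently a point once off the boundary stays off it. -/
theorem mem_bdry_of_mem_bdry_succ {ω : ℕ → Fin N} {n : ℕ} {x : EuclideanSpace ℝ (Fin d)}
    (hx : x ∈ S.pts ω n) (hb : x ∈ S.bdry ω (n + 1)) : x ∈ S.bdry ω n := by
  obtain ⟨y, hy, rfl⟩ := S.exists_X_of_mem_pts hx
  obtain ⟨p, hp, h⟩ := hb
  refine ⟨y, ?_, rfl⟩
  rw [blowUp_succ] at h
  have h1 : (S.Ψ (ω n)).symm p = y := (S.blowUp ω n).injective h
  rw [DilationEquiv.symm_apply_eq] at h1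
  exact S.mem_F_of_Ψ_mem_F hy (h1 ▸ hp)

/-- The points of `F_{<n>}` off the boundary. -/
def intPts (ω : ℕ → Fin N) (n : ℕ) : Set (EuclideanSpace ℝ (Fin d)) :=
  (S.pts ω n : Set (EuclideanSpace ℝ (Fin d))) \ S.bdry ω n

theorem intPts_mono (ω : ℕ → Fin N) : Monotone (S.intPts ω) :=
  monotone_nat_of_le_succ fun n _ hx =>
    ⟨S.pts_mono ω n.le_succ hx.1, fun h => hx.2 (S.mem_bdry_of_mem_bdry_succ hx.1 h)⟩

theorem intPts_subset_ptsInf (ω : ℕ → Fin N) (n : ℕ) : S.intPts ω n ⊆ S.ptsInf ω :=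
  fun _ hx => Set.mem_iUnion.2 ⟨n, hx.1⟩

theorem exists_mem_intPts {ω : ℕ → Fin N} (hω : S.bdryInf ω = ∅) {x : EuclideanSpace ℝ (Fin d)}
    (hx : x ∈ S.ptsInf ω) : ∃ n, x ∈ S.intPts ω n := by
  obtain ⟨n, hn⟩ := Set.mem_iUnion.1 hx
  have hx' : x ∉ S.bdryInf ω := by simp [hω]
  simp only [bdryInf, Set.mem_iInter, Set.mem_iUnion, not_forall, not_exists] at hx'
  obtain ⟨m, hm⟩ := hx'
  exact ⟨max n m, S.pts_mono ω (le_max_left n m) hn, hm _ (le_max_right n m)⟩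

theorem exists_finset_subset_intPts {ω : ℕ → Fin N} (hω : S.bdryInf ω = ∅)
    (s : Finset (EuclideanSpace ℝ (Fin d))) (hs : ∀ x ∈ s, x ∈ S.ptsInf ω) :
    ∃ n, ∀ x ∈ s, x ∈ S.intPts ω n := by
  choose! m hm using fun x (hx : x ∈ s) => S.exists_mem_intPts hω (hs x hx)
  exact ⟨s.sup m, fun x hx => S.intPts_mono ω (Finset.le_sup hx) (hm x hx)⟩

theorem cell_cons_notMem_intPts {ω : ℕ → Fin N} {n k : ℕ} (hnk : n ≤ k) {i : Fin N} (hi : i ≠ ω k)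
    (w : Fin k → Fin N) (z : S.F) :
    S.cell ω (Fin.cons i w : Fin (k + 1) → Fin N) z ∉ S.intPts ω n := fun h =>
  have h' := S.intPts_mono ω hnk h
  h'.2 (S.mem_bdry_of_cell_cons hi w z h'.1)

/-- Cells added after level `n` meet the lattice of level `n` only on its boundary, so a quantity
that sees only cells with a point off this boundary is frozen from level `n` on. Masses, operators
and eigenfunctions stabilize for this reason. -/
theorem cellSum_eq_of_le {M : Type*} [AddCommMonoid M] [Module ℝ M] {ω : ℕ → Fin N} {n m : ℕ}
    (hnm : n ≤ m) (G : (EuclideanSpace ℝ (Fin d) ≃ᵈ EuclideanSpace ℝ (Fin d)) → M)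
    (hG : ∀ c : EuclideanSpace ℝ (Fin d) ≃ᵈ EuclideanSpace ℝ (Fin d),
      (∀ z : S.F, c z ∉ S.intPts ω n) → G c = 0) :
    S.cellSum ω m G = S.cellSum ω n G := by
  induction m, hnm using Nat.le_induction with
  | base => rfl
  | succ m hnm ih =>
    rw [cellSum_succ, ih, Finset.sum_eq_zero, add_zero]
    intro i hi
    refine Finset.sum_eq_zero fun w _ => ?_
    rw [hG _ fun z => S.cell_cons_notMem_intPts hnm (Finset.ne_of_mem_erase hi) w z, smul_zero]

/-- A `0`-cell with a point off the boundary of `F_{<n>}` is a `0`-cell of `F_{<n>}`. -/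
theorem exists_cell_eq {ω : ℕ → Fin N} {n m : ℕ} (hnm : n ≤ m) (j : Fin m → Fin N) (z : S.F)
    (hz : S.cell ω j z ∈ S.intPts ω n) : ∃ j' : Fin n → Fin N, S.cell ω j = S.cell ω j' := by
  induction m, hnm using Nat.le_induction with
  | base => exact ⟨j, rfl⟩
  | succ m hnm ih =>
    rw [← Fin.cons_self_tail j] at hz ⊢
    by_cases h : j 0 = ω m
    · rw [h, cell_cons] at hz ⊢
      exact ih _ hz
    · exact absurd hz (S.cell_cons_notMem_intPts hnm h _ z)

/-! ### The boundary of the infinite lattice is almost surely empty -/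

/-- A point of the limiting boundary lies on the boundary at all large levels, since leaving it is
irreversible. Its coordinates in F are then moved by the successive maps Ψ of the letters of ω.
Almost every ω contains, arbitrarily far, a letter repeated |F| times and then another one repeated
|F| times; by the pigeonhole lemma the same coordinate is fixed by both maps, against the
distinctness of the fixed points. -/
theorem ae_bdryInf_eq_empty : ∀ᵐ ω ∂blowUpLaw N, S.bdryInf ω = ∅ := by
  have := S.neZero
  obtain ⟨i, hi⟩ := S.exists_ne_letter 0
  set L := S.F.card
  filter_upwards [ae_word_occurs (2 * L) (fun k => if k < L then (0 : Fin N) else i)] with ω hω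
  rw [Set.eq_empty_iff_forall_notMem]
  intro x hx
  have hx' : ∀ n, ∃ m ≥ n, x ∈ S.bdry ω m := by
    simpa [bdryInf] using hx
  obtain ⟨n, -, hn⟩ := hx' 0
  have hpts : x ∈ S.pts ω n := S.bdry_subset_pts ω n hn
  have hall : ∀ m, n ≤ m → x ∈ S.bdry ω m := by
    intro m hm
    by_contra hnot
    obtain ⟨m', hm', hb⟩ := hx' m
    exact (S.intPts_mono ω hm' ⟨S.pts_mono ω hm hpts, hnot⟩).2 hb
  obtain ⟨m, hm, hword⟩ := hω n
  have hp : ∀ k, ∃ p ∈ S.F, S.blowUp ω (m + k) p = x := fun k =>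
    hall (m + k) (hm.le.trans (Nat.le_add_right m k))
  choose p hpF hpx using hp
  have hstep : ∀ k, p (k + 1) = S.Ψ (ω (m + k)) (p k) := by
    intro k
    have h1 : S.blowUp ω (m + k + 1) (p (k + 1)) = x := hpx (k + 1)
    rw [blowUp_succ, ← hpx k] at h1
    exact (DilationEquiv.symm_apply_eq _).1 ((S.blowUp ω (m + k)).injective h1)
  have hit0 : ∀ k ≤ L, (S.Ψ 0)^[k] (p 0) = p k := by
    intro k
    induction k with
    | zero => simp
    | succ k ih =>
      intro hk
      rw [Function.iterate_succ_apply', ih (by omega), hstep, hword k (by omega),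
        if_pos (by omega)]
  have hit1 : ∀ k ≤ L, (S.Ψ i)^[k] (p L) = p (L + k) := by
    intro k
    induction k with
    | zero => simp
    | succ k ih =>
      intro hk
      rw [Function.iterate_succ_apply', ih (by omega), ← add_assoc, hstep,
        hword (L + k) (by omega), if_neg (by omega)]
  have h0 : S.Ψ 0 (p 0) = p 0 :=
    S.Ψ_eq_self_of_iterate_mem_F fun k hk => by rw [hit0 k hk]; exact hpF k
  have h1 : S.Ψ i (p L) = p L :=
    S.Ψ_eq_self_of_iterate_mem_F fun k hk => by rw [hit1 k hk]; exact hpF _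
  rw [← hit0 L le_rfl, Function.iterate_fixed h0] at h1
  exact hi (S.fixed_distinct i 0 (p 0) h1 h0)

end SelfSimilarLattice

namespace SelfSimilarLattice

variable {d N : ℕ} (S : SelfSimilarLattice d N)

/-! ### The masses of the points -/

open Classical in
/-- The mass of the point `x` for the measure `b_{<n>}`. -/
noncomputable def ptMass (ω : ℕ → Fin N) (n : ℕ) (x : EuclideanSpace ℝ (Fin d)) : ℝ :=
  S.cellSum ω n fun c => ∑ z : S.F, if c z = x then S.b z else 0

theorem bStage_singleton (ω : ℕ → Fin N) (n : ℕ) (x : EuclideanSpace ℝ (Fin d)) :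
    S.bStage ω n {x} = ENNReal.ofReal (S.ptMass ω n x) := by
  classical
  unfold bStage ptMass cellSum
  simp only [Measure.coe_finsetSum, Finset.sum_apply, Measure.smul_apply, smul_eq_mul,
    Measure.dirac_apply' _ (measurableSet_singleton x)]
  rw [ENNReal.ofReal_sum_of_nonneg]
  · refine Finset.sum_congr rfl fun j _ => ?_
    rw [Finset.mul_sum, ENNReal.ofReal_sum_of_nonneg]
    · refine Finset.sum_congr rfl fun z _ => ?_
      by_cases h : S.cell ω j z = x <;> simp [h]
    · intro z _
      have := (S.massWeight_pos ω j).le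
      have := (S.b_pos z).le
      split_ifs <;> positivity
  · intro j _
    refine mul_nonneg (S.massWeight_pos ω j).le (Finset.sum_nonneg fun z _ => ?_)
    have := (S.b_pos z).le
    split_ifs <;> simp [this]

theorem ptMass_le_succ (ω : ℕ → Fin N) (n : ℕ) (x : EuclideanSpace ℝ (Fin d)) :
    S.ptMass ω n x ≤ S.ptMass ω (n + 1) x := by
  classical
  unfold ptMass
  rw [cellSum_succ]
  refine le_add_of_nonneg_right (Finset.sum_nonneg fun i _ => Finset.sum_nonneg fun w _ =>
    smul_nonneg (S.massWeight_pos ω _).le (Finset.sum_nonneg fun z _ => ?_))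
  have := (S.b_pos z).le
  split_ifs <;> simp [this]

theorem ptMass_mono (ω : ℕ → Fin N) (x : EuclideanSpace ℝ (Fin d)) :
    Monotone fun n => S.ptMass ω n x :=
  monotone_nat_of_le_succ fun n => S.ptMass_le_succ ω n x

theorem ptMass_pos {ω : ℕ → Fin N} {n : ℕ} {x : EuclideanSpace ℝ (Fin d)} (hx : x ∈ S.pts ω n) :
    0 < S.ptMass ω n x := by
  classical
  obtain ⟨j, z, rfl⟩ := S.mem_pts_iff.1 hx
  have hnn : ∀ (c : EuclideanSpace ℝ (Fin d) ≃ᵈ EuclideanSpace ℝ (Fin d)) (y : S.F),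
      0 ≤ if c y = S.cell ω j z then S.b y else 0 := fun c y => by
    have := (S.b_pos y).le
    split_ifs <;> simp [this]
  refine Finset.sum_pos' (fun j' _ => smul_nonneg (S.massWeight_pos ω j').le
    (Finset.sum_nonneg fun y _ => hnn _ y)) ⟨j, Finset.mem_univ _, ?_⟩
  refine mul_pos (S.massWeight_pos ω j) (Finset.sum_pos' (fun y _ => hnn _ y)
    ⟨z, Finset.mem_univ _, ?_⟩)
  simpa using S.b_pos z

theorem ptMass_nonneg (ω : ℕ → Fin N) (n : ℕ) (x : EuclideanSpace ℝ (Fin d)) :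
    0 ≤ S.ptMass ω n x := by
  classical
  refine Finset.sum_nonneg fun j _ => smul_nonneg (S.massWeight_pos ω j).le
    (Finset.sum_nonneg fun z _ => ?_)
  have := (S.b_pos z).le
  split_ifs <;> simp [this]

theorem ptMass_eq_of_le {ω : ℕ → Fin N} {n m : ℕ} (hnm : n ≤ m) {x : EuclideanSpace ℝ (Fin d)}
    (hx : x ∈ S.intPts ω n) : S.ptMass ω m x = S.ptMass ω n x := by
  classical
  refine S.cellSum_eq_of_le hnm _ fun c hc => Finset.sum_eq_zero fun z _ => ?_
  rw [if_neg]
  rintro rfl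
  exact hc z hx

theorem countable_ptsInf (ω : ℕ → Fin N) : (S.ptsInf ω).Countable :=
  Set.countable_iUnion fun _ => (Finset.finite_toSet _).countable

theorem bInf_singleton {ω : ℕ → Fin N} {x : EuclideanSpace ℝ (Fin d)} (hx : x ∈ S.ptsInf ω) :
    S.bInf ω {x} = ⨆ n, S.bStage ω n {x} := by
  unfold bInf
  rw [Measure.sum_apply _ (measurableSet_singleton x), tsum_eq_single ⟨x, hx⟩]
  · simp
  · intro y hy
    have : y.1 ≠ x := fun h => hy (Subtype.ext h)
    simp [this]

theorem bInf_singleton_of_mem_intPts {ω : ℕ → Fin N} {n : ℕ} {x : EuclideanSpace ℝ (Fin d)}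
    (hx : x ∈ S.intPts ω n) : S.bInf ω {x} = ENNReal.ofReal (S.ptMass ω n x) := by
  rw [S.bInf_singleton (S.intPts_subset_ptsInf ω n hx)]
  simp only [bStage_singleton]
  refine le_antisymm (iSup_le fun m => ENNReal.ofReal_le_ofReal ?_)
    (le_iSup (fun m => ENNReal.ofReal (S.ptMass ω m x)) n)
  exact (S.ptMass_mono ω x (le_max_left m n)).trans
    (S.ptMass_eq_of_le (le_max_right m n) hx).le

/-- The mass of the point `x` for the measure `b_{<∞>}`. -/
noncomputable def mass (ω : ℕ → Fin N) (x : EuclideanSpace ℝ (Fin d)) : ℝ := (S.bInf ω {x}).toReal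

theorem mass_eq {ω : ℕ → Fin N} {n : ℕ} {x : EuclideanSpace ℝ (Fin d)} (hx : x ∈ S.intPts ω n) :
    S.mass ω x = S.ptMass ω n x := by
  rw [mass, S.bInf_singleton_of_mem_intPts hx, ENNReal.toReal_ofReal (S.ptMass_nonneg ω n x)]

theorem bInf_singleton_ne_top {ω : ℕ → Fin N} (hω : S.bdryInf ω = ∅)
    {x : EuclideanSpace ℝ (Fin d)} (hx : x ∈ S.ptsInf ω) : S.bInf ω {x} ≠ ⊤ := by
  obtain ⟨n, hn⟩ := S.exists_mem_intPts hω hx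
  rw [S.bInf_singleton_of_mem_intPts hn]
  exact ENNReal.ofReal_ne_top

theorem mass_pos {ω : ℕ → Fin N} (hω : S.bdryInf ω = ∅) {x : EuclideanSpace ℝ (Fin d)}
    (hx : x ∈ S.ptsInf ω) : 0 < S.mass ω x := by
  obtain ⟨n, hn⟩ := S.exists_mem_intPts hω hx
  rw [S.mass_eq hn]
  exact S.ptMass_pos hn.1

/-- Every point of the infinite lattice has positive mass, so functions on it can be handled
pointwise. -/
theorem ae_bInf_iff (ω : ℕ → Fin N) (p : EuclideanSpace ℝ (Fin d) → Prop) :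
    (∀ᵐ x ∂S.bInf ω, p x) ↔ ∀ x ∈ S.ptsInf ω, p x := by
  constructor
  · intro h x hx
    obtain ⟨n, hn⟩ := Set.mem_iUnion.1 hx
    obtain ⟨j, z, rfl⟩ := S.mem_pts_iff.1 hn
    exact S.ae_bInf ω h j z
  · intro h
    have := (S.countable_ptsInf ω).to_subtype
    unfold bInf
    rw [Measure.ae_sum_iff]
    intro x
    refine Measure.ae_smul_measure ?_ _
    rw [ae_dirac_eq]
    exact h x.1 x.2

/-! ### Vectors given by their values -/

/-- With an empty boundary the Dirichlet condition is void; both domains contain every vector, in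
particular the Dirac functions. -/
theorem mem_domain {ω : ℕ → Fin N} (hω : S.bdryInf ω = ∅) (bc : BoundaryCondition)
    (f : Lp ℂ 2 (S.bInf ω)) : f ∈ S.domain ω bc := by
  cases bc
  · exact Submodule.mem_top
  · refine LinearMap.mem_ker.2 (Lp.ext ?_)
    have hae : ae ((S.bInf ω).restrict (S.bdryInf ω)) = ⊥ := by
      rw [hω, Measure.restrict_empty, ae_zero]
    exact Filter.Eventually.filter_mono hae.le Filter.eventually_bot

/-- `f` takes the values of the function `h` on `F_{<∞>}`. -/
def Represents {ω : ℕ → Fin N} {bc : BoundaryCondition} (f : S.domain ω bc)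
    (h : EuclideanSpace ℝ (Fin d) → ℂ) : Prop :=
  ∀ x ∈ S.ptsInf ω, (f : Lp ℂ 2 (S.bInf ω)) x = h x

variable {S}

theorem represents_iff_ae {ω : ℕ → Fin N} {bc : BoundaryCondition} {f : S.domain ω bc}
    {h : EuclideanSpace ℝ (Fin d) → ℂ} :
    S.Represents f h ↔ (f : Lp ℂ 2 (S.bInf ω)) =ᵐ[S.bInf ω] h :=
  (S.ae_bInf_iff ω _).symm

theorem Represents.unique {ω : ℕ → Fin N} {bc : BoundaryCondition} {f g : S.domain ω bc}
    {h : EuclideanSpace ℝ (Fin d) → ℂ} (hf : S.Represents f h) (hg : S.Represents g h) : f = g :=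
  Subtype.ext (Lp.ext ((represents_iff_ae.1 hf).trans (represents_iff_ae.1 hg).symm))

theorem Represents.add {ω : ℕ → Fin N} {bc : BoundaryCondition} {f g : S.domain ω bc}
    {h k : EuclideanSpace ℝ (Fin d) → ℂ} (hf : S.Represents f h) (hg : S.Represents g k) :
    S.Represents (f + g) (h + k) := by
  rw [represents_iff_ae] at *
  exact (Lp.coeFn_add _ _).trans (hf.add hg)

theorem Represents.sub {ω : ℕ → Fin N} {bc : BoundaryCondition} {f g : S.domain ω bc}
    {h k : EuclideanSpace ℝ (Fin d) → ℂ} (hf : S.Represents f h) (hg : S.Represents g k) :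
    S.Represents (f - g) (h - k) := by
  rw [represents_iff_ae] at *
  exact (Lp.coeFn_sub _ _).trans (hf.sub hg)

theorem Represents.smul {ω : ℕ → Fin N} {bc : BoundaryCondition} (c : ℂ) {f : S.domain ω bc}
    {h : EuclideanSpace ℝ (Fin d) → ℂ} (hf : S.Represents f h) :
    S.Represents (c • f) (c • h) := by
  rw [represents_iff_ae] at *
  exact (Lp.coeFn_smul c _).trans (hf.const_smul c)

theorem represents_zero {ω : ℕ → Fin N} {bc : BoundaryCondition} :
    S.Represents (0 : S.domain ω bc) 0 :=
  represents_iff_ae.2 (Lp.coeFn_zero _ _ _)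

theorem Represents.sum {ω : ℕ → Fin N} {bc : BoundaryCondition} {ι : Type*} (s : Finset ι)
    {f : ι → S.domain ω bc} {h : ι → EuclideanSpace ℝ (Fin d) → ℂ}
    (hf : ∀ i ∈ s, S.Represents (f i) (h i)) : S.Represents (∑ i ∈ s, f i) (∑ i ∈ s, h i) := by
  classical
  induction s using Finset.induction_on with
  | empty => simpa using represents_zero
  | insert i s hi ih =>
    rw [Finset.sum_insert hi, Finset.sum_insert hi]
    exact (hf i (Finset.mem_insert_self i s)).add
      (ih fun j hj => hf j (Finset.mem_insert_of_mem hj))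

variable (S)

open Classical in
/-- The Dirac function at `x`, as an element of the domain of the given boundary condition. -/
noncomputable def deltaVec (ω : ℕ → Fin N) (bc : BoundaryCondition)
    (x : EuclideanSpace ℝ (Fin d)) : S.domain ω bc :=
  if h : S.bdryInf ω = ∅ ∧ S.bInf ω {x} ≠ ⊤ then
    ⟨indicatorConstLp 2 (measurableSet_singleton x) h.2 (1 : ℂ), S.mem_domain h.1 bc _⟩ else 0

variable {S}

theorem delta_eq_deltaVec {ω : ℕ → Fin N} (hω : S.bdryInf ω = ∅) (x : EuclideanSpace ℝ (Fin d)) :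
    S.delta ω x = S.deltaVec ω .neumann x := by
  by_cases h : S.bInf ω {x} ≠ ⊤
  · have h1 : S.deltaVec ω .neumann x = ⟨indicatorConstLp 2 (measurableSet_singleton x) h (1 : ℂ),
      S.mem_domain hω .neumann _⟩ := dif_pos ⟨hω, h⟩
    rw [h1]
    exact Subtype.ext (dif_pos h)
  · have h1 : S.deltaVec ω .neumann x = 0 := dif_neg fun h' => h h'.2
    rw [h1]
    exact Subtype.ext (dif_neg h)

open Classical in
theorem represents_deltaVec {ω : ℕ → Fin N} (hω : S.bdryInf ω = ∅) (bc : BoundaryCondition)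
    {x : EuclideanSpace ℝ (Fin d)} (hx : x ∈ S.ptsInf ω) :
    S.Represents (S.deltaVec ω bc x) (Pi.single x 1) := by
  rw [represents_iff_ae, deltaVec, dif_pos ⟨hω, S.bInf_singleton_ne_top hω hx⟩]
  refine (indicatorConstLp_coeFn (hs := measurableSet_singleton x)
    (hμs := S.bInf_singleton_ne_top hω hx) (c := (1 : ℂ))).trans (Eventually.of_forall fun y => ?_)
  by_cases h : y = x
  · subst h; simp
  · simp [h]

theorem inner_deltaVec_left {ω : ℕ → Fin N} (hω : S.bdryInf ω = ∅) (bc : BoundaryCondition)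
    {x : EuclideanSpace ℝ (Fin d)} (hx : x ∈ S.ptsInf ω) (f : S.domain ω bc) :
    inner ℂ (S.deltaVec ω bc x) f = S.mass ω x * (f : Lp ℂ 2 (S.bInf ω)) x := by
  have hne := S.bInf_singleton_ne_top hω hx
  rw [deltaVec, dif_pos ⟨hω, hne⟩]
  refine (L2.inner_indicatorConstLp_one (𝕜 := ℂ) (measurableSet_singleton x) hne
    (f : Lp ℂ 2 (S.bInf ω))).trans ?_
  rw [Measure.restrict_singleton, integral_smul_measure, integral_dirac]
  simp [mass]

theorem inner_deltaVec_right {ω : ℕ → Fin N} (hω : S.bdryInf ω = ∅) (bc : BoundaryCondition)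
    {x : EuclideanSpace ℝ (Fin d)} (hx : x ∈ S.ptsInf ω) (f : S.domain ω bc) :
    inner ℂ f (S.deltaVec ω bc x) =
      S.mass ω x * starRingEnd ℂ ((f : Lp ℂ 2 (S.bInf ω)) x) := by
  rw [← inner_conj_symm, inner_deltaVec_left hω bc hx, map_mul, Complex.conj_ofReal]

theorem represents_sum_deltaVec {ω : ℕ → Fin N} (hω : S.bdryInf ω = ∅) (bc : BoundaryCondition)
    {s : Finset (EuclideanSpace ℝ (Fin d))} (hs : ∀ x ∈ s, x ∈ S.ptsInf ω)
    {h : EuclideanSpace ℝ (Fin d) → ℂ} (hh : ∀ x, h x ≠ 0 → x ∈ s) :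
    S.Represents (∑ x ∈ s, h x • S.deltaVec ω bc x) h := by
  classical
  have hr := Represents.sum s (f := fun x => h x • S.deltaVec ω bc x)
    (h := fun x => h x • (Pi.single x 1 : EuclideanSpace ℝ (Fin d) → ℂ))
    fun x hx => (represents_deltaVec hω bc (hs x hx)).smul (h x)
  have : ∑ x ∈ s, h x • (Pi.single x 1 : EuclideanSpace ℝ (Fin d) → ℂ) = h := by
    funext y
    rw [Finset.sum_apply]
    simp only [Pi.smul_apply, smul_eq_mul, Pi.single_apply, mul_ite, mul_one, mul_zero]
    rw [Finset.sum_ite_eq]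
    split_ifs with hy
    · rfl
    · by_contra hne
      exact hy (hh y (Ne.symm hne))
  rwa [this] at hr

theorem Represents.eq_sum {ω : ℕ → Fin N} (hω : S.bdryInf ω = ∅) {bc : BoundaryCondition}
    {f : S.domain ω bc} {h : EuclideanSpace ℝ (Fin d) → ℂ} (hf : S.Represents f h)
    {s : Finset (EuclideanSpace ℝ (Fin d))} (hs : ∀ x ∈ s, x ∈ S.ptsInf ω)
    (hh : ∀ x, h x ≠ 0 → x ∈ s) : f = ∑ x ∈ s, h x • S.deltaVec ω bc x :=
  hf.unique (represents_sum_deltaVec hω bc hs hh)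

theorem Represents.inner_eq_sum {ω : ℕ → Fin N} (hω : S.bdryInf ω = ∅) {bc : BoundaryCondition}
    {f : S.domain ω bc} {h : EuclideanSpace ℝ (Fin d) → ℂ} (hf : S.Represents f h)
    {s : Finset (EuclideanSpace ℝ (Fin d))} (hs : ∀ x ∈ s, x ∈ S.ptsInf ω)
    (hh : ∀ x, h x ≠ 0 → x ∈ s) (g : S.domain ω bc) :
    inner ℂ g f =
      ∑ x ∈ s, (S.mass ω x : ℂ) * (h x * starRingEnd ℂ ((g : Lp ℂ 2 (S.bInf ω)) x)) := by
  rw [hf.eq_sum hω hs hh, inner_sum]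
  refine Finset.sum_congr rfl fun x hx => ?_
  refine (inner_smul_right (𝕜 := ℂ) g (S.deltaVec ω bc x) (h x)).trans ?_
  rw [inner_deltaVec_right hω bc (hs x hx)]
  ring

theorem Represents.norm_sq_eq_sum {ω : ℕ → Fin N} (hω : S.bdryInf ω = ∅) {bc : BoundaryCondition}
    {f : S.domain ω bc} {h : EuclideanSpace ℝ (Fin d) → ℂ} (hf : S.Represents f h)
    {s : Finset (EuclideanSpace ℝ (Fin d))} (hs : ∀ x ∈ s, x ∈ S.ptsInf ω)
    (hh : ∀ x, h x ≠ 0 → x ∈ s) :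
    ‖f‖ ^ 2 = ∑ x ∈ s, S.mass ω x * ‖h x‖ ^ 2 := by
  have h1 := hf.inner_eq_sum hω hs hh f
  have h2 : ∀ x ∈ s, (S.mass ω x : ℂ) *
      (h x * starRingEnd ℂ ((f : Lp ℂ 2 (S.bInf ω)) x)) = ((S.mass ω x * ‖h x‖ ^ 2 : ℝ) : ℂ) := by
    intro x hx
    rw [hf x (hs x hx), Complex.mul_conj, Complex.normSq_eq_norm_sq]
    push_cast
    rfl
  rw [Finset.sum_congr rfl h2, ← Complex.ofReal_sum] at h1
  have h3 := congrArg Complex.re h1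
  rw [Complex.ofReal_re] at h3
  rw [← h3]
  exact norm_sq_eq_re_inner (𝕜 := ℂ) f

/-- A vector orthogonal to all Dirac functions vanishes at every point, the masses being nonzero. -/
theorem topologicalClosure_span_deltaVec {ω : ℕ → Fin N} (hω : S.bdryInf ω = ∅)
    (bc : BoundaryCondition) :
    (Submodule.span ℂ (Set.range fun x : S.ptsInf ω =>
      S.deltaVec ω bc x)).topologicalClosure = ⊤ := by
  rw [Submodule.topologicalClosure_eq_top_iff, Submodule.eq_bot_iff]
  intro f hf
  rw [Submodule.mem_orthogonal] at hf
  refine Represents.unique (fun x hx => ?_) represents_zero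
  have h := hf _ (Submodule.subset_span ⟨⟨x, hx⟩, rfl⟩)
  rw [inner_deltaVec_left hω bc hx] at h
  exact (mul_eq_zero.1 h).resolve_left (by exact_mod_cast (S.mass_pos hω hx).ne')

end SelfSimilarLattice

namespace SelfSimilarLattice

variable {d N : ℕ} (S : SelfSimilarLattice d N)

/-! ### The operators on the finite lattices -/

theorem opA_add (u v : S.F → ℂ) (z : S.F) : S.opA (u + v) z = S.opA u z + S.opA v z := by
  unfold opA
  rw [← neg_add, ← Finset.sum_add_distrib]
  congr 1
  exact Finset.sum_congr rfl fun y _ => by simp only [Pi.add_apply]; ring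

theorem opA_smul (k : ℂ) (u : S.F → ℂ) (z : S.F) : S.opA (k • u) z = k * S.opA u z := by
  unfold opA
  rw [mul_neg, Finset.mul_sum]
  congr 1
  exact Finset.sum_congr rfl fun y _ => by simp only [Pi.smul_apply, smul_eq_mul]; ring

open Classical in
/-- The value at `x` of the copy of `A` on the cell which is the image of `F` under `c`. -/
noncomputable def cellOp (f : EuclideanSpace ℝ (Fin d) → ℂ) (x : EuclideanSpace ℝ (Fin d))
    (c : EuclideanSpace ℝ (Fin d) ≃ᵈ EuclideanSpace ℝ (Fin d)) : ℂ :=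
  ∑ z : S.F, if c z = x then S.opA (fun y => f (c y)) z else 0

theorem opAStage_eq (ω : ℕ → Fin N) (n : ℕ) (f : EuclideanSpace ℝ (Fin d) → ℂ)
    (x : EuclideanSpace ℝ (Fin d)) : S.opAStage ω n f x = S.cellSum ω n (S.cellOp f x) := by
  unfold opAStage cellSum cellOp
  refine Finset.sum_congr rfl fun j _ => ?_
  rw [energyWeight_eq, Complex.real_smul]

theorem opAStage_add (ω : ℕ → Fin N) (n : ℕ) (f g : EuclideanSpace ℝ (Fin d) → ℂ)
    (x : EuclideanSpace ℝ (Fin d)) :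
    S.opAStage ω n (f + g) x = S.opAStage ω n f x + S.opAStage ω n g x := by
  unfold opAStage
  rw [← Finset.sum_add_distrib]
  refine Finset.sum_congr rfl fun j _ => ?_
  rw [← mul_add, ← Finset.sum_add_distrib]
  congr 1
  refine Finset.sum_congr rfl fun z _ => ?_
  split_ifs
  · exact S.opA_add (fun y => f (S.cell ω j y)) (fun y => g (S.cell ω j y)) z
  · rw [add_zero]

theorem opAStage_smul (ω : ℕ → Fin N) (n : ℕ) (k : ℂ) (f : EuclideanSpace ℝ (Fin d) → ℂ)
    (x : EuclideanSpace ℝ (Fin d)) :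
    S.opAStage ω n (k • f) x = k * S.opAStage ω n f x := by
  unfold opAStage
  rw [Finset.mul_sum]
  refine Finset.sum_congr rfl fun j _ => ?_
  rw [mul_left_comm]
  congr 1
  rw [Finset.mul_sum]
  refine Finset.sum_congr rfl fun z _ => ?_
  split_ifs
  · exact S.opA_smul k (fun y => f (S.cell ω j y)) z
  · rw [mul_zero]

theorem opAStage_congr (ω : ℕ → Fin N) (n : ℕ) {f g : EuclideanSpace ℝ (Fin d) → ℂ}
    (h : ∀ x ∈ S.pts ω n, f x = g x) : S.opAStage ω n f = S.opAStage ω n g := by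
  funext x
  unfold opAStage
  refine Finset.sum_congr rfl fun j _ => ?_
  have : (fun y : S.F => f (S.cell ω j y)) = fun y : S.F => g (S.cell ω j y) :=
    funext fun y => h _ (S.cell_mem_pts ω j y)
  rw [this]

theorem opAStage_eq_of_le {ω : ℕ → Fin N} {n m : ℕ} (hnm : n ≤ m)
    (f : EuclideanSpace ℝ (Fin d) → ℂ) {x : EuclideanSpace ℝ (Fin d)} (hx : x ∈ S.intPts ω n) :
    S.opAStage ω m f x = S.opAStage ω n f x := by
  rw [opAStage_eq, opAStage_eq]
  refine S.cellSum_eq_of_le hnm _ fun c hc => Finset.sum_eq_zero fun z _ => ?_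
  rw [if_neg]
  rintro rfl
  exact hc z hx

theorem exists_cell_of_opAStage_ne_zero {ω : ℕ → Fin N} {n : ℕ}
    {f : EuclideanSpace ℝ (Fin d) → ℂ} {x : EuclideanSpace ℝ (Fin d)}
    (h : S.opAStage ω n f x ≠ 0) :
    ∃ (j : Fin n → Fin N) (z y : S.F), S.cell ω j z = x ∧ f (S.cell ω j y) ≠ 0 := by
  unfold opAStage at h
  obtain ⟨j, -, hj⟩ := Finset.exists_ne_zero_of_sum_ne_zero h
  obtain ⟨z, -, hz⟩ := Finset.exists_ne_zero_of_sum_ne_zero (right_ne_zero_of_mul hj)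
  have hzx : S.cell ω j z = x := by
    by_contra hne
    exact hz (if_neg hne)
  rw [if_pos hzx] at hz
  refine ⟨j, z, ?_⟩
  by_contra! hcon
  refine hz ?_
  unfold opA
  simp [hcon z hzx, fun y => hcon y hzx]

/-- The operator on functions with `<A_{<n>} f, g> = -∫ (stageOp f) g̅ db_{<n>}`. -/
noncomputable def stageOp (ω : ℕ → Fin N) (n : ℕ) :
    Module.End ℂ (EuclideanSpace ℝ (Fin d) → ℂ) where
  toFun f x := -S.opAStage ω n f x / S.ptMass ω n x
  map_add' f g := by
    funext x
    simp only [opAStage_add, Pi.add_apply]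
    ring
  map_smul' k f := by
    funext x
    simp only [opAStage_smul, Pi.smul_apply, RingHom.id_apply, smul_eq_mul]
    ring

theorem stageOp_apply (ω : ℕ → Fin N) (n : ℕ) (f : EuclideanSpace ℝ (Fin d) → ℂ)
    (x : EuclideanSpace ℝ (Fin d)) :
    S.stageOp ω n f x = -S.opAStage ω n f x / S.ptMass ω n x := rfl

theorem stageOp_eq_of_le {ω : ℕ → Fin N} {n m : ℕ} (hnm : n ≤ m)
    (f : EuclideanSpace ℝ (Fin d) → ℂ) {x : EuclideanSpace ℝ (Fin d)} (hx : x ∈ S.intPts ω n) :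
    S.stageOp ω m f x = S.stageOp ω n f x := by
  rw [stageOp_apply, stageOp_apply, S.opAStage_eq_of_le hnm f hx, S.ptMass_eq_of_le hnm hx]

open Classical in
theorem pairing_single {ω : ℕ → Fin N} {n : ℕ} (f : EuclideanSpace ℝ (Fin d) → ℂ)
    {x : EuclideanSpace ℝ (Fin d)} (hx : x ∈ S.pts ω n) :
    S.pairing ω n f (Pi.single x 1) = S.opAStage ω n f x := by
  unfold pairing
  rw [Finset.sum_eq_single_of_mem x hx]
  · simp
  · intro y _ hy
    simp [hy]

variable {S}

/-- Pair with the Dirac function at x: at a point off the boundary of level `n` the pairings are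
constant from level `n` on, so the limit form is computed there. -/
theorem laplacian_apply {ω : ℕ → Fin N} (hω : S.bdryInf ω = ∅) {bc : BoundaryCondition}
    (f : S.domain ω bc) {n : ℕ} {x : EuclideanSpace ℝ (Fin d)} (hx : x ∈ S.intPts ω n) :
    (S.laplacian ω bc f : Lp ℂ 2 (S.bInf ω)) x =
      S.stageOp ω n (f : Lp ℂ 2 (S.bInf ω)) x := by
  classical
  have hxI := S.intPts_subset_ptsInf ω n hx
  have h1 := S.laplacian_spec ω bc f (S.deltaVec ω bc x)
  have h2 : Tendsto (fun m => S.pairing ω m (f : Lp ℂ 2 (S.bInf ω))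
      (S.deltaVec ω bc x : Lp ℂ 2 (S.bInf ω))) atTop
      (𝓝 (S.opAStage ω n (f : Lp ℂ 2 (S.bInf ω)) x)) := by
    refine tendsto_const_nhds.congr' ?_
    filter_upwards [eventually_ge_atTop n] with m hm
    rw [S.pairing_congr ω m (ae_eq_refl _) (represents_iff_ae.1 (represents_deltaVec hω bc hxI)),
      S.pairing_single _ (S.pts_mono ω hm hx.1), S.opAStage_eq_of_le hm _ hx]
  have h3 := tendsto_nhds_unique h1 h2
  rw [inner_deltaVec_left hω bc hxI] at h3
  have hm : (S.mass ω x : ℂ) ≠ 0 := by exact_mod_cast (S.mass_pos hω hxI).ne'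
  rw [stageOp_apply, ← h3, ← S.mass_eq hx, neg_neg, mul_div_cancel_left₀ _ hm]

/-- One application of the operator spreads the support by at most one cell, and a cell meeting the
support is already a cell of level `n₀`. The image is thus finitely supported and becomes
independent of the level. -/
theorem Represents.laplacian {ω : ℕ → Fin N} (hω : S.bdryInf ω = ∅) {bc : BoundaryCondition}
    {f : S.domain ω bc} {h : EuclideanSpace ℝ (Fin d) → ℂ} (hf : S.Represents f h) {n₀ : ℕ}
    (hh : ∀ x, h x ≠ 0 → x ∈ S.intPts ω n₀) :
    ∃ n₁ ≥ n₀, (∀ n ≥ n₁, S.stageOp ω n h = S.stageOp ω n₁ h) ∧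
      (∀ x, S.stageOp ω n₁ h x ≠ 0 → x ∈ S.intPts ω n₁) ∧
      S.Represents (S.laplacian ω bc f) (S.stageOp ω n₁ h) := by
  -- The spread support can reach the boundary of level `n₀`; a higher level puts all of these
  -- points off the boundary.
  obtain ⟨n', hn'⟩ := S.exists_finset_subset_intPts hω (S.pts ω n₀)
    fun x hx => Set.mem_iUnion.2 ⟨n₀, hx⟩
  have hint : ∀ x ∈ S.pts ω n₀, x ∈ S.intPts ω (max n₀ n') := fun x hx =>
    S.intPts_mono ω (le_max_right _ _) (hn' x hx)
  have hsupp : ∀ n ≥ n₀, ∀ x, S.stageOp ω n h x ≠ 0 → x ∈ S.pts ω n₀ := by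
    intro n hn x hx
    have hx' : S.opAStage ω n h x ≠ 0 := fun h0 => hx (by rw [stageOp_apply, h0]; simp)
    obtain ⟨j, z, y, rfl, hy⟩ := S.exists_cell_of_opAStage_ne_zero hx'
    obtain ⟨j', hj'⟩ := S.exists_cell_eq hn j y (hh _ hy)
    rw [hj']
    exact S.cell_mem_pts ω j' z
  have hconst : ∀ n ≥ max n₀ n', S.stageOp ω n h = S.stageOp ω (max n₀ n') h := by
    intro n hn
    funext x
    by_cases hx : x ∈ S.pts ω n₀
    · exact S.stageOp_eq_of_le hn h (hint x hx)
    · have h1 := not_imp_not.2 (hsupp n ((le_max_left _ _).trans hn) x) hx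
      have h2 := not_imp_not.2 (hsupp (max n₀ n') (le_max_left _ _) x) hx
      rw [not_not.1 h1, not_not.1 h2]
  refine ⟨max n₀ n', le_max_left _ _, hconst,
    fun x hx => hint x (hsupp _ (le_max_left _ _) x hx), fun x hx => ?_⟩
  obtain ⟨m, hm⟩ := S.exists_mem_intPts hω hx
  rw [laplacian_apply hω f (S.intPts_mono ω (le_max_left m (max n₀ n')) hm),
    ← hconst _ (le_max_right m (max n₀ n')), stageOp_apply, stageOp_apply]
  rw [S.opAStage_congr ω _ fun y hy => hf y (Set.mem_iUnion.2 ⟨_, hy⟩)]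

-- By iteration, the powers of the operator on a Dirac function are computed exactly on all
-- sufficiently large finite lattices, with the same resulting function.
open Classical in
theorem exists_represents_laplacian_pow {ω : ℕ → Fin N} (hω : S.bdryInf ω = ∅)
    (bc : BoundaryCondition) {x : EuclideanSpace ℝ (Fin d)} (hx : x ∈ S.ptsInf ω) (k : ℕ) :
    ∃ (n₀ : ℕ) (h : EuclideanSpace ℝ (Fin d) → ℂ), (∀ y, h y ≠ 0 → y ∈ S.intPts ω n₀) ∧
      (∀ n ≥ n₀, (S.stageOp ω n ^ k) (Pi.single x 1) = h) ∧
      S.Represents ((S.laplacian ω bc ^ k) (S.deltaVec ω bc x)) h := by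
  induction k with
  | zero =>
    obtain ⟨n, hn⟩ := S.exists_mem_intPts hω hx
    refine ⟨n, Pi.single x 1, fun y hy => ?_, fun _ _ => rfl, represents_deltaVec hω bc hx⟩
    have : y = x := by
      by_contra hne
      exact hy (by simp [hne])
    rwa [this]
  | succ k ih =>
    obtain ⟨n₀, h, h1, h2, h3⟩ := ih
    obtain ⟨n₁, hn, h4, h5, h6⟩ := h3.laplacian hω h1
    refine ⟨n₁, S.stageOp ω n₁ h, h5, fun n hn' => ?_, ?_⟩
    · rw [pow_succ', Module.End.mul_apply, h2 n (hn.le.trans hn'), h4 n hn']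
    · rw [pow_succ', mul_apply_eq_comp]
      exact h6

end SelfSimilarLattice

/-- Distances to an increasing sequence of sets exhausting a closed subspace. -/
theorem tendsto_sInf_norm_sub_sq {V : Type*} [NormedAddCommGroup V] [InnerProductSpace ℂ V]
    (M : Submodule ℂ V) [M.HasOrthogonalProjection] (K : ℕ → Set V) (hK : Monotone K)
    (h0 : ∀ n, (0 : V) ∈ K n) (hKM : ∀ n, K n ⊆ M) (hMK : (M : Set V) ⊆ closure (⋃ n, K n)) (u : V) :
    Tendsto (fun n => sInf ((fun f => ‖u - f‖ ^ 2) '' K n)) atTop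
      (𝓝 (‖Mᗮ.starProjection u‖ ^ 2)) := by
  set p := M.starProjection u
  have hp : Mᗮ.starProjection u = u - p := by
    rw [Submodule.starProjection_orthogonal_val]
  have hbdd : ∀ n, BddBelow ((fun f => ‖u - f‖ ^ 2) '' K n) := fun n =>
    ⟨0, by rintro _ ⟨f, -, rfl⟩; positivity⟩
  have hlow : ∀ n, ‖Mᗮ.starProjection u‖ ^ 2 ≤ sInf ((fun f => ‖u - f‖ ^ 2) '' K n) := by
    intro n
    refine le_csInf ⟨_, 0, h0 n, rfl⟩ ?_
    rintro _ ⟨f, hf, rfl⟩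
    have h1 : Mᗮ.starProjection (u - f) = Mᗮ.starProjection u := by
      rw [map_sub, Submodule.starProjection_orthogonal_val (K := M) (u := f),
        Submodule.starProjection_eq_self_iff.2 (hKM n hf), sub_self, sub_zero]
    change _ ≤ ‖u - f‖ ^ 2
    rw [← h1]
    gcongr
    exact Submodule.norm_starProjection_apply_le _ _
  rw [Metric.tendsto_atTop]
  intro ε hε
  have hcont : Tendsto (fun f => ‖u - f‖ ^ 2) (𝓝 p) (𝓝 (‖u - p‖ ^ 2)) := by
    refine Continuous.tendsto ?_ p
    fun_prop
  have hev : ∀ᶠ f in 𝓝 p, ‖u - f‖ ^ 2 < ‖u - p‖ ^ 2 + ε :=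
    hcont.eventually_lt_const (by linarith)
  obtain ⟨f, hfε, hf⟩ := mem_closure_iff_nhds.1
    (hMK (Submodule.starProjection_apply_mem M u)) _ hev
  obtain ⟨n₀, hn₀⟩ := Set.mem_iUnion.1 hf
  refine ⟨n₀, fun n hn => ?_⟩
  have h2 : sInf ((fun f => ‖u - f‖ ^ 2) '' K n) ≤ ‖u - f‖ ^ 2 :=
    csInf_le (hbdd n) ⟨f, hK hn hn₀, rfl⟩
  have hfε' : ‖u - f‖ ^ 2 < ‖u - p‖ ^ 2 + ε := hfε
  rw [Real.dist_eq, abs_of_nonneg (sub_nonneg.2 (hlow n)), hp]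
  linarith

namespace SelfSimilarLattice

variable {d N : ℕ} (S : SelfSimilarLattice d N)

/-! ### Neumann-Dirichlet eigenfunctions -/

/-- The Neumann-Dirichlet eigenfunctions of level `n`, as functions on the whole space. -/
def ndSet (ω : ℕ → Fin N) (n : ℕ) : Set (EuclideanSpace ℝ (Fin d) → ℂ) :=
  {w | (∀ x ∉ S.intPts ω n, w x = 0) ∧ ∃ t : ℝ, S.stageOp ω n w = (t : ℂ) • w}

theorem opAStage_eq_zero_of_notMem (ω : ℕ → Fin N) (n : ℕ) (f : EuclideanSpace ℝ (Fin d) → ℂ)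
    {x : EuclideanSpace ℝ (Fin d)} (hx : x ∉ S.pts ω n) : S.opAStage ω n f x = 0 := by
  by_contra h
  obtain ⟨j, z, y, rfl, -⟩ := S.exists_cell_of_opAStage_ne_zero h
  exact hx (S.cell_mem_pts ω j z)

theorem opAStage_eq_of_support {ω : ℕ → Fin N} {n m : ℕ} (hnm : n ≤ m)
    {w : EuclideanSpace ℝ (Fin d) → ℂ} (hw : ∀ x ∉ S.intPts ω n, w x = 0)
    (x : EuclideanSpace ℝ (Fin d)) : S.opAStage ω m w x = S.opAStage ω n w x := by
  rw [opAStage_eq, opAStage_eq]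
  refine S.cellSum_eq_of_le hnm _ fun c hc => Finset.sum_eq_zero fun z _ => ?_
  have : (fun y : S.F => w (c y)) = 0 := funext fun y => hw _ (hc y)
  rw [this]
  simp [opA]

/-- The new cells do not meet the support of w. Only the masses at boundary points change, and there
the eigenvalue equation says 0 = 0 whatever the mass. -/
theorem ndSet_mono (ω : ℕ → Fin N) : Monotone (S.ndSet ω) := by
  rintro n m hnm w ⟨hw, t, ht⟩
  refine ⟨fun x hx => hw x fun h => hx (S.intPts_mono ω hnm h), t, ?_⟩
  funext x
  have h1 := congrFun ht x
  by_cases hx : x ∈ S.intPts ω n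
  · rw [S.stageOp_eq_of_le hnm w hx, h1]
  · rw [Pi.smul_apply, hw x hx, smul_zero, stageOp_apply] at h1 ⊢
    rw [S.opAStage_eq_of_support hnm hw]
    by_cases hx' : x ∈ S.pts ω n
    · have h2 : (S.ptMass ω n x : ℂ) ≠ 0 := by exact_mod_cast (S.ptMass_pos hx').ne'
      rw [(div_eq_zero_iff.1 h1).resolve_right h2, zero_div]
    · rw [S.opAStage_eq_zero_of_notMem ω n w hx', neg_zero, zero_div]

open Classical in
theorem integral_bStage (ω : ℕ → Fin N) (n : ℕ) (G : EuclideanSpace ℝ (Fin d) → ℂ) :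
    ∫ x, G x ∂S.bStage ω n = ∑ x ∈ S.pts ω n, (S.ptMass ω n x : ℂ) * G x := by
  have hint : ∀ (j : Fin n → Fin N) (z : S.F), Integrable G
      (ENNReal.ofReal (S.massWeight ω j * S.b z) • Measure.dirac (S.cell ω j z)) := fun j z =>
    (integrable_dirac (by simp)).smul_measure ENNReal.ofReal_ne_top
  unfold bStage
  rw [integral_finsetSum_measure fun j _ =>
    integrable_finsetSum_measure.2 fun z _ => hint j z]
  unfold ptMass cellSum
  push_cast
  simp only [Finset.sum_mul]
  rw [Finset.sum_comm]
  refine Finset.sum_congr rfl fun j _ => ?_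
  rw [integral_finsetSum_measure fun z _ => hint j z]
  simp only [smul_eq_mul, Complex.ofReal_mul, Complex.ofReal_sum, Finset.mul_sum, Finset.sum_mul]
  rw [Finset.sum_comm]
  refine Finset.sum_congr rfl fun z _ => ?_
  rw [integral_smul_measure, integral_dirac, ENNReal.toReal_ofReal
    (mul_nonneg (S.massWeight_pos ω j).le (S.b_pos z).le),
    Finset.sum_eq_single_of_mem _ (S.cell_mem_pts ω j z)]
  · simp
  · intro y _ hy
    simp [hy.symm]

/-- Testing the weak equation on Dirac functions gives the pointwise one, division by the positive
masses being allowed. -/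
theorem mem_ndSet_iff {ω : ℕ → Fin N} {n : ℕ} {w : EuclideanSpace ℝ (Fin d) → ℂ}
    (hw : ∀ x ∉ S.intPts ω n, w x = 0) :
    w ∈ S.ndSet ω n ↔ ∃ t : ℝ, ∀ g : EuclideanSpace ℝ (Fin d) → ℂ,
      S.pairing ω n w g = -(t : ℂ) * ∫ x, w x * starRingEnd ℂ (g x) ∂S.bStage ω n := by
  classical
  have key : ∀ t : ℝ, S.stageOp ω n w = (t : ℂ) • w ↔
      ∀ x ∈ S.pts ω n, S.opAStage ω n w x = -(t : ℂ) * (S.ptMass ω n x * w x) := by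
    intro t
    constructor
    · intro h x hx
      have h1 := congrFun h x
      have h2 : (S.ptMass ω n x : ℂ) ≠ 0 := by exact_mod_cast (S.ptMass_pos hx).ne'
      rw [stageOp_apply, div_eq_iff h2, Pi.smul_apply, smul_eq_mul] at h1
      linear_combination -h1
    · intro h
      funext x
      rw [stageOp_apply, Pi.smul_apply, smul_eq_mul]
      by_cases hx : x ∈ S.pts ω n
      · have h2 : (S.ptMass ω n x : ℂ) ≠ 0 := by exact_mod_cast (S.ptMass_pos hx).ne'
        rw [h x hx, div_eq_iff h2]
        ring
      · rw [S.opAStage_eq_zero_of_notMem ω n w hx, hw x fun h => hx h.1]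
        simp
  constructor
  · rintro ⟨-, t, ht⟩
    refine ⟨t, fun g => ?_⟩
    rw [S.integral_bStage ω n fun x => w x * starRingEnd ℂ (g x), pairing, Finset.mul_sum]
    refine Finset.sum_congr rfl fun x hx => ?_
    rw [(key t).1 ht x hx]
    ring
  · rintro ⟨t, ht⟩
    refine ⟨hw, t, (key t).2 fun x hx => ?_⟩
    have h1 := ht (Pi.single x 1)
    rw [S.pairing_single w hx, S.integral_bStage ω n fun y => w y * starRingEnd ℂ _,
      Finset.sum_eq_single_of_mem x hx] at h1
    · simpa using h1
    · intro y _ hy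
      simp [hy]

variable {S}

theorem exists_represents_of_support {ω : ℕ → Fin N} (hω : S.bdryInf ω = ∅)
    (bc : BoundaryCondition) {n : ℕ} {w : EuclideanSpace ℝ (Fin d) → ℂ}
    (hw : ∀ x ∉ S.intPts ω n, w x = 0) : ∃ f : S.domain ω bc, S.Represents f w :=
  ⟨_, represents_sum_deltaVec hω bc (s := S.pts ω n)
    (fun _ hx => Set.mem_iUnion.2 ⟨n, hx⟩) fun x hx => (not_imp_comm.1 (hw x) hx).1⟩

theorem isNDEigenfunction_iff {ω : ℕ → Fin N} {bc : BoundaryCondition} (f : S.domain ω bc) (n : ℕ) :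
    S.IsNDEigenfunction ω n (f : Lp ℂ 2 (S.bInf ω)) ↔ ∃ w ∈ S.ndSet ω n, S.Represents f w := by
  classical
  have hcongr : ∀ w : EuclideanSpace ℝ (Fin d) → ℂ, S.Represents f w →
      ((∃ t : ℝ, ∀ g : EuclideanSpace ℝ (Fin d) → ℂ,
        S.pairing ω n (f : Lp ℂ 2 (S.bInf ω)) g =
          -(t : ℂ) * ∫ x, (f : Lp ℂ 2 (S.bInf ω)) x * starRingEnd ℂ (g x) ∂S.bStage ω n) ↔
      ∃ t : ℝ, ∀ g : EuclideanSpace ℝ (Fin d) → ℂ,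
        S.pairing ω n w g = -(t : ℂ) * ∫ x, w x * starRingEnd ℂ (g x) ∂S.bStage ω n) := by
    intro w hw
    have h1 : ∀ g, S.pairing ω n (f : Lp ℂ 2 (S.bInf ω)) g = S.pairing ω n w g := fun g =>
      S.pairing_congr ω n (represents_iff_ae.1 hw) (ae_eq_refl _)
    have h2 : ∀ g : EuclideanSpace ℝ (Fin d) → ℂ,
        ∫ x, (f : Lp ℂ 2 (S.bInf ω)) x * starRingEnd ℂ (g x) ∂S.bStage ω n =
          ∫ x, w x * starRingEnd ℂ (g x) ∂S.bStage ω n := by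
      intro g
      rw [S.integral_bStage ω n fun x => (f : Lp ℂ 2 (S.bInf ω)) x * starRingEnd ℂ (g x),
        S.integral_bStage ω n fun x => w x * starRingEnd ℂ (g x)]
      refine Finset.sum_congr rfl fun x hx => ?_
      rw [hw x (Set.mem_iUnion.2 ⟨n, hx⟩)]
    simp only [h1, h2]
  constructor
  · rintro ⟨h0, ht⟩
    rw [ae_bInf_iff] at h0
    set w : EuclideanSpace ℝ (Fin d) → ℂ :=
      (S.intPts ω n).indicator (f : Lp ℂ 2 (S.bInf ω)) with hw
    have hwr : S.Represents f w := by
      intro x hx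
      by_cases hx' : x ∈ S.intPts ω n
      · rw [hw, Set.indicator_of_mem hx']
      · rw [hw, Set.indicator_of_notMem hx']
        exact h0 x hx hx'
    exact ⟨w, (S.mem_ndSet_iff fun x hx => Set.indicator_of_notMem hx _).2 ((hcongr w hwr).1 ht),
      hwr⟩
  · rintro ⟨w, hw, hwr⟩
    refine ⟨?_, (hcongr w hwr).2 ((S.mem_ndSet_iff hw.1).1 hw)⟩
    rw [ae_bInf_iff]
    intro x hx hx'
    rw [hwr x hx]
    exact hw.1 x hx'

variable (S)

/-- The subspace of `D_{<∞>}` removed in the definition of the part `p` of the spectrum. -/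
noncomputable def removedSpace (ω : ℕ → Fin N) (bc : BoundaryCondition) : Part → Submodule ℂ (S.domain ω bc)
  | .ppTilde => S.ndSpace ω bc
  | _ => ⊥

instance (ω : ℕ → Fin N) (bc : BoundaryCondition) (p : Part) :
    CompleteSpace (S.removedSpace ω bc p) := by
  cases p
  case ppTilde => exact inferInstanceAs (CompleteSpace (S.ndSpace ω bc))
  all_goals exact inferInstanceAs (CompleteSpace (⊥ : Submodule ℂ (S.domain ω bc)))

/-- The functions of level `n` removed in the definition of the part `p` of the spectrum. -/
noncomputable def removedStage (ω : ℕ → Fin N) (n : ℕ) : Part → Submodule ℂ (EuclideanSpace ℝ (Fin d) → ℂ)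
  | .ppTilde => Submodule.span ℂ (S.ndSet ω n)
  | _ => ⊥

theorem removedStage_mono (ω : ℕ → Fin N) (p : Part) :
    Monotone fun n => S.removedStage ω n p := by
  intro n m hnm
  cases p
  case ppTilde => exact Submodule.span_mono (S.ndSet_mono ω hnm)
  all_goals exact le_rfl

theorem removedStage_support {ω : ℕ → Fin N} {n : ℕ} {p : Part}
    {w : EuclideanSpace ℝ (Fin d) → ℂ} (hw : w ∈ S.removedStage ω n p)
    {x : EuclideanSpace ℝ (Fin d)} (hx : x ∉ S.intPts ω n) : w x = 0 := by
  have hbot : w ∈ (⊥ : Submodule ℂ (EuclideanSpace ℝ (Fin d) → ℂ)) → w x = 0 := fun h => by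
    rw [(Submodule.mem_bot ℂ).1 h, Pi.zero_apply]
  cases p
  case ppTilde =>
    have hle : Submodule.span ℂ (S.ndSet ω n) ≤ LinearMap.ker (LinearMap.proj (R := ℂ) x) :=
      Submodule.span_le.2 fun w hw => hw.1 x hx
    exact hle hw
  all_goals exact hbot hw

variable {S}

theorem Represents.mem_removedSpace {ω : ℕ → Fin N} (hω : S.bdryInf ω = ∅)
    {bc : BoundaryCondition} {p : Part} {n : ℕ} {w : EuclideanSpace ℝ (Fin d) → ℂ}
    (hw : w ∈ S.removedStage ω n p) {f : S.domain ω bc} (hf : S.Represents f w) :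
    f ∈ S.removedSpace ω bc p := by
  have hbot : w ∈ (⊥ : Submodule ℂ (EuclideanSpace ℝ (Fin d) → ℂ)) →
      f ∈ (⊥ : Submodule ℂ (S.domain ω bc)) := fun h => by
    rw [(Submodule.mem_bot ℂ).1 h] at hf
    rw [hf.unique represents_zero]
    exact zero_mem _
  cases p
  case ppTilde =>
    have key : ∃ g ∈ S.ndSpace ω bc, S.Represents g w := by
      refine Submodule.span_induction (p := fun w _ => ∃ g ∈ S.ndSpace ω bc, S.Represents g w)
        ?_ ⟨0, zero_mem _, represents_zero⟩ ?_ ?_ hw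
      · intro w hw
        obtain ⟨g, hg⟩ := exists_represents_of_support hω bc hw.1
        exact ⟨g, Submodule.le_topologicalClosure _
          (Submodule.subset_span ⟨n, (isNDEigenfunction_iff g n).2 ⟨w, hw, hg⟩⟩), hg⟩
      · rintro w w' - - ⟨g, hg, hgw⟩ ⟨g', hg', hgw'⟩
        exact ⟨g + g', add_mem hg hg', hgw.add hgw'⟩
      · rintro c w - ⟨g, hg, hgw⟩
        exact ⟨c • g, Submodule.smul_mem _ c hg, hgw.smul c⟩
    obtain ⟨g, hg, hgw⟩ := key
    rw [hf.unique hgw]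
    exact hg
  all_goals exact hbot hw

/-- The spans of Neumann-Dirichlet functions increase with the level, so their union is already a
subspace and only the closure remains to be taken. -/
theorem removedSpace_subset_closure {ω : ℕ → Fin N} {bc : BoundaryCondition} (p : Part) :
    (S.removedSpace ω bc p : Set (S.domain ω bc)) ⊆
      closure (⋃ n, {f | ∃ w ∈ S.removedStage ω n p, S.Represents f w}) := by
  have hbot : ((⊥ : Submodule ℂ (S.domain ω bc)) : Set (S.domain ω bc)) ⊆
      closure (⋃ n, {f | ∃ w ∈ S.removedStage ω n p, S.Represents f w}) := by
    intro f hf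
    rw [SetLike.mem_coe, Submodule.mem_bot] at hf
    rw [hf]
    refine subset_closure (Set.mem_iUnion.2 ⟨0, ?_⟩)
    exact ⟨0, zero_mem _, represents_zero⟩
  cases p
  case ppTilde =>
    refine closure_mono fun f hf => ?_
    refine Submodule.span_induction
      (p := fun f _ => f ∈ ⋃ n, {f | ∃ w ∈ S.removedStage ω n .ppTilde, S.Represents f w})
      ?_ ?_ ?_ ?_ hf
    · rintro f ⟨n, hn⟩
      obtain ⟨w, hw, hfw⟩ := (isNDEigenfunction_iff f n).1 hn
      refine Set.mem_iUnion.2 ⟨n, ?_⟩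
      exact ⟨w, Submodule.subset_span hw, hfw⟩
    · refine Set.mem_iUnion.2 ⟨0, ?_⟩
      exact ⟨0, zero_mem _, represents_zero⟩
    · intro f g _ _ hf hg
      obtain ⟨n, w, hw, hfw⟩ := Set.mem_iUnion.1 hf
      obtain ⟨m, w', hw', hgw⟩ := Set.mem_iUnion.1 hg
      refine Set.mem_iUnion.2 ⟨max n m, ?_⟩
      exact ⟨w + w', add_mem (S.removedStage_mono ω _ (le_max_left n m) hw)
        (S.removedStage_mono ω _ (le_max_right n m) hw'), hfw.add hgw⟩
    · intro c f _ hf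
      obtain ⟨n, w, hw, hfw⟩ := Set.mem_iUnion.1 hf
      refine Set.mem_iUnion.2 ⟨n, ?_⟩
      exact ⟨c • w, Submodule.smul_mem _ c hw, hfw.smul c⟩
  all_goals exact hbot

/-- Extended by 0, such a function satisfies the same equation at every higher level, hence it is an
eigenvector of the infinite operator. This makes the removed space invariant. -/
theorem laplacian_eq_smul_of_mem_ndSet {ω : ℕ → Fin N} (hω : S.bdryInf ω = ∅)
    {bc : BoundaryCondition} {n : ℕ} {w : EuclideanSpace ℝ (Fin d) → ℂ} (hw : w ∈ S.ndSet ω n)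
    {f : S.domain ω bc} (hf : S.Represents f w) : ∃ t : ℝ, S.laplacian ω bc f = (t : ℂ) • f := by
  obtain ⟨h0, t, ht⟩ := hw
  refine ⟨t, Represents.unique (fun x hx => ?_) (hf.smul (t : ℂ))⟩
  obtain ⟨m, hm⟩ := S.exists_mem_intPts hω hx
  obtain ⟨-, t', ht'⟩ := S.ndSet_mono ω (le_max_left n m) ⟨h0, t, ht⟩
  have hx' := S.intPts_mono ω (le_max_right n m) hm
  rw [laplacian_apply hω f hx', ← ht, stageOp_apply, stageOp_apply,
    S.opAStage_congr ω _ fun y hy => hf y (Set.mem_iUnion.2 ⟨_, hy⟩),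
    S.opAStage_eq_of_support (le_max_left n m) h0]
  by_cases hxn : x ∈ S.intPts ω n
  · rw [S.ptMass_eq_of_le (le_max_left n m) hxn]
  · have h1 := congrFun ht x
    rw [Pi.smul_apply, h0 x hxn, smul_zero, stageOp_apply] at h1
    rw [h1]
    by_cases hxp : x ∈ S.pts ω n
    · have h2 : (S.ptMass ω n x : ℂ) ≠ 0 := by exact_mod_cast (S.ptMass_pos hxp).ne'
      rw [(div_eq_zero_iff.1 h1).resolve_right h2, zero_div]
    · rw [S.opAStage_eq_zero_of_notMem ω n w hxp, neg_zero, zero_div]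

theorem laplacian_mem_removedSpace {ω : ℕ → Fin N} (hω : S.bdryInf ω = ∅)
    {bc : BoundaryCondition} {p : Part} :
    ∀ f ∈ S.removedSpace ω bc p, S.laplacian ω bc f ∈ S.removedSpace ω bc p := by
  have hbot : ∀ f ∈ (⊥ : Submodule ℂ (S.domain ω bc)),
      S.laplacian ω bc f ∈ (⊥ : Submodule ℂ (S.domain ω bc)) := fun f hf => by
    rw [(Submodule.mem_bot ℂ).1 hf, map_zero]
    exact zero_mem _
  cases p
  case ppTilde =>
    intro f hf
    have hle : Submodule.span ℂ {f : S.domain ω bc |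
        ∃ n, S.IsNDEigenfunction ω n (f : Lp ℂ 2 (S.bInf ω))} ≤
        (S.ndSpace ω bc).comap (S.laplacian ω bc : S.domain ω bc →ₗ[ℂ] S.domain ω bc) := by
      refine Submodule.span_le.2 ?_
      rintro f ⟨n, hn⟩
      obtain ⟨w, hw, hfw⟩ := (isNDEigenfunction_iff f n).1 hn
      obtain ⟨t, ht⟩ := laplacian_eq_smul_of_mem_ndSet hω hw hfw
      change S.laplacian ω bc f ∈ S.ndSpace ω bc
      rw [ht]
      exact Submodule.smul_mem _ _ (Submodule.le_topologicalClosure _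
        (Submodule.subset_span ⟨n, hn⟩))
    have hcl : IsClosed {f : S.domain ω bc | S.laplacian ω bc f ∈ S.ndSpace ω bc} :=
      (Submodule.isClosed_topologicalClosure _).preimage (S.laplacian ω bc).continuous
    exact closure_minimal hle hcl hf
  all_goals exact hbot

end SelfSimilarLattice

theorem pow_starProjection {V : Type*} [NormedAddCommGroup V] [InnerProductSpace ℂ V]
    [CompleteSpace V] {T : V →L[ℂ] V} (hT : IsSelfAdjoint T) {M : Submodule ℂ V}
    [M.HasOrthogonalProjection] (hM : ∀ f ∈ M, T f ∈ M) (k : ℕ) (f : V) :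
    (T ^ k) (M.starProjection f) = M.starProjection ((T ^ k) f) := by
  have h := cfc_starProjection hT hM (fun x : ℝ => x ^ k) f
  rwa [cfc_pow_id T k hT] at h

namespace SelfSimilarLattice

variable {d N : ℕ} (S : SelfSimilarLattice d N)

/-! ### The moments of the spectral measures as limits over the finite lattices -/

/-- The squared distance of `u` to the functions of level `n` removed for the part `p`. -/
noncomputable def stageDist (ω : ℕ → Fin N) (n : ℕ) (p : Part)
    (u : EuclideanSpace ℝ (Fin d) → ℂ) : ℝ :=
  sInf ((fun w : EuclideanSpace ℝ (Fin d) → ℂ =>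
    ∑ x ∈ S.pts ω n, S.ptMass ω n x * ‖u x - w x‖ ^ 2) '' S.removedStage ω n p)

open Classical in
/-- The `k`-th moment at level `n`, in polarized form, of the spectral measure at `y`. -/
noncomputable def stageMoment (ω : ℕ → Fin N) (n : ℕ) (p : Part) (k : ℕ)
    (y : EuclideanSpace ℝ (Fin d)) : ℝ :=
  (S.stageDist ω n p (Pi.single y 1 + (S.stageOp ω n ^ k) (Pi.single y 1)) -
    S.stageDist ω n p (Pi.single y 1 - (S.stageOp ω n ^ k) (Pi.single y 1))) / 4

/-- The spectral measure of the projection of `δ_y` on the orthogonal complement of the space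
removed for the part `p`. -/
noncomputable def projSpectralMeasure (ω : ℕ → Fin N) (bc : BoundaryCondition) (p : Part)
    (y : EuclideanSpace ℝ (Fin d)) : Measure ℝ :=
  spectralMeasure (S.laplacian ω bc)
    ((S.removedSpace ω bc p)ᗮ.starProjection (S.deltaVec ω bc y))

instance (ω : ℕ → Fin N) (bc : BoundaryCondition) (p : Part) (y : EuclideanSpace ℝ (Fin d)) :
    IsFiniteMeasure (S.projSpectralMeasure ω bc p y) := by
  unfold projSpectralMeasure; infer_instance

variable {S}

theorem tendsto_stageDist {ω : ℕ → Fin N} (hω : S.bdryInf ω = ∅) {bc : BoundaryCondition} (p : Part)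
    {f : S.domain ω bc} {u : EuclideanSpace ℝ (Fin d) → ℂ} (hf : S.Represents f u) {n₀ : ℕ}
    (hu : ∀ x, u x ≠ 0 → x ∈ S.intPts ω n₀) :
    Tendsto (fun n => S.stageDist ω n p u) atTop
      (𝓝 (‖(S.removedSpace ω bc p)ᗮ.starProjection f‖ ^ 2)) := by
  refine (tendsto_sInf_norm_sub_sq (S.removedSpace ω bc p)
    (fun n => {g | ∃ w ∈ S.removedStage ω n p, S.Represents g w}) ?_ ?_ ?_
    (removedSpace_subset_closure p) f).congr' ?_
  · rintro n m hnm g ⟨w, hw, hg⟩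
    exact ⟨w, S.removedStage_mono ω p hnm hw, hg⟩
  · exact fun n => ⟨0, zero_mem _, represents_zero⟩
  · rintro n g ⟨w, hw, hg⟩
    exact hg.mem_removedSpace hω hw
  filter_upwards [eventually_ge_atTop n₀] with n hn
  -- Both functions vanish on the boundary of level `n`, and off it the masses of level `n` are
  -- already final; the distance in L² is therefore a finite sum.
  have key : ∀ w ∈ S.removedStage ω n p, ∀ g : S.domain ω bc, S.Represents g w →
      ‖f - g‖ ^ 2 = ∑ x ∈ S.pts ω n, S.ptMass ω n x * ‖u x - w x‖ ^ 2 := by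
    intro w hw g hg
    have h0 : ∀ x, x ∉ S.intPts ω n → u x - w x = 0 := by
      intro x hx
      rw [S.removedStage_support hw hx, sub_zero]
      by_contra hne
      exact hx (S.intPts_mono ω hn (hu x hne))
    rw [(hf.sub hg).norm_sq_eq_sum hω (s := S.pts ω n)
      (fun x hx => Set.mem_iUnion.2 ⟨n, hx⟩) fun x hx => (not_imp_comm.1 (h0 x) hx).1]
    refine Finset.sum_congr rfl fun x _ => ?_
    by_cases hx : x ∈ S.intPts ω n
    · rw [S.mass_eq hx, Pi.sub_apply]
    · rw [Pi.sub_apply, h0 x hx]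
      simp
  unfold stageDist
  congr 1
  ext r
  constructor
  · rintro ⟨g, ⟨w, hw, hg⟩, rfl⟩
    exact ⟨w, hw, (key w hw g hg).symm⟩
  · rintro ⟨w, hw, rfl⟩
    obtain ⟨g, hg⟩ := exists_represents_of_support hω bc (n := n) (w := w)
      fun x hx => S.removedStage_support hw hx
    exact ⟨g, ⟨w, hw, hg⟩, key w hw g hg⟩

/-- The projection P commutes with T, so the moment is the real part of ⟨Pδ, P Tᵏ δ⟩. Polarization
turns it into two squared distances to the removed space, each a limit of finite-level distances. No
boundary condition appears at finite level. -/
theorem tendsto_stageMoment {ω : ℕ → Fin N} (hω : S.bdryInf ω = ∅) (bc : BoundaryCondition)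
    (p : Part) (k : ℕ) {y : EuclideanSpace ℝ (Fin d)} (hy : y ∈ S.ptsInf ω) :
    Tendsto (fun n => S.stageMoment ω n p k y) atTop
      (𝓝 (∫ x, x ^ k ∂S.projSpectralMeasure ω bc p y)) := by
  classical
  obtain ⟨n₀, h, h1, h2, h3⟩ := exists_represents_laplacian_pow hω bc hy k
  obtain ⟨n₁, hn₁⟩ := S.exists_mem_intPts hω hy
  have hδ := represents_deltaVec hω bc hy
  set T := S.laplacian ω bc with hT
  have hTs : IsSelfAdjoint T := S.laplacian_isSelfAdjoint ω bc
  set P := (S.removedSpace ω bc p)ᗮ.starProjection with hP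
  set δ := S.deltaVec ω bc y
  have hsupp : ∀ x, (x = y ∨ h x ≠ 0) → x ∈ S.intPts ω (max n₀ n₁) := by
    rintro x (rfl | hx)
    · exact S.intPts_mono ω (le_max_right _ _) hn₁
    · exact S.intPts_mono ω (le_max_left _ _) (h1 x hx)
  have hadd := tendsto_stageDist hω p (hδ.add h3) (n₀ := max n₀ n₁) fun x hx => hsupp x (by
    by_contra! hcon
    exact hx (by simp [hcon.1, hcon.2]))
  have hsub := tendsto_stageDist hω p (hδ.sub h3) (n₀ := max n₀ n₁) fun x hx => hsupp x (by
    by_contra! hcon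
    exact hx (by simp [hcon.1, hcon.2]))
  have hmem : ∀ f ∈ (S.removedSpace ω bc p)ᗮ, T f ∈ (S.removedSpace ω bc p)ᗮ := by
    intro f hf
    rw [Submodule.mem_orthogonal] at hf ⊢
    intro g hg
    have h4 := hf _ (laplacian_mem_removedSpace hω g hg)
    rw [← h4]
    exact ((ContinuousLinearMap.isSelfAdjoint_iff_isSymmetric.1 hTs) g f).symm
  have hcomm : (T ^ k) (P δ) = P ((T ^ k) δ) := pow_starProjection hTs hmem k δ
  have hval : ∫ x, x ^ k ∂S.projSpectralMeasure ω bc p y =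
      (‖P (δ + (T ^ k) δ)‖ ^ 2 - ‖P (δ - (T ^ k) δ)‖ ^ 2) / 4 := by
    unfold projSpectralMeasure
    rw [integral_pow_spectralMeasure hTs, hcomm, map_add, map_sub]
    have h6 := norm_add_sq (𝕜 := ℂ) (P δ) (P ((T ^ k) δ))
    have h7 := norm_sub_sq (𝕜 := ℂ) (P δ) (P ((T ^ k) δ))
    rw [h6, h7]
    simp only [RCLike.re_eq_complex_re]
    ring
  rw [hval]
  refine ((hadd.sub hsub).div_const 4).congr' ?_
  filter_upwards [eventually_ge_atTop n₀] with n hn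
  rw [stageMoment, h2 n hn]

/-- A bound independent of ω and of the boundary condition puts all the spectral measures in one
compact interval, so that moments determine them and their measurability. -/
theorem norm_laplacian_le (ω : ℕ → Fin N) (bc : BoundaryCondition) :
    ‖S.laplacian ω bc‖ ≤ 2 * S.formBound := by
  have hK : 0 ≤ S.formBound := Finset.sum_nonneg fun z _ => Finset.sum_nonneg fun y _ =>
    mul_nonneg (abs_nonneg _) (mul_nonneg (by norm_num)
      (Finset.sum_nonneg fun x _ => (inv_pos.2 (S.b_pos x)).le))
  have hb : ∀ f g : S.domain ω bc, ‖(inner ℂ g (S.laplacian ω bc f) : ℂ)‖ ≤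
      S.formBound * (‖f‖ ^ 2 + ‖g‖ ^ 2) := by
    intro f g
    have h := le_of_tendsto (S.laplacian_spec ω bc f g).norm
      (Eventually.of_forall fun n => S.norm_pairing_le ω n f g)
    rwa [norm_neg] at h
  refine ContinuousLinearMap.opNorm_le_bound _ (by positivity) fun f => ?_
  rcases eq_or_ne (S.laplacian ω bc f) 0 with h0 | h0
  · rw [h0, norm_zero]; positivity
  have h1 := norm_pos_iff.2 h0
  rcases eq_or_ne f 0 with rfl | hf
  · simp
  have hf' := norm_pos_iff.2 hf
  -- The test vector is T f rescaled to the norm of f, which turns the quadratic bound into a linear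
  -- one.
  have h2 := hb f (((‖f‖ / ‖S.laplacian ω bc f‖ : ℝ) : ℂ) • S.laplacian ω bc f)
  have h3 : (inner ℂ (((‖f‖ / ‖S.laplacian ω bc f‖ : ℝ) : ℂ) • S.laplacian ω bc f)
      (S.laplacian ω bc f) : ℂ) = ((‖f‖ * ‖S.laplacian ω bc f‖ : ℝ) : ℂ) := by
    refine (inner_smul_left (𝕜 := ℂ) (S.laplacian ω bc f) (S.laplacian ω bc f) _).trans ?_
    rw [Complex.conj_ofReal, inner_self_eq_norm_sq_to_K]
    have h4 : (‖S.laplacian ω bc f‖ : ℂ) ≠ 0 := by exact_mod_cast h1.ne'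
    push_cast
    field_simp
    rfl
  rw [h3, norm_smul, Complex.norm_real, Complex.norm_real, Real.norm_of_nonneg (by positivity),
    Real.norm_of_nonneg (by positivity), div_mul_cancel₀ _ h1.ne'] at h2
  nlinarith

theorem ae_mem_closedBall_projSpectralMeasure (ω : ℕ → Fin N) (bc : BoundaryCondition) (p : Part)
    (y : EuclideanSpace ℝ (Fin d)) :
    ∀ᵐ x ∂S.projSpectralMeasure ω bc p y, x ∈ Metric.closedBall (0 : ℝ) (2 * S.formBound) := by
  filter_upwards [ae_mem_closedBall_spectralMeasure (S.laplacian ω bc)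
    ((S.removedSpace ω bc p)ᗮ.starProjection (S.deltaVec ω bc y))] with x hx
  exact Metric.closedBall_subset_closedBall (norm_laplacian_le ω bc) hx

/-! ### Transport between the lattices of two blow-ups -/

variable (S)

/-- At level `n`, the lattice of `ω'` is the image of that of `ω` under `τ`, with masses multiplied
by `κ`. -/
structure IsShift (ω ω' : ℕ → Fin N) (n : ℕ)
    (τ : EuclideanSpace ℝ (Fin d) ≃ᵈ EuclideanSpace ℝ (Fin d)) (κ : ℝ) : Prop where
  blowUp_eq : S.blowUp ω' n = τ * S.blowUp ω n
  prod_eq : ∏ k : Fin n, (S.β (ω' k))⁻¹ = κ * ∏ k : Fin n, (S.β (ω k))⁻¹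

variable {S}

namespace IsShift

variable {ω ω' : ℕ → Fin N} {n : ℕ} {τ : EuclideanSpace ℝ (Fin d) ≃ᵈ EuclideanSpace ℝ (Fin d)}
  {κ : ℝ}

theorem pos (h : S.IsShift ω ω' n τ κ) : 0 < κ := by
  have h1 : 0 < ∏ k : Fin n, (S.β (ω' k))⁻¹ := Finset.prod_pos fun _ _ => inv_pos.2 (S.β_mem _).1
  have h2 : 0 < ∏ k : Fin n, (S.β (ω k))⁻¹ := Finset.prod_pos fun _ _ => inv_pos.2 (S.β_mem _).1
  rw [h.prod_eq] at h1
  exact (pos_iff_pos_of_mul_pos h1).2 h2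

theorem succ (h : S.IsShift ω ω' n τ κ) (hn : ω n = ω' n) : S.IsShift ω ω' (n + 1) τ κ where
  blowUp_eq := by rw [blowUp_succ, blowUp_succ, h.blowUp_eq, hn, mul_assoc]
  prod_eq := by
    rw [Fin.prod_univ_castSucc, Fin.prod_univ_castSucc]
    simp only [Fin.val_castSucc, Fin.val_last]
    rw [h.prod_eq, hn, mul_assoc]

theorem of_le (h : S.IsShift ω ω' n τ κ) (hn : ∀ k, n ≤ k → ω k = ω' k) {m : ℕ} (hm : n ≤ m) :
    S.IsShift ω ω' m τ κ := by
  induction m, hm using Nat.le_induction with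
  | base => exact h
  | succ m hm ih => exact ih.succ (hn m hm)

/-- With the trivial similitude, the transport formulas say that quantities of level `n` depend only
on the first `n` letters. -/
theorem of_agree (h : ∀ k < n, ω k = ω' k) : S.IsShift ω ω' n 1 1 where
  blowUp_eq := by
    have : (fun k : Fin n => (S.Ψ (ω' k))⁻¹) = fun k : Fin n => (S.Ψ (ω k))⁻¹ :=
      funext fun k => by rw [h k k.2]
    rw [blowUp, blowUp, this, one_mul]
  prod_eq := by
    rw [one_mul]
    exact Finset.prod_congr rfl fun k _ => by rw [h k k.2]

theorem cell_eq (h : S.IsShift ω ω' n τ κ) (j : Fin n → Fin N) :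
    S.cell ω' j = τ * S.cell ω j := by
  unfold cell
  rw [h.blowUp_eq, mul_assoc]

theorem massWeight_eq (h : S.IsShift ω ω' n τ κ) (j : Fin n → Fin N) :
    S.massWeight ω' j = κ * S.massWeight ω j := by
  unfold massWeight
  rw [h.prod_eq, mul_assoc]

theorem cellSum_eq {M : Type*} [AddCommMonoid M] [Module ℝ M] (h : S.IsShift ω ω' n τ κ)
    (G : (EuclideanSpace ℝ (Fin d) ≃ᵈ EuclideanSpace ℝ (Fin d)) → M) :
    S.cellSum ω' n G = κ • S.cellSum ω n fun c => G (τ * c) := by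
  unfold cellSum
  rw [Finset.smul_sum]
  exact Finset.sum_congr rfl fun j _ => by rw [h.massWeight_eq, h.cell_eq, mul_smul]

theorem mem_pts_iff (h : S.IsShift ω ω' n τ κ) (x : EuclideanSpace ℝ (Fin d)) :
    τ x ∈ S.pts ω' n ↔ x ∈ S.pts ω n := by
  rw [SelfSimilarLattice.mem_pts_iff, SelfSimilarLattice.mem_pts_iff]
  simp only [h.cell_eq, DilationEquiv.coe_mul, Function.comp_apply,
    EmbeddingLike.apply_eq_iff_eq]

theorem mem_bdry_iff (h : S.IsShift ω ω' n τ κ) (x : EuclideanSpace ℝ (Fin d)) :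
    τ x ∈ S.bdry ω' n ↔ x ∈ S.bdry ω n := by
  unfold bdry
  simp only [Set.mem_image, h.blowUp_eq, DilationEquiv.coe_mul,
    Function.comp_apply, EmbeddingLike.apply_eq_iff_eq]

theorem mem_intPts_iff (h : S.IsShift ω ω' n τ κ) (x : EuclideanSpace ℝ (Fin d)) :
    τ x ∈ S.intPts ω' n ↔ x ∈ S.intPts ω n :=
  and_congr (h.mem_pts_iff x) (not_congr (h.mem_bdry_iff x))

theorem ptMass_eq (h : S.IsShift ω ω' n τ κ) (x : EuclideanSpace ℝ (Fin d)) :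
    S.ptMass ω' n (τ x) = κ * S.ptMass ω n x := by
  unfold ptMass
  rw [h.cellSum_eq, smul_eq_mul]
  simp only [DilationEquiv.coe_mul, Function.comp_apply,
    EmbeddingLike.apply_eq_iff_eq]

theorem opAStage_eq (h : S.IsShift ω ω' n τ κ) (f : EuclideanSpace ℝ (Fin d) → ℂ)
    (x : EuclideanSpace ℝ (Fin d)) :
    S.opAStage ω' n f (τ x) = κ * S.opAStage ω n (f ∘ τ) x := by
  rw [SelfSimilarLattice.opAStage_eq, SelfSimilarLattice.opAStage_eq, h.cellSum_eq,
    Complex.real_smul]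
  unfold cellOp
  simp only [DilationEquiv.coe_mul, Function.comp_apply,
    EmbeddingLike.apply_eq_iff_eq]

/-- Energies and masses are multiplied by the same κ, which cancels in their quotient; this is where
the constancy of the products α β enters. -/
theorem stageOp_comp (h : S.IsShift ω ω' n τ κ) (f : EuclideanSpace ℝ (Fin d) → ℂ) :
    S.stageOp ω' n f ∘ τ = S.stageOp ω n (f ∘ τ) := by
  funext x
  rw [Function.comp_apply, stageOp_apply, stageOp_apply, h.opAStage_eq, h.ptMass_eq]
  have hκ : (κ : ℂ) ≠ 0 := by exact_mod_cast h.pos.ne'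
  push_cast
  rw [← mul_neg, mul_div_mul_left _ _ hκ]

theorem stageOp_pow_comp (h : S.IsShift ω ω' n τ κ) (k : ℕ) (f : EuclideanSpace ℝ (Fin d) → ℂ) :
    (S.stageOp ω' n ^ k) f ∘ τ = (S.stageOp ω n ^ k) (f ∘ τ) := by
  induction k with
  | zero => rfl
  | succ k ih =>
    rw [pow_succ', pow_succ', Module.End.mul_apply, Module.End.mul_apply, h.stageOp_comp, ih]

theorem mem_ndSet_iff (h : S.IsShift ω ω' n τ κ) (w : EuclideanSpace ℝ (Fin d) → ℂ) :
    w ∘ τ ∈ S.ndSet ω n ↔ w ∈ S.ndSet ω' n := by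
  have hs := EquivLike.surjective τ
  refine and_congr ?_ (exists_congr fun t => ?_)
  · rw [hs.forall (p := fun x => x ∉ S.intPts ω' n → w x = 0)]
    simp only [h.mem_intPts_iff, Function.comp_apply]
  · rw [← h.stageOp_comp]
    exact ⟨fun h1 => hs.injective_comp_right h1, fun h1 => by rw [h1]; rfl⟩

theorem mem_removedStage_iff (h : S.IsShift ω ω' n τ κ) (p : Part)
    (w : EuclideanSpace ℝ (Fin d) → ℂ) :
    w ∘ τ ∈ S.removedStage ω n p ↔ w ∈ S.removedStage ω' n p := by
  set L := LinearEquiv.funCongrLeft ℂ ℂ (EquivLike.toEquiv τ)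
  have hL : ∀ w, L w = w ∘ τ := fun w => rfl
  have hbot : w ∘ τ ∈ (⊥ : Submodule ℂ (EuclideanSpace ℝ (Fin d) → ℂ)) ↔
      w ∈ (⊥ : Submodule ℂ (EuclideanSpace ℝ (Fin d) → ℂ)) := by
    rw [Submodule.mem_bot, Submodule.mem_bot, ← hL, L.map_eq_zero_iff]
  cases p
  case ppTilde =>
    have himg : S.ndSet ω n = L '' S.ndSet ω' n := by
      ext v
      constructor
      · intro hv
        refine ⟨L.symm v, (h.mem_ndSet_iff _).1 ?_, L.apply_symm_apply v⟩
        rwa [← hL, L.apply_symm_apply]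
      · rintro ⟨v, hv, rfl⟩
        exact (h.mem_ndSet_iff v).2 hv
    change w ∘ τ ∈ Submodule.span ℂ (S.ndSet ω n) ↔ w ∈ Submodule.span ℂ (S.ndSet ω' n)
    rw [himg, ← hL]
    have hmap := Submodule.map_span L.toLinearMap (S.ndSet ω' n)
    change Submodule.map _ _ = Submodule.span ℂ (L '' S.ndSet ω' n) at hmap
    rw [← hmap]
    exact L.injective.mem_set_image
  all_goals exact hbot

theorem stageDist_eq (h : S.IsShift ω ω' n τ κ) (p : Part) (u : EuclideanSpace ℝ (Fin d) → ℂ) :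
    S.stageDist ω' n p u = κ * S.stageDist ω n p (u ∘ τ) := by
  have hsum : ∀ w : EuclideanSpace ℝ (Fin d) → ℂ,
      ∑ x ∈ S.pts ω' n, S.ptMass ω' n x * ‖u x - w x‖ ^ 2 =
        κ * ∑ x ∈ S.pts ω n, S.ptMass ω n x * ‖(u ∘ τ) x - (w ∘ τ) x‖ ^ 2 := by
    intro w
    rw [Finset.mul_sum]
    refine (Finset.sum_equiv (EquivLike.toEquiv τ) (fun x => (h.mem_pts_iff x).symm)
      fun x _ => ?_).symm
    rw [← mul_assoc, ← h.ptMass_eq]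
    rfl
  unfold stageDist
  rw [← smul_eq_mul, ← Real.sInf_smul_of_nonneg h.pos.le]
  congr 1
  ext r
  constructor
  · rintro ⟨w, hw, rfl⟩
    exact ⟨_, ⟨w ∘ τ, (h.mem_removedStage_iff p w).2 hw, rfl⟩, (hsum w).symm⟩
  · rintro ⟨_, ⟨w, hw, rfl⟩, rfl⟩
    have hw' : (w ∘ τ.symm) ∘ τ = w := by funext x; simp
    refine ⟨w ∘ τ.symm, (h.mem_removedStage_iff p _).1 (by rwa [hw']), ?_⟩
    change ∑ x ∈ S.pts ω' n, S.ptMass ω' n x * ‖u x - (w ∘ τ.symm) x‖ ^ 2 = _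
    rw [hsum, hw']
    rfl

theorem stageMoment_eq (h : S.IsShift ω ω' n τ κ) (p : Part) (k : ℕ)
    (y : EuclideanSpace ℝ (Fin d)) :
    S.stageMoment ω' n p k (τ y) = κ * S.stageMoment ω n p k y := by
  classical
  have hs : (Pi.single (τ y) 1 : EuclideanSpace ℝ (Fin d) → ℂ) ∘ τ = Pi.single y 1 := by
    funext x
    simp [Pi.single_apply]
  have h1 := h.stageOp_pow_comp k (Pi.single (τ y) 1)
  rw [hs] at h1
  unfold stageMoment
  rw [h.stageDist_eq, h.stageDist_eq, Pi.add_comp, Pi.sub_comp, hs, h1]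
  ring

end IsShift

/-- The shift of level `n` is also one of every higher level, so the approximate moments agree up to
κ for all large levels; equal moments with bounded support give equal measures. -/
theorem projSpectralMeasure_of_tail_eq {ω ω' : ℕ → Fin N} (hω : S.bdryInf ω = ∅)
    (hω' : S.bdryInf ω' = ∅) {n : ℕ} {τ : EuclideanSpace ℝ (Fin d) ≃ᵈ EuclideanSpace ℝ (Fin d)}
    {κ : ℝ} (h : S.IsShift ω ω' n τ κ) (hn : ∀ k, n ≤ k → ω k = ω' k) (bc bc' : BoundaryCondition)
    (p : Part) {y : EuclideanSpace ℝ (Fin d)} (hy : y ∈ S.ptsInf ω) :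
    τ y ∈ S.ptsInf ω' ∧ S.projSpectralMeasure ω' bc' p (τ y) =
      ENNReal.ofReal κ • S.projSpectralMeasure ω bc p y := by
  have hy' : τ y ∈ S.ptsInf ω' := by
    obtain ⟨m, hm⟩ := Set.mem_iUnion.1 hy
    exact Set.mem_iUnion.2 ⟨max n m, ((h.of_le hn (le_max_left n m)).mem_pts_iff y).2
      (S.pts_mono ω (le_max_right n m) hm)⟩
  refine ⟨hy', ?_⟩
  have : IsFiniteMeasure (ENNReal.ofReal κ • S.projSpectralMeasure ω bc p y) :=
    Measure.smul_finite _ ENNReal.ofReal_ne_top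
  refine Measure.ext_of_forall_moment_eq (ae_mem_closedBall_projSpectralMeasure ω' bc' p _)
    (Measure.ae_smul_measure (ae_mem_closedBall_projSpectralMeasure ω bc p y) _) fun k => ?_
  rw [integral_smul_measure, ENNReal.toReal_ofReal h.pos.le, smul_eq_mul]
  refine tendsto_nhds_unique (tendsto_stageMoment hω' bc' p k hy')
    (((tendsto_stageMoment hω bc p k hy).const_mul κ).congr' ?_)
  filter_upwards [eventually_ge_atTop n] with m hm
  exact ((h.of_le hn hm).stageMoment_eq p k y).symm

theorem projSpectralMeasure_boundaryCondition {ω : ℕ → Fin N} (hω : S.bdryInf ω = ∅)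
    (bc bc' : BoundaryCondition) (p : Part) {y : EuclideanSpace ℝ (Fin d)} (hy : y ∈ S.ptsInf ω) :
    S.projSpectralMeasure ω bc p y = S.projSpectralMeasure ω bc' p y := by
  have h := (projSpectralMeasure_of_tail_eq hω hω (n := 0)
    (IsShift.of_agree fun k hk => absurd hk (Nat.not_lt_zero k)) (fun _ _ => rfl) bc' bc p hy).2
  rwa [ENNReal.ofReal_one, one_smul] at h

end SelfSimilarLattice

/-- The extraction is not assumed homogeneous; σ and c • σ have the same null sets, so each
dominates the other. -/
theorem IsSpectralType.part_smul_eq_zero_iff {part : Measure ℝ → Measure ℝ}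
    {P : Measure ℝ → Prop} (h : IsSpectralType part P) (σ : Measure ℝ) [IsFiniteMeasure σ] {c : ℝ≥0∞}
    (hc : c ≠ 0) (hc' : c ≠ ⊤) {U : Set ℝ} (hU : MeasurableSet U) :
    part (c • σ) U = 0 ↔ part σ U = 0 := by
  have : IsFiniteMeasure (c • σ) := Measure.smul_finite _ hc'
  constructor
  · intro h0
    exact h.dominationClosed_null U hU Unit (fun _ => c • σ) σ (fun _ => h0) fun B _ hB => by
      have := hB ()
      rw [Measure.smul_apply, smul_eq_mul, mul_eq_zero] at this
      exact this.resolve_left hc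
  · intro h0
    exact h.dominationClosed_null U hU Unit (fun _ => σ) (c • σ) (fun _ => h0) fun B _ hB => by
      rw [Measure.smul_apply, hB (), smul_zero]

theorem measurable_of_agree {N : ℕ} [NeZero N] {γ : Type*} [MeasurableSpace γ]
    {f : (ℕ → Fin N) → γ} (n : ℕ) (h : ∀ ω ω', (∀ k < n, ω k = ω' k) → f ω = f ω') :
    Measurable f := by
  have hf : f = (fun v : Fin n → Fin N => f (prepend v fun _ => 0)) ∘
      fun ω (k : Fin n) => ω k := by
    funext ω
    exact h _ _ fun k hk => (prepend_of_lt (fun k : Fin n => ω k) _ hk).symm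
  rw [hf]
  exact (measurable_of_countable _).comp (measurable_pi_lambda _ fun k => measurable_pi_apply _)

namespace SelfSimilarLattice

variable {d N : ℕ} (S : SelfSimilarLattice d N)

/-! ### The parts of the spectrum -/

/-- The operation extracting the part `p` of a measure on the line. -/
noncomputable def Part.extract : Part → Measure ℝ → Measure ℝ
  | .ac => acPart
  | .sc => scPart
  | .pp => ppPart
  | .ppTilde => ppPart

/-- The measures of the type of the part `p`. -/
def Part.HasType : Part → Measure ℝ → Prop
  | .ac => fun σ => σ ≪ volume
  | .sc => fun σ => σ ⟂ₘ volume ∧ ∀ t, σ {t} = 0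
  | .pp => fun σ => ∃ C : Set ℝ, C.Countable ∧ σ Cᶜ = 0
  | .ppTilde => fun σ => ∃ C : Set ℝ, C.Countable ∧ σ Cᶜ = 0

theorem Part.isSpectralType (p : Part) : IsSpectralType p.extract p.HasType := by
  cases p
  · exact isSpectralType_ac
  · exact isSpectralType_sc
  · exact isSpectralType_pp
  · exact isSpectralType_pp

theorem Part.measurable_extract {Ω : Type*} [MeasurableSpace Ω] (p : Part) {κ : Ω → Measure ℝ}
    (hκ : Measurable κ) [∀ ω, IsFiniteMeasure (κ ω)] : Measurable fun ω => p.extract (κ ω) := by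
  cases p
  · exact hκ.acPart
  · exact hκ.scPart
  · exact hκ.ppPart
  · exact hκ.ppPart

theorem partSpace_eq (ω : ℕ → Fin N) (bc : BoundaryCondition) (p : Part) :
    S.partSpace ω bc p = {f | p.HasType (spectralMeasure (S.laplacian ω bc) f)} ∩
      ((S.removedSpace ω bc p)ᗮ : Submodule ℂ (S.domain ω bc)) := by
  have hbot : ∀ A : Set (S.domain ω bc),
      A = A ∩ ((⊥ : Submodule ℂ (S.domain ω bc))ᗮ : Submodule ℂ (S.domain ω bc)) := fun A => by
    rw [Submodule.bot_orthogonal_eq_top, Submodule.top_coe, Set.inter_univ]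
  cases p
  case ppTilde => rfl
  all_goals exact hbot _

theorem partMeasure_eq (ω : ℕ → Fin N) (bc : BoundaryCondition) (p : Part) (f : S.domain ω bc) :
    S.partMeasure ω bc f p = p.extract (spectralMeasure (S.laplacian ω bc)
      ((S.removedSpace ω bc p)ᗮ.starProjection f)) := by
  have hbot : (⊥ : Submodule ℂ (S.domain ω bc))ᗮ.starProjection f = f := by
    rw [Submodule.starProjection_eq_self_iff, Submodule.bot_orthogonal_eq_top]
    exact Submodule.mem_top
  cases p
  case ppTilde => rfl
  case ac => exact congrArg (fun g => acPart (spectralMeasure (S.laplacian ω bc) g)) hbot.symm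
  case sc => exact congrArg (fun g => scPart (spectralMeasure (S.laplacian ω bc) g)) hbot.symm
  case pp => exact congrArg (fun g => ppPart (spectralMeasure (S.laplacian ω bc) g)) hbot.symm

theorem mem_ptsInf_of_mem_F (ω : ℕ → Fin N) (x : S.F) : (x : EuclideanSpace ℝ (Fin d)) ∈ S.ptsInf ω :=
  Set.mem_iUnion.2 ⟨0, S.mem_pts_iff.2 ⟨Fin.elim0, x, by simp [cell, blowUp]⟩⟩

variable {S}

theorem localMeasure_eq {ω : ℕ → Fin N} (hω : S.bdryInf ω = ∅) (p : Part) :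
    S.localMeasure p ω = ∑ x : S.F,
      (ENNReal.ofReal (S.b x) / (⨆ n, ENNReal.ofReal (S.ptMass ω n x)) ^ 2) •
        p.extract (S.projSpectralMeasure ω .neumann p x) := by
  unfold localMeasure
  refine Finset.sum_congr rfl fun x _ => ?_
  rw [partMeasure_eq, delta_eq_deltaVec hω, S.bInf_singleton (S.mem_ptsInf_of_mem_F ω x)]
  simp only [bStage_singleton]
  rfl

/-- The coefficients are nonzero because b is positive and the masses of points are finite. -/
theorem localMeasure_apply_eq_zero_iff {ω : ℕ → Fin N} (hω : S.bdryInf ω = ∅) (p : Part)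
    (U : Set ℝ) : S.localMeasure p ω U = 0 ↔
      ∀ x : S.F, p.extract (S.projSpectralMeasure ω .neumann p x) U = 0 := by
  unfold localMeasure
  rw [Measure.finsetSum_apply, Finset.sum_eq_zero_iff]
  refine ⟨fun h x => ?_, fun h x _ => ?_⟩
  · have h1 := h x (Finset.mem_univ x)
    rw [Measure.smul_apply, smul_eq_mul, partMeasure_eq, delta_eq_deltaVec hω, mul_eq_zero] at h1
    refine h1.resolve_left ?_
    rw [ENNReal.div_eq_zero_iff, not_or]
    refine ⟨(ENNReal.ofReal_pos.2 (S.b_pos x)).ne', ?_⟩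
    exact ENNReal.pow_ne_top (S.bInf_singleton_ne_top hω (S.mem_ptsInf_of_mem_F ω x))
  · rw [Measure.smul_apply, partMeasure_eq, delta_eq_deltaVec hω, smul_eq_mul]
    exact mul_eq_zero_of_right _ (h x)

variable (S)

theorem ae_good : ∀ᵐ ω ∂blowUpLaw N, S.bdryInf ω = ∅ ∧
    ∀ (n : ℕ) (w : Fin n → Fin N), S.bdryInf (prepend w ω) = ∅ := by
  have := S.neZero
  refine S.ae_bdryInf_eq_empty.and (ae_all_iff.2 fun n => ae_all_iff.2 fun w => ?_)
  exact blowUpLaw_prepend_preimage_eq_zero w (ae_iff.1 S.ae_bdryInf_eq_empty)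

instance (G : Set (ℕ → Fin N)) (bc : BoundaryCondition) (p : Part) (x : EuclideanSpace ℝ (Fin d))
    (ω : ℕ → Fin N) :
    IsFiniteMeasure (G.indicator (fun ω => S.projSpectralMeasure ω bc p x) ω) := by
  by_cases hω : ω ∈ G
  · rw [Set.indicator_of_mem hω]; infer_instance
  · rw [Set.indicator_of_notMem hω]; infer_instance

/-- Each moment is a limit of functions of finitely many letters. The indicator restricts to
sequences with empty boundary, where this convergence is known. -/
theorem measurable_projSpectralMeasure {G : Set (ℕ → Fin N)} (hG : MeasurableSet G)
    (hGS : ∀ ω ∈ G, S.bdryInf ω = ∅) (bc : BoundaryCondition) (p : Part) (x : S.F) :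
    Measurable (G.indicator fun ω => S.projSpectralMeasure ω bc p x) := by
  have := S.neZero
  refine measurable_of_measurable_moments (R := 2 * S.formBound) (fun ω => ?_) fun k => ?_
  · by_cases hω : ω ∈ G
    · have h1 : G.indicator (fun ω => S.projSpectralMeasure ω bc p x) ω =
          S.projSpectralMeasure ω bc p x := Set.indicator_of_mem hω _
      rw [h1]
      exact ae_mem_closedBall_projSpectralMeasure (S := S) ω bc p (x : EuclideanSpace ℝ (Fin d))
    · have h1 : G.indicator (fun ω => S.projSpectralMeasure ω bc p x) ω = 0 :=
        Set.indicator_of_notMem hω _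
      rw [h1, ae_zero]
      exact eventually_bot
  · refine measurable_of_tendsto_metrizable
      (f := fun n => G.indicator fun ω => S.stageMoment ω n p k x) (fun n => ?_) ?_
    · refine Measurable.indicator (measurable_of_agree n fun ω ω' h => ?_) hG
      have h1 := (IsShift.of_agree (S := S) h).stageMoment_eq p k x
      rw [one_mul] at h1
      exact h1.symm
    · rw [tendsto_pi_nhds]
      intro ω
      by_cases hω : ω ∈ G
      · simp only [Set.indicator_of_mem hω]
        exact tendsto_stageMoment (hGS ω hω) bc p k (S.mem_ptsInf_of_mem_F ω x)
      · simp only [Set.indicator_of_notMem hω, integral_zero_measure]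
        exact tendsto_const_nhds

theorem measurable_ptMass (n : ℕ) (x : EuclideanSpace ℝ (Fin d)) :
    Measurable fun ω => S.ptMass ω n x := by
  have := S.neZero
  refine measurable_of_agree n fun ω ω' h => ?_
  have h1 := (IsShift.of_agree (S := S) h).ptMass_eq x
  rw [one_mul] at h1
  exact h1.symm

theorem aemeasurable_localMeasure (p : Part) : AEMeasurable (S.localMeasure p) (blowUpLaw N) := by
  -- A measurable null set containing all sequences with nonempty boundary; off it the random
  -- measure agrees with a measurable one.
  obtain ⟨B, hB, hBm, hB0⟩ := exists_measurable_superset_of_null (ae_iff.1 S.ae_bdryInf_eq_empty)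
  have hGS : ∀ ω ∈ Bᶜ, S.bdryInf ω = ∅ := fun ω hω => by
    by_contra h
    exact hω (hB h)
  refine ⟨fun ω => ∑ x : S.F,
      (ENNReal.ofReal (S.b x) / (⨆ n, ENNReal.ofReal (S.ptMass ω n x)) ^ 2) •
        p.extract (Bᶜ.indicator (fun ω => S.projSpectralMeasure ω .neumann p x) ω), ?_, ?_⟩
  · refine Measure.measurable_of_measurable_coe _ fun s hs => ?_
    simp only [Measure.finsetSum_apply, Measure.smul_apply, smul_eq_mul]
    refine Finset.measurable_fun_sum _ fun x _ => Measurable.mul ?_ ?_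
    · exact measurable_const.div ((Measurable.iSup fun n =>
        (S.measurable_ptMass n x).ennreal_ofReal).pow_const 2)
    · exact (Measure.measurable_coe hs).comp
        (p.measurable_extract (S.measurable_projSpectralMeasure hBm.compl hGS .neumann p x))
  · have hGae : ∀ᵐ ω ∂blowUpLaw N, ω ∈ Bᶜ := by
      rw [ae_iff]
      simpa using hB0
    filter_upwards [hGae] with ω hω
    rw [localMeasure_eq (hGS ω hω)]
    simp only [Set.indicator_of_mem hω]

/-! ### The points charging a set -/

/-- Some point of the infinite lattice has a spectral measure whose part `p` charges `U`. -/
def Charges (p : Part) (U : Set ℝ) (ω : ℕ → Fin N) : Prop :=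
  ∃ y ∈ S.ptsInf ω, p.extract (S.projSpectralMeasure ω .neumann p y) U ≠ 0

theorem isShift_of_blowUp (ω ω' : ℕ → Fin N) (n : ℕ) :
    S.IsShift ω ω' n (S.blowUp ω' n * (S.blowUp ω n)⁻¹)
      ((∏ k : Fin n, (S.β (ω' k))⁻¹) / ∏ k : Fin n, (S.β (ω k))⁻¹) where
  blowUp_eq := by rw [inv_mul_cancel_right]
  prod_eq := (div_mul_cancel₀ _
    (Finset.prod_pos fun (k : Fin n) _ => inv_pos.2 (S.β_mem (ω k)).1).ne').symm

variable {S}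

theorem extract_projSpectralMeasure_eq_zero_iff {ω ω' : ℕ → Fin N} (hω : S.bdryInf ω = ∅)
    (hω' : S.bdryInf ω' = ∅) {n : ℕ} (hn : ∀ k, n ≤ k → ω k = ω' k) (p : Part)
    {y : EuclideanSpace ℝ (Fin d)} (hy : y ∈ S.ptsInf ω) {U : Set ℝ} (hU : MeasurableSet U) :
    p.extract (S.projSpectralMeasure ω' .neumann p (S.blowUp ω' n ((S.blowUp ω n)⁻¹ y))) U = 0 ↔
      p.extract (S.projSpectralMeasure ω .neumann p y) U = 0 := by
  have hs := S.isShift_of_blowUp ω ω' n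
  have h1 := (projSpectralMeasure_of_tail_eq hω hω' hs hn .neumann .neumann p hy).2
  rw [DilationEquiv.coe_mul, Function.comp_apply] at h1
  rw [h1]
  exact p.isSpectralType.part_smul_eq_zero_iff _ (ENNReal.ofReal_pos.2 hs.pos).ne'
    ENNReal.ofReal_ne_top hU

/-- Transport moves the charging point to the other lattice and changes its measure by a positive
factor. -/
theorem Charges.of_tail_eq {p : Part} {U : Set ℝ} (hU : MeasurableSet U) {ω ω' : ℕ → Fin N}
    (h : S.Charges p U ω) (hω : S.bdryInf ω = ∅) (hω' : S.bdryInf ω' = ∅) {n : ℕ}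
    (hn : ∀ k, n ≤ k → ω k = ω' k) : S.Charges p U ω' := by
  obtain ⟨y, hy, hyU⟩ := h
  exact ⟨_, (projSpectralMeasure_of_tail_eq hω hω' (S.isShift_of_blowUp ω ω' n) hn
    .neumann .neumann p hy).1, mt (extract_projSpectralMeasure_eq_zero_iff hω hω' hn p hy hU).1 hyU⟩

variable (S)

/-- Every point of the infinite lattice is moved into `F` by a change of the first letters. -/
theorem exists_prepend_blowUp_mem_F {ω : ℕ → Fin N} {y : EuclideanSpace ℝ (Fin d)}
    (hy : y ∈ S.ptsInf ω) : ∃ (n : ℕ) (w : Fin n → Fin N) (x : S.F),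
      S.blowUp (prepend w ω) n ((S.blowUp ω n)⁻¹ y) = x := by
  obtain ⟨n, hn⟩ := Set.mem_iUnion.1 hy
  obtain ⟨j, z, rfl⟩ := S.mem_pts_iff.1 hn
  -- The blow-up composes inverses, so reading the word of the cell backwards makes it the inverse
  -- of the cell map.
  refine ⟨n, fun k => j (Fin.rev k), z, ?_⟩
  have hinv : S.blowUp (prepend (fun k => j (Fin.rev k)) ω) n =
      ((List.ofFn fun k : Fin n => S.Ψ (j k)).prod)⁻¹ := by
    rw [List.prod_inv_reverse, blowUp]
    congr 1
    refine List.ext_getElem (by simp) fun k hk _ => ?_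
    rw [List.length_ofFn] at hk
    simp only [List.getElem_ofFn, List.getElem_reverse, List.getElem_map, List.length_map,
      List.length_ofFn, prepend_of_lt _ _ hk]
    congr 3
    ext
    simp only [Fin.val_rev]
    omega
  rw [hinv]
  change (((List.ofFn fun k : Fin n => S.Ψ (j k)).prod)⁻¹ * ((S.blowUp ω n)⁻¹ * S.cell ω j)) z = z
  rw [cell, inv_mul_cancel_left, inv_mul_cancel]
  rfl

/-- If the mean measure vanishes on U, so does almost surely the local measure of every modification
of ω; a charging point moved into F would contradict this. If it does not vanish, almost every ω has
a modification whose local measure charges U, and the charge is carried back to ω. -/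
theorem ae_charges_iff (p : Part) {U : Set ℝ} (hU : MeasurableSet U) :
    ∀ᵐ ω ∂blowUpLaw N, S.Charges p U ω ↔ S.partDensity p U ≠ 0 := by
  have := S.neZero
  have hm := S.aemeasurable_localMeasure p
  have hmU : AEMeasurable (fun ω => S.localMeasure p ω U) (blowUpLaw N) :=
    (Measure.measurable_coe hU).comp_aemeasurable hm
  have hD : S.partDensity p U = ∫⁻ ω, S.localMeasure p ω U ∂blowUpLaw N :=
    Measure.bind_apply hU hm
  by_cases h0 : S.partDensity p U = 0
  · rw [hD, lintegral_eq_zero_iff' hmU] at h0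
    have h1 : ∀ᵐ ω ∂blowUpLaw N, ∀ (n : ℕ) (w : Fin n → Fin N),
        S.localMeasure p (prepend w ω) U = 0 :=
      ae_all_iff.2 fun n => ae_all_iff.2 fun w =>
        blowUpLaw_prepend_preimage_eq_zero w (ae_iff.1 h0)
    filter_upwards [h1, S.ae_good] with ω hω hgood
    rw [hD, lintegral_eq_zero_iff' hmU |>.2 h0]
    refine iff_of_false ?_ (fun h => h rfl)
    rintro ⟨y, hy, hyU⟩
    obtain ⟨n, w, x, hx⟩ := S.exists_prepend_blowUp_mem_F hy
    refine hyU ((extract_projSpectralMeasure_eq_zero_iff hgood.1 (hgood.2 n w)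
      (fun k hk => (prepend_of_le w ω hk).symm) p hy hU).1 ?_)
    rw [hx]
    exact (localMeasure_apply_eq_zero_iff (hgood.2 n w) p U).1 (hω n w) x
  -- The zero-one argument needs a measurable event, hence a measurable version of the random mass,
  -- valid along all modifications of almost every ω.
  · set g := hmU.mk _
    have hgm : Measurable g := hmU.measurable_mk
    have hg : (fun ω => S.localMeasure p ω U) =ᵐ[blowUpLaw N] g := hmU.ae_eq_mk
    have hpos : blowUpLaw N {ω | g ω ≠ 0} ≠ 0 := by
      intro h
      refine h0 ?_
      rw [hD, lintegral_congr_ae hg]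
      exact (lintegral_eq_zero_iff hgm).2 (ae_iff.2 h)
    have h1 : ∀ᵐ ω ∂blowUpLaw N, ∀ (n : ℕ) (w : Fin n → Fin N),
        S.localMeasure p (prepend w ω) U = g (prepend w ω) :=
      ae_all_iff.2 fun n => ae_all_iff.2 fun w =>
        blowUpLaw_prepend_preimage_eq_zero w (ae_iff.1 hg)
    have h2 := ae_exists_prepend_mem (D := {ω | g ω ≠ 0})
      (hgm (measurableSet_singleton 0)).compl hpos
    filter_upwards [h1, h2, S.ae_good] with ω hω1 hω2 hgood
    refine iff_of_true ?_ h0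
    obtain ⟨n, w, hw⟩ := hω2
    have hw' : S.localMeasure p (prepend w ω) U ≠ 0 := by
      rw [hω1]; exact hw
    rw [Ne, localMeasure_apply_eq_zero_iff (hgood.2 n w), not_forall] at hw'
    obtain ⟨x, hx⟩ := hw'
    have hch : S.Charges p U (prepend w ω) := ⟨x, S.mem_ptsInf_of_mem_F _ x, hx⟩
    exact hch.of_tail_eq hU (hgood.2 n w) hgood.1 fun k hk => prepend_of_le w ω hk

variable {S}

theorem mem_partSpectrum_iff {ω : ℕ → Fin N} (hω : S.bdryInf ω = ∅) (bc : BoundaryCondition)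
    (p : Part) (t : ℝ) : t ∈ S.partSpectrum ω bc p ↔
      ∀ ε > 0, S.Charges p (Set.Ioo (t - ε) (t + ε)) ω := by
  unfold partSpectrum
  rw [partSpace_eq, mem_restrictedSpectrum_iff (S.laplacian_isSelfAdjoint ω bc) p.isSpectralType
    (laplacian_mem_removedSpace hω) (fun x : S.ptsInf ω => S.deltaVec ω bc x)
    (topologicalClosure_span_deltaVec hω bc)]
  refine forall₂_congr fun ε _ => ?_
  unfold Charges
  rw [Subtype.exists]
  refine exists_congr fun y => ?_
  refine (exists_congr fun hy => ?_).trans exists_prop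
  rw [projSpectralMeasure_boundaryCondition hω .neumann bc p hy]
  rfl

variable (S)

/-- The equivalence for a single interval has an exceptional null set. Rational endpoints leave only
countably many, and any interval around t contains a rational one around t, which in turn contains a
symmetric one. -/
theorem ae_partSpectrum_eq_support (p : Part) (bc : BoundaryCondition) :
    ∀ᵐ ω ∂blowUpLaw N, S.partSpectrum ω bc p = (S.partDensity p).support := by
  have h1 : ∀ᵐ ω ∂blowUpLaw N, ∀ a b : ℚ, S.Charges p (Set.Ioo (a : ℝ) b) ω ↔
      S.partDensity p (Set.Ioo (a : ℝ) b) ≠ 0 :=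
    ae_all_iff.2 fun a => ae_all_iff.2 fun b => S.ae_charges_iff p measurableSet_Ioo
  filter_upwards [h1, S.ae_bdryInf_eq_empty] with ω h1 hω
  ext t
  rw [mem_partSpectrum_iff hω, (Metric.nhds_basis_ball (x := t)).mem_measureSupport]
  simp only [Real.ball_eq_Ioo]
  constructor
  · intro h ε hε
    obtain ⟨a, ha, ha'⟩ := exists_rat_btwn (show t - ε < t by linarith)
    obtain ⟨b, hb, hb'⟩ := exists_rat_btwn (show t < t + ε by linarith)
    have hδ : 0 < min (t - a) (b - t) := lt_min (by linarith) (by linarith)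
    obtain ⟨y, hy, hyU⟩ := h _ hδ
    have hsub : Set.Ioo (t - min (t - (a : ℝ)) (b - t)) (t + min (t - (a : ℝ)) (b - t)) ⊆
        Set.Ioo (a : ℝ) b := Set.Ioo_subset_Ioo
      (by linarith [min_le_left (t - (a : ℝ)) (b - t)])
      (by linarith [min_le_right (t - (a : ℝ)) (b - t)])
    have h2 := (h1 a b).1 ⟨y, hy, fun h0 => hyU (measure_mono_null hsub h0)⟩
    exact (pos_iff_ne_zero.2 h2).trans_le (measure_mono (Set.Ioo_subset_Ioo ha.le hb'.le))
  · intro h ε hε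
    obtain ⟨a, ha, ha'⟩ := exists_rat_btwn (show t - ε < t by linarith)
    obtain ⟨b, hb, hb'⟩ := exists_rat_btwn (show t < t + ε by linarith)
    have hδ : 0 < min (t - a) (b - t) := lt_min (by linarith) (by linarith)
    have hsub : Set.Ioo (t - min (t - (a : ℝ)) (b - t)) (t + min (t - (a : ℝ)) (b - t)) ⊆
        Set.Ioo (a : ℝ) b := Set.Ioo_subset_Ioo
      (by linarith [min_le_left (t - (a : ℝ)) (b - t)])
      (by linarith [min_le_right (t - (a : ℝ)) (b - t)])
    obtain ⟨y, hy, hyU⟩ := (h1 a b).2 ((h _ hδ).trans_le (measure_mono hsub)).ne'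
    exact ⟨y, hy, fun h0 => hyU (measure_mono_null (Set.Ioo_subset_Ioo ha.le hb'.le) h0)⟩

end SelfSimilarLattice

theorem proposition4 {d N : ℕ} (S : SelfSimilarLattice d N) :
    (∀ p : SelfSimilarLattice.Part,
      AEMeasurable (S.localMeasure p) (SelfSimilarLattice.blowUpLaw N)) ∧
    (∀ bc : BoundaryCondition, ∀ᵐ ω ∂SelfSimilarLattice.blowUpLaw N,
      S.partSpectrum ω bc .ac = (S.partDensity .ac).support) ∧
    (∀ bc : BoundaryCondition, ∀ᵐ ω ∂SelfSimilarLattice.blowUpLaw N,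
      S.partSpectrum ω bc .sc = (S.partDensity .sc).support) ∧
    (∀ bc : BoundaryCondition, ∀ᵐ ω ∂SelfSimilarLattice.blowUpLaw N,
      S.partSpectrum ω bc .pp = (S.partDensity .pp).support) ∧
    (∀ bc : BoundaryCondition, ∀ᵐ ω ∂SelfSimilarLattice.blowUpLaw N,
      S.partSpectrum ω bc .ppTilde = (S.partDensity .ppTilde).support) :=
  ⟨S.aemeasurable_localMeasure, S.ae_partSpectrum_eq_support .ac, S.ae_partSpectrum_eq_support .sc,
    S.ae_partSpectrum_eq_support .pp, S.ae_partSpectrum_eq_support .ppTilde⟩
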